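/- Conventions. Integers are written in binary with a sign bit, and "computable in polynomial time" means: by a (multi-tape) Turing machine whose number of steps is bounded by a polynomial in the quantity indicated. A real number $r$ is polynomial-time computable if there are integers $r_n$ ($n\in\mathbb N$), computable in time polynomial in $n$, with $|r-r_n/2^n|\le 2^{-n}$ for all $n$. For $f\in L^2[0,1]$ (complex-valued) let $\tilde f_k=\int_0^1 e^{-2\pi i k x}f(x)\,dx$ ($k\in\mathbb Z$) and $\mathcal F_K(f)(x)=\sum_{|k|\le K}\tilde f_k e^{2\pi i k x}$. Call $f$ Fourier-computable in polynomial time if (i) there are Gaussian integers $c_{k,n}\in\mathbb Z+i\mathbb Z$ ($k\in\mathbb Z$, $n\in\mathbb N$) with $|\tilde f_k-c_{k,n}/2^n|\le 2^{-n}$ for all $k,n$, such that (ii) both $(n,k)\mapsto\operatorname{Re}c_{k,n}$ and $(n,k)\mapsto\operatorname{Im}c_{k,n}$ are computable in time polynomial in $n+\log|k|$ (that is, in the length of the input $1^n0\,\mathrm{bin}(k)$), and (iii) there is a polynomial $p$ with coefficients in $\mathbb N$ such that $\|f-\mathcal F_{2^{p(m)}}(f)\|_{L^2[0,1]}\le 2^{-m}$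 for all $m\in\mathbb N$. A solution of the periodic heat equation with initial datum $f\in L^2[0,1]$ is a function $u(x,s)$, $x\in\mathbb R$, $s>0$, that is $1$-periodic in $x$, continuous together with its partial derivatives $u_x,u_{xx},u_s$, satisfies $u_s=u_{xx}$ for all $x\in\mathbb R$, $s>0$, and attains the initial datum in the sense that $\|u(\cdot,s)-f\|_{L^2[0,1]}\to0$ as $s\downarrow0$. Theorem. Let $t>0$ be a polynomial-time computable real number, and let $f\in L^2[0,1]$ be Fourier-computable in polynomial time. Then the periodic heat equation with initial datum $f$ has a solution $u$, this solution is unique, and $u(\cdot,t)$ is again Fourier-computable in polynomial time. -/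

import Mathlib

noncomputable section

open MeasureTheory Filter Topology

namespace PeriodicHeat

/-! ### Polynomial-time computability on Turing machines -/

/-- `f` is computed in polynomial time by a (finite, multi-stack) Turing machine, where arguments
are presented as the bit strings `ea a`, values as the bit strings `eb b`, and time is the number
of machine steps, bounded by a polynomial in the length of the input string. -/
def PolyTime {α β : Type} (ea : α → List Bool) (eb : β → List Bool) (f : α → β) : Prop :=
  Nonempty (Turing.TM2ComputableInPolyTime ea eb f)

/-- Sign bit (`true` for negative integers), followed by the binary digits of the absolute value. -/
def encodeInt (z : ℤ) : List Bool :=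
  decide (z < 0) :: Computability.encodeNat z.natAbs

/-- The word `1ⁿ`, so that polynomial in its length means polynomial in `n`. -/
def encodeUnary (n : ℕ) : List Bool :=
  List.replicate n true

/-- The word `1ⁿ 0 bin(k)`, so that polynomial in its length means polynomial in `n + log |k|`. -/
def encodeIndex (p : ℕ × ℤ) : List Bool :=
  List.replicate p.1 true ++ false :: encodeInt p.2

/-- The real number `r` is polynomial-time computable: some machine produces, in time polynomial
in `n`, an integer `a n` with `|r - a n / 2 ^ n| ≤ 2 ^ (-n)`. -/
def PolyTimeReal (r : ℝ) : Prop :=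
  ∃ a : ℕ → ℤ, (∀ n, |r - (a n : ℝ) / 2 ^ n| ≤ 1 / 2 ^ n) ∧ PolyTime encodeUnary encodeInt a

/-! ### Fourier series on the unit interval -/

/-- Lebesgue measure on the unit interval. -/
def unitMeasure : Measure ℝ :=
  volume.restrict (Set.Icc 0 1)

/-- The `k`-th Fourier coefficient `∫₀¹ exp(-2πikx) f(x) dx`. -/
def fourierCoefficient (f : ℝ → ℂ) (k : ℤ) : ℂ :=
  ∫ x, Complex.exp (-(2 * Real.pi * Complex.I * k * x)) * f x ∂unitMeasure

/-- The Fourier partial sum over all `|k| ≤ K`. -/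
def fourierPartialSum (f : ℝ → ℂ) (K : ℕ) (x : ℝ) : ℂ :=
  ∑ k ∈ Finset.Icc (-(K : ℤ)) K,
    fourierCoefficient f k * Complex.exp (2 * Real.pi * Complex.I * k * x)

/-- `f`, regarded as an element of `L²[0,1]`, is Fourier-computable in polynomial time. -/
structure FourierPolyTime (f : ℝ → ℂ) : Prop where
  memLp : MemLp f 2 unitMeasure
  approx : ∃ c : ℤ → ℕ → GaussianInt,
    (∀ k n, ‖fourierCoefficient f k - GaussianInt.toComplex (c k n) / 2 ^ n‖ ≤ 1 / 2 ^ n) ∧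
    PolyTime encodeIndex encodeInt (fun p => (c p.2 p.1).re) ∧
    PolyTime encodeIndex encodeInt (fun p => (c p.2 p.1).im)
  tail : ∃ q : Polynomial ℕ, ∀ m : ℕ,
    eLpNorm (fun x => f x - fourierPartialSum f (2 ^ q.eval m) x) 2 unitMeasure ≤
      ENNReal.ofReal (1 / 2 ^ m)

/-! ### The periodic heat equation -/

/-- `u x t` solves `u_t = u_xx` for `t > 0` classically (with `u_x`, `u_xx`, hence also `u_t`,
continuous), is 1-periodic in `x`, and attains the initial datum `f` in the sense of `L²[0,1]`
as `t` decreases to `0`. Only the values of `u` at times `t > 0` matter. -/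
structure IsHeatSolution (f : ℝ → ℂ) (u : ℝ → ℝ → ℂ) : Prop where
  periodic : ∀ x t, 0 < t → u (x + 1) t = u x t
  continuousOn : ContinuousOn (Function.uncurry u) (Set.univ ×ˢ Set.Ioi 0)
  equation : ∃ ux uxx : ℝ → ℝ → ℂ,
    ContinuousOn (Function.uncurry ux) (Set.univ ×ˢ Set.Ioi 0) ∧
    ContinuousOn (Function.uncurry uxx) (Set.univ ×ˢ Set.Ioi 0) ∧
    ∀ x t, 0 < t →
      HasDerivAt (fun y => u y t) (ux x t) x ∧
      HasDerivAt (fun y => ux y t) (uxx x t) x ∧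
      HasDerivAt (fun s => u x s) (uxx x t) t
  initial : Tendsto (fun t => eLpNorm (fun x => u x t - f x) 2 unitMeasure) (𝓝[>] 0) (𝓝 0)

end PeriodicHeat

end

/-! The heat flow is diagonal in Fourier space: it multiplies the `k`-th coefficient by
`exp(-4π²k²s)`, called `decay k s`.

Existence. For `s > 0` the Gaussian factor beats every power of `k`, locally uniformly in `s`. The
series `heatSeries` may therefore be differentiated termwise, and the heat equation holds for each
term. Parseval and dominated convergence give the initial datum (`tendsto_eLpNorm_heatSeries_sub`).

Uniqueness. Differentiation under the integral and integration by parts turn the equation into the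
ODE `c' = (2πik)² c` for the `k`-th coefficient of an arbitrary solution. Convergence in `L²` fixes
its limit at time `0`, so the coefficient is known (`IsHeatSolution.fourierCoefficient_eq`), and a
continuous periodic function is determined by its coefficients.

Computability. Since `decay ≤ 1`, the tail bound of `f` is inherited with the same polynomial
(`eLpNorm_sub_fourierPartialSum_le`). What remains is to compute `exp(-sk²)`, `s = 4π²t`, to `n`
bits in time polynomial in `n + log |k|`. The exponent may be exponentially large in the length of
the input, so the power series is of no use. Instead `exp(-x)` is approximated by `(1 -
x/2^m)^(2^m)` with error `x²/2^m`; for `m = n + O(log |k|)` this takes `m` squarings in fixed-point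
arithmetic with `O(m)` bits (`exists_exp_approx`). The number `π` comes from `π/4 = arctan(1/2) +
arctan(1/3)`.

Machines. Polynomial time refers to concrete stack machines, so a small programming calculus is
built on them. The relation `Computes x y` between word-valued functions contains all finite
transducers and is closed under composition (`Computes.trans`), pairing (`Computes.pair`) and
iteration with polynomially long intermediate words (`computes_iterate`). Branching and bounded
recursion (`Computes.natRec`) follow, and binary arithmetic is programmed with these alone. -/

noncomputable section

namespace PeriodicHeat

open Turing

/-! ### Runs of stack machines in bounded time -/

section Runs

variable {K : Type} [DecidableEq K] {Γ : K → Type} {Λ σ : Type}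

/-- The machine `M` gets from `c` to `c'` in at most `t` steps. -/
def RunsWithin (M : Λ → TM2.Stmt Γ Λ σ) (t : ℕ) (c c' : TM2.Cfg Γ Λ σ) : Prop :=
  ∃ n ≤ t, (flip bind (TM2.step M))^[n] (some c) = some c'

variable {M : Λ → TM2.Stmt Γ Λ σ}

theorem RunsWithin.refl (c : TM2.Cfg Γ Λ σ) : RunsWithin M 0 c c :=
  ⟨0, le_rfl, rfl⟩

theorem RunsWithin.trans {t₁ t₂ : ℕ} {a b c : TM2.Cfg Γ Λ σ}
    (h₁ : RunsWithin M t₁ a b) (h₂ : RunsWithin M t₂ b c) : RunsWithin M (t₁ + t₂) a c := by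
  obtain ⟨n₁, hn₁, h₁⟩ := h₁
  obtain ⟨n₂, hn₂, h₂⟩ := h₂
  exact ⟨n₂ + n₁, by omega, by rw [Function.iterate_add_apply, h₁, h₂]⟩

theorem RunsWithin.mono {t₁ t₂ : ℕ} {a b : TM2.Cfg Γ Λ σ}
    (h : RunsWithin M t₁ a b) (ht : t₁ ≤ t₂) : RunsWithin M t₂ a b := by
  obtain ⟨n, hn, h⟩ := h
  exact ⟨n, hn.trans ht, h⟩

theorem RunsWithin.single {l : Λ} {v : σ} {S : ∀ k, List (Γ k)} {c : TM2.Cfg Γ Λ σ}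
    (h : TM2.stepAux (M l) v S = c) : RunsWithin M 1 ⟨some l, v, S⟩ c :=
  ⟨1, le_rfl, by simp [flip, TM2.step, h]⟩

theorem RunsWithin.head {t : ℕ} {l : Λ} {v : σ} {S : ∀ k, List (Γ k)} {b c : TM2.Cfg Γ Λ σ}
    (h : TM2.stepAux (M l) v S = b) (h' : RunsWithin M t b c) :
    RunsWithin M (t + 1) ⟨some l, v, S⟩ c :=
  ((RunsWithin.single h).trans h').mono (by omega)

/-- The number of symbols that a statement pushes at most. -/
def pushCount : TM2.Stmt Γ Λ σ → ℕ
  | .push _ _ q => pushCount q + 1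
  | .peek _ _ q => pushCount q
  | .pop _ _ q => pushCount q
  | .load _ q => pushCount q
  | .branch _ q₁ q₂ => pushCount q₁ + pushCount q₂
  | .goto _ => 0
  | .halt => 0

theorem length_stepAux_le (q : TM2.Stmt Γ Λ σ) (v : σ) (S : ∀ k, List (Γ k)) (k : K) :
    ((TM2.stepAux q v S).stk k).length ≤ (S k).length + pushCount q := by
  induction q generalizing v S with
  | push k' f q ih =>
    refine (ih _ _).trans ?_
    by_cases h : k = k'
    · subst h; simp [pushCount]; omega
    · simp [pushCount, Function.update_of_ne h]
  | peek k' f q ih => exact ih _ _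
  | pop k' f q ih =>
    refine (ih _ _).trans ?_
    by_cases h : k = k'
    · subst h; simp [pushCount]
    · simp [pushCount, Function.update_of_ne h]
  | load a q ih => exact ih _ _
  | branch f q₁ q₂ ih₁ ih₂ =>
    simp only [TM2.stepAux, pushCount]
    cases f v
    · exact (ih₂ _ _).trans (by omega)
    · exact (ih₁ _ _).trans (by omega)
  | goto l => simp [pushCount]
  | halt => simp [pushCount]

theorem length_iterate_step_le {C : ℕ} (hC : ∀ l, pushCount (M l) ≤ C) (k : K) (n : ℕ)
    (c c' : TM2.Cfg Γ Λ σ) (h : (flip bind (TM2.step M))^[n] (some c) = some c') :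
    (c'.stk k).length ≤ (c.stk k).length + C * n := by
  induction n generalizing c with
  | zero => simp only [Function.iterate_zero, id, Option.some.injEq] at h; subst h; simp
  | succ n ih =>
    rw [Function.iterate_succ_apply] at h
    obtain ⟨l, v, S⟩ := c
    cases l with
    | none =>
      -- A halted configuration has no successor, so it cannot start a run of positive length.
      have : ∀ m, (flip bind (TM2.step M))^[m] none = none := fun m => by
        induction m with
        | zero => rfl
        | succ m ih => rw [Function.iterate_succ_apply']; rw [ih]; rfl
      exact absurd ((this n).symm.trans h) (by simp)
    | some l =>
      have h1 := ih (TM2.stepAux (M l) v S) h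
      have h2 := length_stepAux_le (M l) v S k
      have h3 := hC l
      simp only at *
      rw [Nat.mul_succ]
      omega

/-- A step pushes a bounded number of symbols, so a time bound is also a bound for the length of the
output. -/
theorem RunsWithin.length_le {C t : ℕ} (hC : ∀ l, pushCount (M l) ≤ C) {k : K}
    {c c' : TM2.Cfg Γ Λ σ} (h : RunsWithin M t c c') :
    (c'.stk k).length ≤ (c.stk k).length + C * t := by
  obtain ⟨n, hn, h⟩ := h
  exact (length_iterate_step_le hC k n c c' h).trans (by gcongr)

end Runs

/-! ### Polynomial-time relations between word-valued functions -/

/-- `y a` is computed from `x a` on a Turing machine, in time polynomial in the length of `x a`. -/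
def Computes {α : Type} (x y : α → List Bool) : Prop :=
  PolyTime x y (fun a => a)

/-- A stack content with at most one nonempty stack. -/
def soloStack {K : Type} [DecidableEq K] {Γ : K → Type} (k : K) (e : Γ k ≃ Bool) (l : List Bool) :
    ∀ k, List (Γ k) :=
  Function.update (fun _ => []) k (l.map e.symm)

theorem initList_stk (tm : FinTM2) (e : tm.Γ tm.k₀ ≃ Bool) (l : List Bool) :
    initList tm (l.map e.invFun) = ⟨some tm.main, tm.initialState, soloStack tm.k₀ e l⟩ := by
  unfold initList soloStack
  congr 1
  funext k
  by_cases h : k = tm.k₀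
  · subst h; simp
  · simp [h]

theorem haltList_stk (tm : FinTM2) (e : tm.Γ tm.k₁ ≃ Bool) (l : List Bool) :
    haltList tm (l.map e.invFun) = ⟨none, tm.initialState, soloStack tm.k₁ e l⟩ := by
  unfold haltList soloStack
  congr 1
  funext k
  by_cases h : k = tm.k₁
  · subst h; simp
  · simp [h]

/-- Only the input word and the output word matter to a machine. With a common index type for both,
intermediate results can be composed and paired without types of their own. -/
theorem polyTime_iff {α β : Type} {x : α → List Bool} {y : β → List Bool} {f : α → β} :
    PolyTime x y f ↔ Computes x (fun a => y (f a)) := by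
  constructor
  · rintro ⟨⟨M, t, h⟩⟩; exact ⟨⟨M, t, h⟩⟩
  · rintro ⟨⟨M, t, h⟩⟩; exact ⟨⟨M, t, h⟩⟩

/-- The machine has to halt in its initial internal state with all stacks but the output stack
empty. This is what allows it to serve as a subroutine, even repeatedly. -/
theorem computes_iff {α : Type} {x y : α → List Bool} :
    Computes x y ↔ ∃ (tm : FinTM2) (e₀ : tm.Γ tm.k₀ ≃ Bool) (e₁ : tm.Γ tm.k₁ ≃ Bool)
      (p : Polynomial ℕ), ∀ a, RunsWithin tm.m (p.eval (x a).length)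
        ⟨some tm.main, tm.initialState, soloStack tm.k₀ e₀ (x a)⟩
        ⟨none, tm.initialState, soloStack tm.k₁ e₁ (y a)⟩ := by
  constructor
  · rintro ⟨⟨⟨tm, e₀, e₁⟩, p, h⟩⟩
    refine ⟨tm, e₀, e₁, p, fun a => ?_⟩
    obtain ⟨⟨n, hn⟩, hle⟩ := h a
    refine ⟨n, hle, ?_⟩
    rw [← initList_stk, ← haltList_stk]
    exact hn
  · rintro ⟨tm, e₀, e₁, p, h⟩
    refine ⟨⟨⟨tm, e₀, e₁⟩, p, fun a => Classical.choice ?_⟩⟩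
    obtain ⟨n, hle, hn⟩ := h a
    rw [← initList_stk, ← haltList_stk] at hn
    exact ⟨⟨⟨n, hn⟩, hle⟩⟩

theorem exists_pushCount_le (tm : FinTM2) : ∃ C, ∀ l, pushCount (tm.m l) ≤ C := by
  have := tm.ΛFin
  obtain ⟨C, hC⟩ := (Set.finite_range fun l => pushCount (tm.m l)).bddAbove
  exact ⟨C, fun l => hC ⟨l, rfl⟩⟩

/-- `g` is bounded by a polynomial in the length of `x`. -/
def PolyBounded {α : Type} (x : α → List Bool) (g : α → ℕ) : Prop :=
  ∃ p : Polynomial ℕ, ∀ a, g a ≤ p.eval (x a).length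

namespace PolyBounded

variable {α β : Type} {x y : α → List Bool} {f g : α → ℕ}

theorem mono (h : PolyBounded x g) (hf : ∀ a, f a ≤ g a) : PolyBounded x f := by
  obtain ⟨p, hp⟩ := h
  exact ⟨p, fun a => (hf a).trans (hp a)⟩

theorem const (c : ℕ) : PolyBounded x (fun _ => c) :=
  ⟨Polynomial.C c, fun a => by simp⟩

theorem length : PolyBounded x (fun a => (x a).length) :=
  ⟨Polynomial.X, fun a => by simp⟩

theorem add (hf : PolyBounded x f) (hg : PolyBounded x g) : PolyBounded x (fun a => f a + g a) := by
  obtain ⟨p, hp⟩ := hf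
  obtain ⟨q, hq⟩ := hg
  exact ⟨p + q, fun a => by simpa using Nat.add_le_add (hp a) (hq a)⟩

theorem mul (hf : PolyBounded x f) (hg : PolyBounded x g) : PolyBounded x (fun a => f a * g a) := by
  obtain ⟨p, hp⟩ := hf
  obtain ⟨q, hq⟩ := hg
  exact ⟨p * q, fun a => by simpa using Nat.mul_le_mul (hp a) (hq a)⟩

end PolyBounded

theorem eval_mono (p : Polynomial ℕ) {m n : ℕ} (h : m ≤ n) : p.eval m ≤ p.eval n := by
  simp only [Polynomial.eval_eq_sum_range]
  gcongr

theorem PolyBounded.eval {α : Type} {x : α → List Bool} {g : α → ℕ} (h : PolyBounded x g)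
    (p : Polynomial ℕ) : PolyBounded x (fun a => p.eval (g a)) := by
  obtain ⟨q, hq⟩ := h
  exact ⟨p.comp q, fun a => by rw [Polynomial.eval_comp]; exact eval_mono p (hq a)⟩

theorem PolyBounded.trans {α : Type} {x y : α → List Bool} {g : α → ℕ} (h : PolyBounded y g)
    (hy : PolyBounded x (fun a => (y a).length)) : PolyBounded x g := by
  obtain ⟨p, hp⟩ := h
  exact (hy.eval p).mono hp

theorem Computes.polyBounded {α : Type} {x y : α → List Bool} (h : Computes x y) :
    PolyBounded x (fun a => (y a).length) := by
  obtain ⟨tm, e₀, e₁, p, h⟩ := computes_iff.1 h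
  obtain ⟨C, hC⟩ := exists_pushCount_le tm
  refine ⟨Polynomial.X + Polynomial.C C * p, fun a => ?_⟩
  have := (h a).length_le hC (k := tm.k₁)
  simp only [soloStack, Function.update_self, List.length_map] at this
  refine this.trans ?_
  simp only [Polynomial.eval_add, Polynomial.eval_X, Polynomial.eval_mul, Polynomial.eval_C]
  gcongr
  -- The output stack may be the input stack, which is not empty at the start.
  by_cases hk : tm.k₁ = tm.k₀
  · have : ∀ (k) (hk : k = tm.k₀), (Function.update (fun k => ([] : List (tm.Γ k))) tm.k₀
        (List.map (⇑e₀.symm) (x a)) k).length ≤ (x a).length := by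
      rintro k rfl; simp
    exact this _ hk
  · simp [Function.update_of_ne hk]

theorem Computes.refl {α : Type} (x : α → List Bool) : Computes x x :=
  ⟨idComputableInPolyTime x⟩

theorem Computes.of_eq {α : Type} {x x' y y' : α → List Bool} (h : Computes x y)
    (hx : ∀ a, x' a = x a) (hy : ∀ a, y' a = y a) : Computes x' y' := by
  obtain rfl : x' = x := funext hx
  obtain rfl : y' = y := funext hy
  exact h

/-- Reindexing costs nothing, since the time bound depends on the input word only. Together with
`Computes.trans` it expresses the call of a known routine with computed arguments. -/
theorem Computes.comp {α β : Type} {x y : α → List Bool} (h : Computes x y) (f : β → α) :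
    Computes (fun b => x (f b)) (fun b => y (f b)) := by
  obtain ⟨tm, e₀, e₁, p, h⟩ := computes_iff.1 h
  exact computes_iff.2 ⟨tm, e₀, e₁, p, fun b => h (f b)⟩

end PeriodicHeat
end

noncomputable section

namespace PeriodicHeat

open Turing

/-! ### Sequential transducers -/

section PushAll

variable {K : Type} [DecidableEq K] {Γ : K → Type} {Λ σ : Type}

/-- Push the first `n` symbols of the word `f v` so that its first symbol ends up on top. -/
def pushAll (k : K) (f : σ → List (Γ k)) (d : Γ k) : ℕ → TM2.Stmt Γ Λ σ → TM2.Stmt Γ Λ σ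
  | 0, q => q
  | n + 1, q =>
    .branch (fun v => decide (n < (f v).length))
      (.push k (fun v => (f v).getD n d) (pushAll k f d n q)) (pushAll k f d n q)

theorem stepAux_pushAll (k : K) (f : σ → List (Γ k)) (d : Γ k) (n : ℕ) (q : TM2.Stmt Γ Λ σ)
    (v : σ) (S : ∀ k, List (Γ k)) :
    TM2.stepAux (pushAll k f d n q) v S =
      TM2.stepAux q v (Function.update S k ((f v).take n ++ S k)) := by
  induction n generalizing S with
  | zero => simp [pushAll]
  | succ n ih =>
    by_cases h : n < (f v).length
    · simp only [pushAll, TM2.stepAux, h, decide_true, cond_true, ih, Function.update_self,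
        Function.update_idem]
      congr 2
      rw [List.take_add_one, List.getD_eq_getElem _ _ h, List.getElem?_eq_getElem h,
        Option.toList_some, List.append_assoc]
      rfl
    · simp only [pushAll, TM2.stepAux, h, decide_false, cond_false, ih]
      rw [List.take_of_length_le (by omega), List.take_of_length_le (by omega)]

end PushAll

/-- A sequential transducer: it reads a word from left to right, writing a word of length at most
`width` for every letter and at the end of the input. -/
structure Transducer where
  /-- the states -/
  Q : Type
  [fin : Fintype Q]
  /-- the initial state -/
  start : Q
  /-- the next state -/
  next : Q → Bool → Q
  /-- the word written when a letter is read -/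
  emit : Q → Bool → List Bool
  /-- the word written at the end of the input -/
  final : Q → List Bool
  /-- a bound for the length of all words written -/
  width : ℕ
  emit_le : ∀ q b, (emit q b).length ≤ width
  final_le : ∀ q, (final q).length ≤ width

namespace Transducer

variable (T : Transducer)

/-- The output of a transducer started in state `q`. -/
def out (q : T.Q) : List Bool → List Bool
  | [] => T.final q
  | b :: l => T.emit q b ++ out (T.next q b) l

/-- The program of a machine with two stacks that executes a transducer. The label `true` is for
reading the input, the label `false` for reversing the output. -/
def program : Bool → TM2.Stmt (fun _ : Bool => Bool) Bool (T.Q × Option Bool)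
  | true =>
    .pop true (fun v o => (v.1, o)) <|
    .branch (fun v => v.2.isSome)
      (pushAll false (fun v => (T.emit v.1 (v.2.getD false)).reverse) false T.width <|
        .load (fun v => (T.next v.1 (v.2.getD false), none)) <|
        .goto fun _ => true)
      (pushAll false (fun v => (T.final v.1).reverse) false T.width <|
        .goto fun _ => false)
  | false =>
    .pop false (fun v o => (v.1, o)) <|
    .branch (fun v => v.2.isSome)
      (.push true (fun v => v.2.getD false) <| .goto fun _ => false)
      (.load (fun _ => (T.start, none)) .halt)

/-- A machine with two stacks that executes a transducer. -/
def machine : FinTM2 where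
  K := Bool
  k₀ := true
  k₁ := true
  Γ _ := Bool
  Λ := Bool
  main := true
  σ := T.Q × Option Bool
  initialState := (T.start, none)
  σFin := by have := T.fin; infer_instance
  m := T.program

/-- The two stacks of the machine executing a transducer. -/
def twoStacks (l r : List Bool) : Bool → List Bool
  | true => l
  | false => r

theorem update_twoStacks_true (l l' r : List Bool) :
    Function.update (twoStacks l r) true l' = twoStacks l' r := by
  funext b; cases b <;> simp [twoStacks]

theorem update_twoStacks_false (l r r' : List Bool) :
    Function.update (twoStacks l r) false r' = twoStacks l r' := by
  funext b; cases b <;> simp [twoStacks]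

/-- Pushing the emitted words leaves the output reversed on the second stack; `runs_reverse` pours
it back, which restores the order and the initial state. -/
theorem runs_read (q : T.Q) (o : Option Bool) (l r : List Bool) :
    ∃ q', RunsWithin T.program (l.length + 1) ⟨some true, (q, o), twoStacks l r⟩
      ⟨some false, (q', none), twoStacks [] ((T.out q l).reverse ++ r)⟩ := by
  induction l generalizing q o r with
  | nil =>
    refine ⟨q, RunsWithin.single ?_⟩
    have := T.final_le q
    simp only [program, TM2.stepAux, twoStacks, List.head?_nil, Option.isSome_none, cond_false,
      stepAux_pushAll, List.tail_nil, update_twoStacks_true, update_twoStacks_false]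
    rw [List.take_of_length_le (by simpa using T.final_le q)]
    rfl
  | cons b l ih =>
    obtain ⟨q', h⟩ := ih (T.next q b) none ((T.emit q b).reverse ++ r)
    refine ⟨q', RunsWithin.head (b := ⟨some true, (T.next q b, none),
      twoStacks l ((T.emit q b).reverse ++ r)⟩) ?_ (by simpa [out] using h)⟩
    simp only [program, TM2.stepAux, twoStacks, List.head?_cons, Option.isSome_some, cond_true,
      stepAux_pushAll, List.tail_cons, update_twoStacks_true, update_twoStacks_false]
    rw [List.take_of_length_le (by simpa using T.emit_le q _)]
    rfl

theorem runs_reverse (q : T.Q) (o : Option Bool) (l r : List Bool) :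
    RunsWithin T.program (r.length + 1) ⟨some false, (q, o), twoStacks l r⟩
      ⟨none, (T.start, none), twoStacks (r.reverse ++ l) []⟩ := by
  induction r generalizing l o with
  | nil =>
    refine RunsWithin.single ?_
    simp [program, twoStacks, update_twoStacks_false]
  | cons b r ih =>
    refine RunsWithin.head (b := ⟨some false, (q, some b), twoStacks (b :: l) r⟩) ?_
      (by simpa using ih (some b) (b :: l))
    simp [program, twoStacks, update_twoStacks_true, update_twoStacks_false]

theorem length_out_le (q : T.Q) (l : List Bool) :
    (T.out q l).length ≤ T.width * (l.length + 1) := by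
  induction l generalizing q with
  | nil => simpa [out] using T.final_le q
  | cons b l ih =>
    have := ih (T.next q b)
    have := T.emit_le q b
    simp only [out, List.length_append, List.length_cons]
    rw [Nat.mul_succ]
    omega

theorem computes {α : Type} (x : α → List Bool) :
    Computes x (fun a => T.out T.start (x a)) := by
  rw [computes_iff]
  refine ⟨T.machine, Equiv.refl _, Equiv.refl _, Polynomial.X + 1 +
    (Polynomial.C T.width * (Polynomial.X + 1) + 1), fun a => ?_⟩
  obtain ⟨q', h⟩ := T.runs_read T.start none (x a) []
  have h' := T.runs_reverse q' none [] ((T.out T.start (x a)).reverse ++ [])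
  have e : ∀ l : List Bool, soloStack (K := Bool) (Γ := fun _ => Bool) true (Equiv.refl Bool) l =
      twoStacks l [] := by
    intro l; funext b; cases b <;> simp [twoStacks, soloStack]
  have := (h.trans h').mono (t₂ := Polynomial.eval (x a).length (Polynomial.X + 1 +
    (Polynomial.C T.width * (Polynomial.X + 1) + 1))) (by
      have := T.length_out_le T.start (x a)
      simp only [List.append_nil, List.length_reverse, Polynomial.eval_add, Polynomial.eval_X,
        Polynomial.eval_one, Polynomial.eval_mul, Polynomial.eval_C]
      omega)
  rw [← e, ← e] at this
  simp only [List.append_nil, List.reverse_reverse] at this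
  exact this

end Transducer

end PeriodicHeat
end

noncomputable section

namespace PeriodicHeat

open Turing

/-! ### Machines with subroutines -/

section Host

variable {ι : Type} (O : ι → FinTM2) (V C : Type)

/-- The stacks of a machine with subroutines `O i`: all stacks of the subroutines, and stacks with
indices in `V`. -/
abbrev HostK : Type := (Σ i, (O i).K) ⊕ V

/-- The stack alphabets of a machine with subroutines. -/
@[reducible] def HostΓ : HostK O V → Type
  | .inl p => (O p.1).Γ p.2
  | .inr _ => Bool

/-- The labels of a machine with subroutines. -/
abbrev HostΛ : Type := (Σ i, (O i).Λ) ⊕ C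

/-- The states of a machine with subroutines. -/
abbrev Hostσ : Type := (∀ i, (O i).σ) × Option Bool

/-- Statements of a machine with subroutines. -/
abbrev HostStmt : Type := TM2.Stmt (HostΓ O V) (HostΛ O C) (Hostσ O)

variable {O V C}

/-- The stack content of a machine with subroutines. -/
def hostStack (A : ∀ i k, List ((O i).Γ k)) (B : V → List Bool) : ∀ k, List (HostΓ O V k)
  | .inl p => A p.1 p.2
  | .inr v => B v

variable [DecidableEq ι] [DecidableEq V]

theorem update_hostStack_inl (A : ∀ i k, List ((O i).Γ k)) (B : V → List Bool) (i : ι)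
    (k : (O i).K) (l : List ((O i).Γ k)) :
    Function.update (hostStack A B) (.inl ⟨i, k⟩) l =
      hostStack (Function.update A i (Function.update (A i) k l)) B := by
  funext s
  rcases s with ⟨j, k'⟩ | v
  · by_cases hj : j = i
    · subst hj
      by_cases hk : k' = k
      · subst hk; simp [hostStack]
      · rw [Function.update_of_ne (by simpa using hk)]; simp [hostStack, hk]
    · rw [Function.update_of_ne (by simp [hj])]; simp [hostStack, hj]
  · rw [Function.update_of_ne (by simp)]; rfl

theorem update_hostStack_inr (A : ∀ i k, List ((O i).Γ k)) (B : V → List Bool) (v : V)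
    (l : List Bool) :
    Function.update (hostStack A B) (.inr v) l = hostStack A (Function.update B v l) := by
  funext s
  rcases s with ⟨j, k'⟩ | v'
  · rw [Function.update_of_ne (by simp)]; rfl
  · by_cases hv : v' = v
    · subst hv; simp [hostStack]
    · rw [Function.update_of_ne (by simpa using hv)]; simp [hostStack, hv]

/-- A statement of a subroutine, as a statement of the machine with subroutines. Halting is
replaced by a jump to the label `exit`. -/
def embedStmt (i : ι) (exit : C) : TM2.Stmt (O i).Γ (O i).Λ (O i).σ → HostStmt O V C
  | .push k f q => .push (.inl ⟨i, k⟩) (fun v => f (v.1 i)) (embedStmt i exit q)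
  | .peek k f q => .peek (.inl ⟨i, k⟩) (fun v o => (Function.update v.1 i (f (v.1 i) o), v.2))
      (embedStmt i exit q)
  | .pop k f q => .pop (.inl ⟨i, k⟩) (fun v o => (Function.update v.1 i (f (v.1 i) o), v.2))
      (embedStmt i exit q)
  | .load a q => .load (fun v => (Function.update v.1 i (a (v.1 i)), v.2)) (embedStmt i exit q)
  | .branch f q₁ q₂ => .branch (fun v => f (v.1 i)) (embedStmt i exit q₁) (embedStmt i exit q₂)
  | .goto l => .goto fun v => .inl ⟨i, l (v.1 i)⟩
  | .halt => .goto fun _ => .inr exit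

/-- A configuration of a subroutine, as a configuration of the machine with subroutines. -/
def embedCfg (i : ι) (exit : C) (w : ∀ i, (O i).σ) (o : Option Bool)
    (A : ∀ i k, List ((O i).Γ k)) (B : V → List Bool) (c : TM2.Cfg (O i).Γ (O i).Λ (O i).σ) :
    TM2.Cfg (HostΓ O V) (HostΛ O C) (Hostσ O) :=
  ⟨some (c.l.elim (.inr exit) fun l => .inl ⟨i, l⟩), (Function.update w i c.var, o),
    hostStack (Function.update A i c.stk) B⟩

/-- Step-by-step simulation: the host leaves everything outside the subroutine `i` untouched, and
where the subroutine would halt it arrives at the label `exit`. -/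
theorem stepAux_embedStmt (i : ι) (exit : C) (q : TM2.Stmt (O i).Γ (O i).Λ (O i).σ)
    (w : ∀ i, (O i).σ) (o : Option Bool) (A : ∀ i k, List ((O i).Γ k)) (B : V → List Bool)
    (v : (O i).σ) (S : ∀ k, List ((O i).Γ k)) :
    TM2.stepAux (embedStmt i exit q) (Function.update w i v, o)
      (hostStack (Function.update A i S) B) =
      embedCfg i exit w o A B (TM2.stepAux q v S) := by
  induction q generalizing v S with
  | push k f q ih =>
    simp only [embedStmt, TM2.stepAux, ← ih]
    rw [update_hostStack_inl]
    simp [hostStack]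
  | peek k f q ih =>
    simp only [embedStmt, TM2.stepAux, ← ih]
    simp [hostStack]
  | pop k f q ih =>
    simp only [embedStmt, TM2.stepAux, ← ih]
    rw [update_hostStack_inl]
    simp [hostStack]
  | load a q ih =>
    simp only [embedStmt, TM2.stepAux, ← ih]
    simp
  | branch f q₁ q₂ ih₁ ih₂ =>
    simp only [embedStmt, TM2.stepAux, Function.update_self]
    cases f v
    · exact ih₂ _ _
    · exact ih₁ _ _
  | goto l => simp [embedStmt, embedCfg]
  | halt => simp [embedStmt, embedCfg]

theorem runsWithin_embed {M : HostΛ O C → HostStmt O V C} {i : ι} {exit : C}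
    (hM : ∀ l, M (.inl ⟨i, l⟩) = embedStmt i exit ((O i).m l)) {w : ∀ i, (O i).σ}
    {o : Option Bool} {A : ∀ i k, List ((O i).Γ k)} {B : V → List Bool} {t : ℕ}
    {c c' : TM2.Cfg (O i).Γ (O i).Λ (O i).σ} (h : RunsWithin (O i).m t c c') :
    RunsWithin M t (embedCfg i exit w o A B c) (embedCfg i exit w o A B c') := by
  obtain ⟨n, hn, h⟩ := h
  refine RunsWithin.mono ?_ hn
  clear hn
  induction n generalizing c with
  | zero =>
    simp only [Function.iterate_zero, id, Option.some.injEq] at h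
    subst h
    exact RunsWithin.refl _
  | succ n ih =>
    rw [Function.iterate_succ_apply] at h
    obtain ⟨l, v, S⟩ := c
    cases l with
    | none =>
      have : ∀ m, (flip bind (TM2.step (O i).m))^[m] none = none := fun m => by
        induction m with
        | zero => rfl
        | succ m ih => rw [Function.iterate_succ_apply']; rw [ih]; rfl
      exact absurd ((this n).symm.trans h) (by simp)
    | some l =>
      exact RunsWithin.head
        ((congrArg (fun q => TM2.stepAux q _ _) (hM l)).trans (stepAux_embedStmt ..)) (ih h)

/-- The initial states of all subroutines. -/
def hostInit (O : ι → FinTM2) : ∀ i, (O i).σ := fun i => (O i).initialState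

/-- As a subroutine halts in its initial state, `hostInit O` is restored after the call and the same
subroutine can be called again. -/
theorem runsWithin_call {M : HostΛ O C → HostStmt O V C} {i : ι} {exit : C}
    (hM : ∀ l, M (.inl ⟨i, l⟩) = embedStmt i exit ((O i).m l))
    {o : Option Bool} {A : ∀ i k, List ((O i).Γ k)} {B : V → List Bool} {t : ℕ}
    {S S' : ∀ k, List ((O i).Γ k)}
    (h : RunsWithin (O i).m t ⟨some (O i).main, (O i).initialState, S⟩
      ⟨none, (O i).initialState, S'⟩) :
    RunsWithin M t
      ⟨some (.inl ⟨i, (O i).main⟩), (hostInit O, o), hostStack (Function.update A i S) B⟩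
      ⟨some (.inr exit), (hostInit O, o), hostStack (Function.update A i S') B⟩ := by
  have := runsWithin_embed hM (w := hostInit O) (o := o) (A := A) (B := B) h
  simpa [embedCfg, show (O i).initialState = hostInit O i from rfl] using this

end Host

/-! ### Loops that empty a stack -/

section Loop

variable {K : Type} [DecidableEq K] {Γ : K → Type} {Λ W : Type}

/-- Pop a symbol; if there was one, execute `body`, otherwise jump to `next`. -/
def popStmt (k : K) (e : Γ k ≃ Bool) (next : Λ) (body : TM2.Stmt Γ Λ (W × Option Bool)) :
    TM2.Stmt Γ Λ (W × Option Bool) :=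
  .pop k (fun v o => (v.1, o.map e)) <|
  .branch (fun v => v.2.isSome) body (.load (fun v => (v.1, none)) (.goto fun _ => next))

/-- Empty a stack from the top, where `F l d` is the stack content after the removal of `d` (in
reversed order) when `l` still has to be removed. -/
theorem runsWithin_loop {M : Λ → TM2.Stmt Γ Λ (W × Option Bool)} {self next : Λ} {k : K}
    {e : Γ k ≃ Bool} {body : TM2.Stmt Γ Λ (W × Option Bool)}
    (hM : M self = popStmt k e next body) (F : List Bool → List Bool → ∀ k, List (Γ k)) (w : W)
    (hF : ∀ l d, F l d k = l.map e.symm)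
    (hbody : ∀ b l d, TM2.stepAux body (w, some b) (Function.update (F (b :: l) d) k (F l d k)) =
      ⟨some self, (w, some b), F l (b :: d)⟩)
    (l d : List Bool) (o : Option Bool) :
    RunsWithin M (l.length + 1) ⟨some self, (w, o), F l d⟩
      ⟨some next, (w, none), F [] (l.reverse ++ d)⟩ := by
  induction l generalizing d o with
  | nil =>
    refine RunsWithin.single ?_
    have h : F [] d k = [] := by simp [hF]
    have h' : Function.update (F [] d) k [] = F [] d := by rw [← h, Function.update_eq_self]
    simp [hM, popStmt, h, h']
  | cons b l ih =>
    refine RunsWithin.head (b := ⟨some self, (w, some b), F l (b :: d)⟩) ?_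
      (by simpa using ih (b :: d) (some b))
    rw [← hbody, hM]
    have h : F (b :: l) d k = e.symm b :: F l d k := by simp [hF]
    simp [popStmt, h]

end Loop

theorem update_soloStack {K : Type} [DecidableEq K] {Γ : K → Type} (k : K) (e : Γ k ≃ Bool)
    (l l' : List Bool) :
    Function.update (soloStack k e l) k (l'.map e.symm) = soloStack k e l' := by
  simp [soloStack]

theorem soloStack_self {K : Type} [DecidableEq K] {Γ : K → Type} (k : K) (e : Γ k ≃ Bool)
    (l : List Bool) : soloStack k e l k = l.map e.symm := by
  simp [soloStack]

theorem soloStack_nil {K : Type} [DecidableEq K] {Γ : K → Type} (k : K) (e : Γ k ≃ Bool) :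
    soloStack k e [] = fun _ => [] := by
  simp [soloStack]

theorem update_soloStack_cons {K : Type} [DecidableEq K] {Γ : K → Type} (k : K) (e : Γ k ≃ Bool)
    (b : Bool) (l : List Bool) :
    Function.update (soloStack k e l) k (e.symm b :: l.map e.symm) = soloStack k e (b :: l) := by
  simp [soloStack]

theorem hostStack_soloStack {ι : Type} [DecidableEq ι] {O : ι → FinTM2} {V : Type} [DecidableEq V]
    (i : ι) (k : (O i).K) (e : (O i).Γ k ≃ Bool) (l : List Bool)
    (B : V → List Bool) (hB : ∀ v, B v = []) :
    hostStack (Function.update (fun _ _ => []) i (soloStack k e l)) B =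
      soloStack (Γ := HostΓ O V) (.inl ⟨i, k⟩) e l := by
  have h : (fun _ => []) = hostStack (O := O) (V := V) (fun _ _ => []) (fun _ => []) := by
    funext s; cases s <;> rfl
  obtain rfl : B = fun _ => [] := funext hB
  unfold soloStack
  rw [h, update_hostStack_inl]

open Transducer (twoStacks update_twoStacks_true update_twoStacks_false)

theorem twoStacks_nil (b : Bool) : twoStacks [] [] b = [] := by
  cases b <;> rfl

theorem twoStacks_true (l r : List Bool) : twoStacks l r true = l := rfl

theorem twoStacks_false (l r : List Bool) : twoStacks l r false = r := rfl

/-! ### Composition of machines -/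

section Composition

variable (O : Bool → FinTM2) (e₀ : ∀ i, (O i).Γ (O i).k₀ ≃ Bool) (e₁ : ∀ i, (O i).Γ (O i).k₁ ≃ Bool)

/-- The program for running the subroutine `O true`, and then `O false` on its output. -/
def compProgram : HostΛ O (Fin 3) → HostStmt O Bool (Fin 3)
  | .inl ⟨true, l⟩ => embedStmt true 0 ((O true).m l)
  | .inl ⟨false, l⟩ => embedStmt false 2 ((O false).m l)
  | .inr 0 => popStmt (Γ := HostΓ O Bool) (.inl ⟨true, (O true).k₁⟩) (e₁ true) (.inr 1) <|
      .push (.inr false) (fun v => v.2.getD false) <| .goto fun _ => .inr 0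
  | .inr 1 => popStmt (Γ := HostΓ O Bool) (.inr false) (Equiv.refl Bool)
        (.inl ⟨false, (O false).main⟩) <|
      .push (.inl ⟨false, (O false).k₀⟩) (fun v => (e₀ false).symm (v.2.getD false)) <|
      .goto fun _ => .inr 1
  | .inr 2 => .halt

/-- Moving a stack reverses its word, so the intermediate result travels through an auxiliary stack.
The two moves account for the two summands `y.length + 1`. -/
theorem runsWithin_compProgram {x y z : List Bool} {t t' : ℕ}
    (h : RunsWithin (O true).m t
      ⟨some (O true).main, (O true).initialState, soloStack (O true).k₀ (e₀ true) x⟩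
      ⟨none, (O true).initialState, soloStack (O true).k₁ (e₁ true) y⟩)
    (h' : RunsWithin (O false).m t'
      ⟨some (O false).main, (O false).initialState, soloStack (O false).k₀ (e₀ false) y⟩
      ⟨none, (O false).initialState, soloStack (O false).k₁ (e₁ false) z⟩) :
    RunsWithin (compProgram O e₀ e₁) (t + (y.length + 1) + (y.length + 1) + t' + 1)
      ⟨some (.inl ⟨true, (O true).main⟩), (hostInit O, none),
        soloStack (Γ := HostΓ O Bool) (.inl ⟨true, (O true).k₀⟩) (e₀ true) x⟩
      ⟨none, (hostInit O, none),
        soloStack (Γ := HostΓ O Bool) (.inl ⟨false, (O false).k₁⟩) (e₁ false) z⟩ := by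
  have s1 := runsWithin_call (M := compProgram O e₀ e₁) (i := true) (exit := 0)
    (fun l => by rw [compProgram]) (o := none) (A := fun _ _ => []) (B := twoStacks [] []) h
  have s2 := runsWithin_loop (M := compProgram O e₀ e₁) (self := .inr 0) (by rw [compProgram])
    (fun l d => hostStack (Function.update (fun _ _ => []) true (soloStack (O true).k₁ (e₁ true) l))
      (twoStacks [] d)) (hostInit O) (fun l d => by simp [hostStack, soloStack_self])
    (fun b l d => by
      simp [update_hostStack_inl, update_hostStack_inr, hostStack, soloStack_self,
        update_soloStack, update_twoStacks_false, twoStacks_false]) y [] none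
  have s3 := runsWithin_loop (M := compProgram O e₀ e₁) (self := .inr 1) (by rw [compProgram])
    (fun l d => hostStack (Function.update (fun _ _ => []) false
      (soloStack (O false).k₀ (e₀ false) d)) (twoStacks [] l)) (hostInit O)
    (fun l d => by simp [hostStack, twoStacks_false])
    (fun b l d => by
      simp [update_hostStack_inl, update_hostStack_inr, hostStack, soloStack_self,
        update_soloStack_cons, update_twoStacks_false, twoStacks_false]) y.reverse [] none
  have s4 := runsWithin_call (M := compProgram O e₀ e₁) (i := false) (exit := 2)
    (fun l => by rw [compProgram]) (o := none) (A := fun _ _ => []) (B := twoStacks [] []) h'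
  have s5 : RunsWithin (compProgram O e₀ e₁) 1
    ⟨some (.inr 2), (hostInit O, none), hostStack (Function.update (fun _ _ => []) false
      (soloStack (O false).k₁ (e₁ false) z)) (twoStacks [] [])⟩ ⟨none, (hostInit O, none), _⟩ :=
    RunsWithin.single (by rw [compProgram, TM2.stepAux])
  have e : ∀ i, Function.update (fun i (k : (O i).K) => ([] : List ((O i).Γ k))) i
      (fun _ => []) = fun _ _ => [] := fun i => Function.update_eq_self i _
  simp only [soloStack_nil, List.append_nil, e, List.length_reverse, List.reverse_reverse]
    at s2 s3
  rw [← hostStack_soloStack _ _ _ _ (twoStacks [] []) twoStacks_nil,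
    ← hostStack_soloStack _ _ _ _ (twoStacks [] []) twoStacks_nil]
  exact (((s1.trans s2).trans s3).trans s4).trans s5

/-- The machine for running the subroutine `O true`, and then `O false` on its output. -/
def compMachine : FinTM2 :=
  have := fun i => (O i).kFin
  have := fun i => (O i).ΛFin
  have := fun i => (O i).σFin
  { K := HostK O Bool
    k₀ := .inl ⟨true, (O true).k₀⟩
    k₁ := .inl ⟨false, (O false).k₁⟩
    Γ := HostΓ O Bool
    Λ := HostΛ O (Fin 3)
    main := .inl ⟨true, (O true).main⟩
    σ := Hostσ O
    initialState := (hostInit O, none)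
    Γk₀Fin := (O true).Γk₀Fin
    m := compProgram O e₀ e₁ }

end Composition

/-- The second running time is polynomial in the length of `y`, which by `Computes.polyBounded` is
polynomial in the length of `x`. -/
theorem Computes.trans {α : Type} {x y z : α → List Bool} (h : Computes x y) (h' : Computes y z) :
    Computes x z := by
  have hy := h.polyBounded
  have H : ∀ i : Bool, Computes (cond i x y) (cond i y z) := fun i => by cases i <;> assumption
  simp only [computes_iff] at H
  choose O e₀ e₁ p H using H
  have hb : PolyBounded x fun a => (p true).eval (x a).length + ((y a).length + 1) +
      ((y a).length + 1) + (p false).eval (y a).length + 1 :=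
    ((((PolyBounded.length.eval _).add (hy.add (.const 1))).add (hy.add (.const 1))).add
      (hy.eval _)).add (.const 1)
  obtain ⟨q, hq⟩ := hb
  exact computes_iff.2 ⟨compMachine O e₀ e₁, e₀ true, e₁ false, q, fun a =>
    (runsWithin_compProgram O e₀ e₁ (H true a) (H false a)).mono (hq a)⟩

/-! ### Pairing -/

/-- The word that represents a pair of words. -/
def pairWord (x y : List Bool) : List Bool :=
  x.flatMap (fun b => [true, b]) ++ false :: y

-- Each letter of the first word is preceded by the flag `true`, and the flag `false` announces the
-- second word. A transducer with finite memory can therefore take pairs apart.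
@[simp] theorem pairWord_nil (y : List Bool) : pairWord [] y = false :: y := rfl

@[simp] theorem pairWord_cons (b : Bool) (x y : List Bool) :
    pairWord (b :: x) y = true :: b :: pairWord x y := rfl

theorem length_pairWord (x y : List Bool) : (pairWord x y).length = 2 * x.length + y.length + 1 := by
  induction x with
  | nil => simp
  | cons b x ih => simp [ih]; ring

section Fork

variable (O : Bool → FinTM2) (e₀ : ∀ i, (O i).Γ (O i).k₀ ≃ Bool) (e₁ : ∀ i, (O i).Γ (O i).k₁ ≃ Bool)

/-- The program for running the subroutines `O true` and `O false` on the same input and forming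
the pair of the outputs. -/
def forkProgram : HostΛ O (Fin 8) → HostStmt O Bool (Fin 8)
  | .inr 0 => popStmt (Γ := HostΓ O Bool) (.inr true) (Equiv.refl Bool) (.inr 1) <|
      .push (.inr false) (fun v => v.2.getD false) <| .goto fun _ => .inr 0
  | .inr 1 => popStmt (Γ := HostΓ O Bool) (.inr false) (Equiv.refl Bool)
        (.inl ⟨true, (O true).main⟩) <|
      .push (.inl ⟨true, (O true).k₀⟩) (fun v => (e₀ true).symm (v.2.getD false)) <|
      .push (.inl ⟨false, (O false).k₀⟩) (fun v => (e₀ false).symm (v.2.getD false)) <|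
      .goto fun _ => .inr 1
  | .inl ⟨true, l⟩ => embedStmt true 2 ((O true).m l)
  | .inr 2 => .goto fun _ => .inl ⟨false, (O false).main⟩
  | .inl ⟨false, l⟩ => embedStmt false 3 ((O false).m l)
  | .inr 3 => popStmt (Γ := HostΓ O Bool) (.inl ⟨false, (O false).k₁⟩) (e₁ false) (.inr 4) <|
      .push (.inr false) (fun v => v.2.getD false) <| .goto fun _ => .inr 3
  | .inr 4 => popStmt (Γ := HostΓ O Bool) (.inr false) (Equiv.refl Bool) (.inr 5) <|
      .push (.inr true) (fun v => v.2.getD false) <| .goto fun _ => .inr 4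
  | .inr 5 => popStmt (Γ := HostΓ O Bool) (.inl ⟨true, (O true).k₁⟩) (e₁ true) (.inr 6) <|
      .push (.inr false) (fun v => v.2.getD false) <| .goto fun _ => .inr 5
  | .inr 6 => .push (.inr true) (fun _ => false) <| .goto fun _ => .inr 7
  | .inr 7 => .pop (.inr false) (fun v o => (v.1, o)) <|
      .branch (fun v => v.2.isSome)
        (.push (.inr true) (fun v => v.2.getD false) <| .push (.inr true) (fun _ => true) <|
          .goto fun _ => .inr 7)
        (.load (fun v => (v.1, none)) .halt)

/-- The stack contents of the subroutines. -/
def forkStacks (f : ∀ k, List ((O true).Γ k)) (g : ∀ k, List ((O false).Γ k)) :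
    ∀ i k, List ((O i).Γ k)
  | true => f
  | false => g

theorem update_forkStacks_true (f f' : ∀ k, List ((O true).Γ k)) (g : ∀ k, List ((O false).Γ k)) :
    Function.update (forkStacks O f g) true f' = forkStacks O f' g := by
  funext b; cases b <;> simp [forkStacks]

theorem update_forkStacks_false (f : ∀ k, List ((O true).Γ k)) (g g' : ∀ k, List ((O false).Γ k)) :
    Function.update (forkStacks O f g) false g' = forkStacks O f g' := by
  funext b; cases b <;> simp [forkStacks]

theorem forkStacks_true (f : ∀ k, List ((O true).Γ k)) (g : ∀ k, List ((O false).Γ k)) :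
    forkStacks O f g true = f := rfl

theorem forkStacks_false (f : ∀ k, List ((O true).Γ k)) (g : ∀ k, List ((O false).Γ k)) :
    forkStacks O f g false = g := rfl

/-- The input is emptied onto an auxiliary stack and from there pushed onto both input stacks. Of
the results, `z` is moved twice and keeps its order. `y` is moved only once: reversed, it can be put
in front of `z` letter by letter, last letter first, each followed by its flag. -/
theorem runsWithin_forkProgram {x y z : List Bool} {t t' : ℕ}
    (h : RunsWithin (O true).m t
      ⟨some (O true).main, (O true).initialState, soloStack (O true).k₀ (e₀ true) x⟩
      ⟨none, (O true).initialState, soloStack (O true).k₁ (e₁ true) y⟩)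
    (h' : RunsWithin (O false).m t'
      ⟨some (O false).main, (O false).initialState, soloStack (O false).k₀ (e₀ false) x⟩
      ⟨none, (O false).initialState, soloStack (O false).k₁ (e₁ false) z⟩) :
    RunsWithin (forkProgram O e₀ e₁)
      (x.length + 1 + (x.length + 1) + t + 1 + t' + (z.length + 1) + (z.length + 1) +
        (y.length + 1) + 1 + (y.length + 1))
      ⟨some (.inr 0), (hostInit O, none),
        soloStack (Γ := HostΓ O Bool) (.inr true) (Equiv.refl Bool) x⟩
      ⟨none, (hostInit O, none),
        soloStack (Γ := HostΓ O Bool) (.inr true) (Equiv.refl Bool) (pairWord y z)⟩ := by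
  have e : ∀ l, soloStack (Γ := HostΓ O Bool) (.inr true) (Equiv.refl Bool) l =
      hostStack (forkStacks O (fun _ => []) (fun _ => [])) (twoStacks l []) := by
    intro l
    have e' : (fun _ => []) = hostStack (forkStacks O (fun _ => []) (fun _ => []))
        (twoStacks [] []) := by
      funext s
      rcases s with ⟨b, k⟩ | b <;> cases b <;> rfl
    rw [soloStack, e', update_hostStack_inr, update_twoStacks_true]
    simp
  have s0 := runsWithin_loop (M := forkProgram O e₀ e₁) (self := .inr 0) (by rw [forkProgram])
    (fun l d => hostStack (forkStacks O (fun _ => []) (fun _ => [])) (twoStacks l d)) (hostInit O)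
    (fun l d => by simp [hostStack, twoStacks_true])
    (fun b l d => by
      simp [update_hostStack_inr, hostStack, update_twoStacks_false, update_twoStacks_true,
        twoStacks_false, twoStacks_true]) x [] none
  have s1 := runsWithin_loop (M := forkProgram O e₀ e₁) (self := .inr 1) (by rw [forkProgram])
    (fun l d => hostStack (forkStacks O (soloStack (O true).k₀ (e₀ true) d)
      (soloStack (O false).k₀ (e₀ false) d)) (twoStacks [] l)) (hostInit O)
    (fun l d => by simp [hostStack, twoStacks_false])
    (fun b l d => by
      simp [update_hostStack_inr, update_hostStack_inl, hostStack, update_twoStacks_false,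
        twoStacks_false, forkStacks_true, forkStacks_false, update_forkStacks_true,
        update_forkStacks_false, soloStack_self, update_soloStack_cons])
    x.reverse [] none
  have s2 := runsWithin_call (M := forkProgram O e₀ e₁) (i := true) (exit := 2)
    (fun l => by rw [forkProgram]) (o := none)
    (A := forkStacks O (fun _ => []) (soloStack (O false).k₀ (e₀ false) x))
    (B := twoStacks [] []) h
  have s3 : RunsWithin (forkProgram O e₀ e₁) 1
    ⟨some (.inr 2), (hostInit O, none), hostStack (forkStacks O (soloStack (O true).k₁ (e₁ true) y)
      (soloStack (O false).k₀ (e₀ false) x)) (twoStacks [] [])⟩ _ :=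
    RunsWithin.single (by rw [forkProgram, TM2.stepAux])
  have s4 := runsWithin_call (M := forkProgram O e₀ e₁) (i := false) (exit := 3)
    (fun l => by rw [forkProgram]) (o := none)
    (A := forkStacks O (soloStack (O true).k₁ (e₁ true) y) (fun _ => []))
    (B := twoStacks [] []) h'
  have s5 := runsWithin_loop (M := forkProgram O e₀ e₁) (self := .inr 3) (by rw [forkProgram])
    (fun l d => hostStack (forkStacks O (soloStack (O true).k₁ (e₁ true) y)
      (soloStack (O false).k₁ (e₁ false) l)) (twoStacks [] d)) (hostInit O)
    (fun l d => by simp [hostStack, forkStacks_false, soloStack_self])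
    (fun b l d => by
      simp [update_hostStack_inr, update_hostStack_inl, hostStack, update_twoStacks_false,
        twoStacks_false, forkStacks_false, update_forkStacks_false, soloStack_self,
        update_soloStack])
    z [] none
  have s6 := runsWithin_loop (M := forkProgram O e₀ e₁) (self := .inr 4) (by rw [forkProgram])
    (fun l d => hostStack (forkStacks O (soloStack (O true).k₁ (e₁ true) y) (fun _ => []))
      (twoStacks d l)) (hostInit O)
    (fun l d => by simp [hostStack, twoStacks_false])
    (fun b l d => by
      simp [update_hostStack_inr, hostStack, update_twoStacks_false, update_twoStacks_true,
        twoStacks_false, twoStacks_true]) z.reverse [] none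
  have s7 := runsWithin_loop (M := forkProgram O e₀ e₁) (self := .inr 5) (by rw [forkProgram])
    (fun l d => hostStack (forkStacks O (soloStack (O true).k₁ (e₁ true) l) (fun _ => []))
      (twoStacks z d)) (hostInit O)
    (fun l d => by simp [hostStack, forkStacks_true, soloStack_self])
    (fun b l d => by
      simp [update_hostStack_inr, update_hostStack_inl, hostStack, update_twoStacks_false,
        twoStacks_false, forkStacks_true, update_forkStacks_true, soloStack_self,
        update_soloStack])
    y [] none
  have s8 : RunsWithin (forkProgram O e₀ e₁) 1
    ⟨some (.inr 6), (hostInit O, none), hostStack (forkStacks O (fun _ => []) (fun _ => []))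
      (twoStacks z y.reverse)⟩
    ⟨some (.inr 7), (hostInit O, none), hostStack (forkStacks O (fun _ => []) (fun _ => []))
      (twoStacks (false :: z) y.reverse)⟩ :=
    RunsWithin.single (by
      rw [forkProgram]
      simp [update_hostStack_inr, hostStack, update_twoStacks_true, twoStacks_true])
  -- Here `w` is the part of the first component that is already coded and `r` the rest of it,
  -- reversed.
  have s9 : ∀ (r w : List Bool) (o : Option Bool), RunsWithin (forkProgram O e₀ e₁) (r.length + 1)
      ⟨some (.inr 7), (hostInit O, o), hostStack (forkStacks O (fun _ => []) (fun _ => []))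
        (twoStacks (pairWord w z) r)⟩
      ⟨none, (hostInit O, none), hostStack (forkStacks O (fun _ => []) (fun _ => []))
        (twoStacks (pairWord (r.reverse ++ w) z) [])⟩ := by
    intro r
    induction r with
    | nil =>
      intro w o
      refine RunsWithin.single ?_
      rw [forkProgram]
      simp [hostStack, twoStacks_false, update_hostStack_inr, update_twoStacks_false]
    | cons b r ih =>
      intro w o
      refine RunsWithin.head (b := ⟨some (.inr 7), (hostInit O, some b),
        hostStack (forkStacks O (fun _ => []) (fun _ => []))
        (twoStacks (pairWord (b :: w) z) r)⟩) ?_ (by simpa using ih (b :: w) (some b))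
      rw [forkProgram]
      simp [hostStack, twoStacks_false, twoStacks_true, update_hostStack_inr,
        update_twoStacks_false, update_twoStacks_true]
  simp only [soloStack_nil, List.append_nil, List.length_reverse, List.reverse_reverse,
    update_forkStacks_true, update_forkStacks_false] at s0 s1 s2 s4 s5 s6 s7
  rw [e, e]
  exact ((((((((s0.trans s1).trans s2).trans s3).trans s4).trans s5).trans s6).trans s7).trans
    s8).trans (by simpa using s9 y.reverse [] none)

/-- The machine for running the subroutines `O true` and `O false` on the same input and forming
the pair of the outputs. -/
def forkMachine : FinTM2 :=
  have := fun i => (O i).kFin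
  have := fun i => (O i).ΛFin
  have := fun i => (O i).σFin
  { K := HostK O Bool
    k₀ := .inr true
    k₁ := .inr true
    Γ := HostΓ O Bool
    Λ := HostΛ O (Fin 8)
    main := .inr 0
    σ := Hostσ O
    initialState := (hostInit O, none)
    Γk₀Fin := inferInstanceAs (Fintype Bool)
    m := forkProgram O e₀ e₁ }

end Fork

theorem Computes.pair {α : Type} {x y z : α → List Bool} (h : Computes x y) (h' : Computes x z) :
    Computes x (fun a => pairWord (y a) (z a)) := by
  have hy := h.polyBounded
  have hz := h'.polyBounded
  have H : ∀ i : Bool, Computes x (cond i y z) := fun i => by cases i <;> assumption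
  simp only [computes_iff] at H
  choose O e₀ e₁ p H using H
  have hx := (PolyBounded.length (x := x)).add (.const 1)
  have hb := (((((((((hx.add hx).add (PolyBounded.length.eval (p true))).add (.const 1)).add
    (PolyBounded.length.eval (p false))).add (hz.add (.const 1))).add (hz.add (.const 1))).add
    (hy.add (.const 1))).add (.const 1)).add (hy.add (.const 1)))
  obtain ⟨q, hq⟩ := hb
  exact computes_iff.2 ⟨forkMachine O e₀ e₁, Equiv.refl _, Equiv.refl _, q, fun a =>
    (runsWithin_forkProgram O e₀ e₁ (H true a) (H false a)).mono (hq a)⟩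

end PeriodicHeat
end

noncomputable section

namespace PeriodicHeat

open Turing

/-! ### Iteration -/

open Transducer (twoStacks update_twoStacks_true update_twoStacks_false)

section Iterate

variable (O : Unit → FinTM2) (e₀ : ∀ i, (O i).Γ (O i).k₀ ≃ Bool)
  (e₁ : ∀ i, (O i).Γ (O i).k₁ ≃ Bool)

/-- The stack content of the only subroutine. -/
def unitStacks (f : ∀ k, List ((O ()).Γ k)) : ∀ i k, List ((O i).Γ k)
  | () => f

theorem unitStacks_unit (f : ∀ k, List ((O ()).Γ k)) : unitStacks O f () = f := rfl

theorem update_eq_unitStacks (f : ∀ i k, List ((O i).Γ k)) (g : ∀ k, List ((O ()).Γ k)) :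
    Function.update f () g = unitStacks O g := by
  funext b; cases b; simp [unitStacks]

theorem update_unitStacks (f g : ∀ k, List ((O ()).Γ k)) :
    Function.update (unitStacks O f) () g = unitStacks O g :=
  update_eq_unitStacks O _ _

/-- The program for running a subroutine repeatedly on its own output. The first component of the
input is a counter. -/
def iterateProgram : HostΛ O (Fin 5) → HostStmt O Bool (Fin 5)
  | .inr 0 => .pop (.inl ⟨(), (O ()).k₀⟩) (fun v o => (v.1, o.map (e₀ ()))) <|
      .branch (fun v => v.2.getD false)
        (.pop (.inl ⟨(), (O ()).k₀⟩) (fun v _ => (v.1, none)) <|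
          .push (.inr true) (fun _ => true) <| .goto fun _ => .inr 0)
        (.load (fun v => (v.1, none)) <| .goto fun _ => .inr 1)
  | .inr 1 => popStmt (Γ := HostΓ O Bool) (.inr true) (Equiv.refl Bool) (.inr 4) <|
      .load (fun v => (v.1, none)) <| .goto fun _ => .inl ⟨(), (O ()).main⟩
  | .inl ⟨(), l⟩ => embedStmt () 2 ((O ()).m l)
  | .inr 2 => popStmt (Γ := HostΓ O Bool) (.inl ⟨(), (O ()).k₁⟩) (e₁ ()) (.inr 3) <|
      .push (.inr false) (fun v => v.2.getD false) <| .goto fun _ => .inr 2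
  | .inr 3 => popStmt (Γ := HostΓ O Bool) (.inr false) (Equiv.refl Bool) (.inr 1) <|
      .push (.inl ⟨(), (O ()).k₀⟩) (fun v => (e₀ ()).symm (v.2.getD false)) <|
      .goto fun _ => .inr 3
  | .inr 4 => .halt

theorem runsWithin_iterateProgram_body {n : ℕ} {x y : List Bool} {t : ℕ}
    (h : RunsWithin (O ()).m t
      ⟨some (O ()).main, (O ()).initialState, soloStack (O ()).k₀ (e₀ ()) x⟩
      ⟨none, (O ()).initialState, soloStack (O ()).k₁ (e₁ ()) y⟩) :
    RunsWithin (iterateProgram O e₀ e₁) (1 + t + (y.length + 1) + (y.length + 1))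
      ⟨some (.inr 1), (hostInit O, none), hostStack (unitStacks O <| soloStack (O ()).k₀ (e₀ ()) x)
        (twoStacks (List.replicate (n + 1) true) [])⟩
      ⟨some (.inr 1), (hostInit O, none), hostStack (unitStacks O <| soloStack (O ()).k₀ (e₀ ()) y)
        (twoStacks (List.replicate n true) [])⟩ := by
  have s1 : RunsWithin (iterateProgram O e₀ e₁) 1
      ⟨some (.inr 1), (hostInit O, none), hostStack (unitStacks O <| soloStack (O ()).k₀ (e₀ ()) x)
        (twoStacks (List.replicate (n + 1) true) [])⟩
      ⟨some (.inl ⟨(), (O ()).main⟩), (hostInit O, none),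
        hostStack (unitStacks O <| soloStack (O ()).k₀ (e₀ ()) x)
          (twoStacks (List.replicate n true) [])⟩ :=
    RunsWithin.single (by
      rw [iterateProgram]
      simp [popStmt, hostStack, List.replicate_succ, twoStacks_true, update_hostStack_inr,
        update_twoStacks_true])
  have s2 := runsWithin_call (M := iterateProgram O e₀ e₁) (i := ()) (exit := 2)
    (fun l => by rw [iterateProgram]) (o := none) (A := fun _ _ => [])
    (B := twoStacks (List.replicate n true) []) h
  have s3 := runsWithin_loop (M := iterateProgram O e₀ e₁) (self := .inr 2)
    (by rw [iterateProgram])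
    (fun l d => hostStack (unitStacks O <| soloStack (O ()).k₁ (e₁ ()) l)
      (twoStacks (List.replicate n true) d)) (hostInit O)
    (fun l d => by simp [hostStack, soloStack_self, unitStacks_unit])
    (fun b l d => by
      simp [update_hostStack_inl, update_hostStack_inr, hostStack, soloStack_self, unitStacks_unit,
        update_unitStacks,
        update_soloStack, update_twoStacks_false, twoStacks_false]) y [] none
  have s4 := runsWithin_loop (M := iterateProgram O e₀ e₁) (self := .inr 3)
    (by rw [iterateProgram])
    (fun l d => hostStack (unitStacks O <| soloStack (O ()).k₀ (e₀ ()) d)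
      (twoStacks (List.replicate n true) l)) (hostInit O)
    (fun l d => by simp [hostStack, twoStacks_false])
    (fun b l d => by
      simp [update_hostStack_inl, update_hostStack_inr, hostStack, soloStack_self, unitStacks_unit,
        update_unitStacks,
        update_soloStack_cons, update_twoStacks_false, twoStacks_false]) y.reverse [] none
  simp only [soloStack_nil, List.append_nil, List.length_reverse, List.reverse_reverse,
    update_eq_unitStacks]
    at s2 s3 s4
  exact ((s1.trans s2).trans s3).trans s4

/-- The counter is first unpacked onto a stack of its own. Each round returns the output through a
buffer to the input stack of the subroutine, so the final result is found there as well. The uniform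
length bound `r` controls the cost of the moves. -/
theorem runsWithin_iterateProgram {n : ℕ} {x : ℕ → List Bool} {t r : ℕ}
    (h : ∀ i < n, RunsWithin (O ()).m t
      ⟨some (O ()).main, (O ()).initialState, soloStack (O ()).k₀ (e₀ ()) (x i)⟩
      ⟨none, (O ()).initialState, soloStack (O ()).k₁ (e₁ ()) (x (i + 1))⟩)
    (hr : ∀ i ≤ n, (x i).length ≤ r) :
    RunsWithin (iterateProgram O e₀ e₁) (n + 1 + n * (1 + t + (r + 1) + (r + 1)) + 1 + 1)
      ⟨some (.inr 0), (hostInit O, none), soloStack (Γ := HostΓ O Bool) (.inl ⟨(), (O ()).k₀⟩)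
        (e₀ ()) (pairWord (List.replicate n true) (x 0))⟩
      ⟨none, (hostInit O, none), soloStack (Γ := HostΓ O Bool) (.inl ⟨(), (O ()).k₀⟩)
        (e₀ ()) (x n)⟩ := by
  -- `m` letters of the counter are still to be read, and `c` are already on the counter stack.
  have s0 : ∀ m c : ℕ, RunsWithin (iterateProgram O e₀ e₁) (m + 1)
      ⟨some (.inr 0), (hostInit O, none), hostStack (unitStacks O <| soloStack (O ()).k₀ (e₀ ())
        (pairWord (List.replicate m true) (x 0))) (twoStacks (List.replicate c true) [])⟩
      ⟨some (.inr 1), (hostInit O, none), hostStack (unitStacks O <| soloStack (O ()).k₀ (e₀ ())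
        (x 0)) (twoStacks (List.replicate (m + c) true) [])⟩ := by
    intro m
    induction m with
    | zero =>
      intro c
      refine RunsWithin.single ?_
      rw [iterateProgram]
      simp [hostStack, update_hostStack_inl, soloStack_self, unitStacks_unit,
        update_unitStacks, update_soloStack]
    | succ m ih =>
      intro c
      refine RunsWithin.head ?_ (by simpa [add_assoc, add_comm 1] using ih (c + 1))
      rw [iterateProgram]
      simp [hostStack, update_hostStack_inl, soloStack_self, unitStacks_unit,
        update_unitStacks, update_soloStack,
        update_hostStack_inr, List.replicate_succ, twoStacks_true, update_twoStacks_true]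
  have s1 : ∀ m i : ℕ, i + m = n →
      RunsWithin (iterateProgram O e₀ e₁) (m * (1 + t + (r + 1) + (r + 1)) + 1)
      ⟨some (.inr 1), (hostInit O, none), hostStack (unitStacks O <| soloStack (O ()).k₀ (e₀ ())
        (x i)) (twoStacks (List.replicate m true) [])⟩
      ⟨some (.inr 4), (hostInit O, none), hostStack (unitStacks O <| soloStack (O ()).k₀ (e₀ ())
        (x n)) (twoStacks [] [])⟩ := by
    intro m
    induction m with
    | zero =>
      rintro i rfl
      rw [Nat.zero_mul]
      refine RunsWithin.single ?_
      rw [iterateProgram]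
      simp [popStmt, hostStack, twoStacks_true, update_hostStack_inr, update_twoStacks_true]
    | succ m ih =>
      intro i hi
      have := hr (i + 1) (by omega)
      refine ((runsWithin_iterateProgram_body O e₀ e₁ (h i (by omega))).trans
        (ih (i + 1) (by omega))).mono ?_
      rw [Nat.succ_mul]
      omega
  have s2 : RunsWithin (iterateProgram O e₀ e₁) 1
      ⟨some (.inr 4), (hostInit O, none), hostStack (unitStacks O <| soloStack (O ()).k₀ (e₀ ())
        (x n)) (twoStacks [] [])⟩ ⟨none, (hostInit O, none), _⟩ :=
    RunsWithin.single (by rw [iterateProgram, TM2.stepAux])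
  rw [← hostStack_soloStack _ _ _ _ (twoStacks [] []) twoStacks_nil,
    ← hostStack_soloStack _ _ _ _ (twoStacks [] []) twoStacks_nil,
    update_eq_unitStacks, update_eq_unitStacks]
  exact (((s0 n 0).trans (s1 n 0 (by omega))).trans s2).mono (by omega)

/-- The machine for running a subroutine repeatedly on its own output. -/
def iterateMachine : FinTM2 :=
  have := fun i => (O i).kFin
  have := fun i => (O i).ΛFin
  have := fun i => (O i).σFin
  { K := HostK O Bool
    k₀ := .inl ⟨(), (O ()).k₀⟩
    k₁ := .inl ⟨(), (O ()).k₀⟩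
    Γ := HostΓ O Bool
    Λ := HostΛ O (Fin 5)
    main := .inr 0
    σ := Hostσ O
    initialState := (hostInit O, none)
    Γk₀Fin := (O ()).Γk₀Fin
    m := iterateProgram O e₀ e₁ }

end Iterate

/-- The bound `g` is essential: a polynomial-time map may double the length of a word, so its
iterates may grow exponentially. -/
theorem computes_iterate {α β : Type} {x : β → List Bool} {F : β → β} {N : α → ℕ} {I : α → β}
    (hF : Computes x (fun b => x (F b)))
    (hb : ∃ g : α → ℕ, PolyBounded (fun a => pairWord (encodeUnary (N a)) (x (I a))) g ∧
      ∀ a, ∀ i ≤ N a, (x (F^[i] (I a))).length ≤ g a) :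
    Computes (fun a => pairWord (encodeUnary (N a)) (x (I a))) (fun a => x (F^[N a] (I a))) := by
  obtain ⟨tm, e₀, e₁, p, h⟩ := computes_iff.1 hF
  obtain ⟨g, hg, hle⟩ := hb
  have hN : PolyBounded (fun a => pairWord (encodeUnary (N a)) (x (I a))) N :=
    PolyBounded.length.mono fun a => by simp [length_pairWord, encodeUnary]; omega
  have hb := (((hN.add (.const 1)).add (hN.mul ((((PolyBounded.const 1).add (hg.eval p)).add
    (hg.add (.const 1))).add (hg.add (.const 1))))).add (.const 1)).add (.const 1)
  obtain ⟨q, hq⟩ := hb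
  refine computes_iff.2 ⟨iterateMachine (fun _ => tm) (fun _ => e₀) (fun _ => e₁), e₀, e₀, q,
    fun a => RunsWithin.mono (runsWithin_iterateProgram (fun _ => tm) (fun _ => e₀) (fun _ => e₁)
      (n := N a) (x := fun i => x (F^[i] (I a))) (t := p.eval (g a)) (r := g a) (fun i hi => ?_)
      (hle a)) (hq a)⟩
  simp only [Function.iterate_succ_apply']
  exact (h _).mono (eval_mono p (hle a i hi.le))

end PeriodicHeat
end

noncomputable section

namespace PeriodicHeat

open Turing

/-! ### Basic operations on words -/

section Words

variable {α β : Type} {x y z : α → List Bool}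

theorem Computes.transduce (T : Transducer) {w : α → List Bool} (h : Computes x y)
    (hw : ∀ a, T.out T.start (y a) = w a) : Computes x w :=
  h.trans ((T.computes y).of_eq (fun _ => rfl) fun a => (hw a).symm)

/-- A transducer that ignores its input. -/
def constTransducer (w : List Bool) : Transducer where
  Q := Unit
  start := ()
  next _ _ := ()
  emit _ _ := []
  final _ := w
  width := w.length
  emit_le := by simp
  final_le := by simp

theorem Computes.const (w : List Bool) : Computes x (fun _ => w) :=
  (Computes.refl x).transduce (constTransducer w) fun a => by
    induction x a with
    | nil => rfl
    | cons b l ih => simpa [Transducer.out, constTransducer] using ih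

/-- A transducer that replaces all letters. -/
def flatMapTransducer (f : Bool → List Bool) (w : List Bool) : Transducer where
  Q := Unit
  start := ()
  next _ _ := ()
  emit _ := f
  final _ := w
  width := (f true).length + (f false).length + w.length
  emit_le := by rintro _ (_ | _) <;> omega
  final_le := by simp

theorem Computes.flatMap (h : Computes x y) (f : Bool → List Bool) (w : List Bool) :
    Computes x (fun a => (y a).flatMap f ++ w) :=
  h.transduce (flatMapTransducer f w) fun a => by
    induction y a with
    | nil => rfl
    | cons b l ih => simpa [Transducer.out, flatMapTransducer] using ih

/-- A transducer that treats the first letter in a special way. -/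
def headTransducer (f g : Bool → List Bool) (w : List Bool) : Transducer where
  Q := Bool
  start := true
  next _ _ := false
  emit q b := if q then f b else g b
  final q := if q then w else []
  width := (f true).length + (f false).length + (g true).length + (g false).length + w.length
  emit_le := by rintro (_ | _) (_ | _) <;> simp <;> omega
  final_le := by rintro (_ | _) <;> simp

theorem headTransducer_out_false (f g : Bool → List Bool) (w l : List Bool) :
    (headTransducer f g w).out false l = l.flatMap g := by
  induction l with
  | nil => rfl
  | cons b l ih => simpa [Transducer.out, headTransducer] using ih

theorem headTransducer_out (f g : Bool → List Bool) (w : List Bool) (b : Bool) (l : List Bool) :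
    (headTransducer f g w).out (headTransducer f g w).start (b :: l) = f b ++ l.flatMap g := by
  have := headTransducer_out_false f g w l
  simpa [Transducer.out, headTransducer] using this

theorem headTransducer_out_nil (f g : Bool → List Bool) (w : List Bool) :
    (headTransducer f g w).out (headTransducer f g w).start [] = w := rfl

theorem Computes.cons (h : Computes x y) (b : Bool) : Computes x (fun a => b :: y a) :=
  h.transduce (headTransducer (fun c => [b, c]) (fun c => [c]) [b]) fun a => by
    cases y a <;> simp [headTransducer_out, headTransducer_out_nil]

theorem Computes.tail (h : Computes x y) : Computes x (fun a => (y a).tail) :=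
  h.transduce (headTransducer (fun _ => []) (fun c => [c]) []) fun a => by
    cases y a <;> simp [headTransducer_out, headTransducer_out_nil]

theorem Computes.headD (h : Computes x y) : Computes x (fun a => [(y a).headD false]) :=
  h.transduce (headTransducer (fun b => [b]) (fun _ => []) [false]) fun a => by
    cases y a <;> simp [headTransducer_out, headTransducer_out_nil]

theorem Computes.isEmpty (h : Computes x y) : Computes x (fun a => [(y a).isEmpty]) :=
  h.transduce (headTransducer (fun _ => [false]) (fun _ => []) [true]) fun a => by
    cases y a <;> simp [headTransducer_out, headTransducer_out_nil]

/-- This is doubling in binary with the least significant digit first: zero is the empty word and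
has to remain so. -/
theorem Computes.consFalse (h : Computes x y) :
    Computes x (fun a => if (y a).isEmpty then [] else false :: y a) :=
  h.transduce (headTransducer (fun c => [false, c]) (fun c => [c]) []) fun a => by
    cases y a <;> simp [headTransducer_out, headTransducer_out_nil]

theorem Computes.length (h : Computes x y) : Computes x (fun a => encodeUnary (y a).length) :=
  (h.flatMap (fun _ => [true]) []).of_eq (fun _ => rfl) fun a => by
    simp [encodeUnary, List.flatMap]

/-- A transducer that extracts a component of a pair. In state `none` it expects the flag that
precedes a letter of the first component, in state `some true` that letter, and in state
`some false` a letter of the second component. -/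
def projTransducer (first : Bool) : Transducer where
  Q := Option Bool
  start := none
  next
    | none, b => some b
    | some true, _ => none
    | some false, _ => some false
  emit
    | none, _ => []
    | some true, b => if first then [b] else []
    | some false, b => if first then [] else [b]
  final _ := []
  width := 1
  emit_le := by rintro (_ | _ | _) b <;> cases first <;> simp
  final_le := by simp

theorem Computes.fst (h : Computes x (fun a => pairWord (y a) (z a))) : Computes x y :=
  h.transduce (projTransducer true) fun a => by
    induction y a with
    | nil =>
      suffices H : ∀ l, (projTransducer true).out (some false) l = [] by
        simpa [Transducer.out, projTransducer] using H (z a)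
      intro l
      induction l with
      | nil => rfl
      | cons b l ih => simpa [Transducer.out, projTransducer] using ih
    | cons b l ih => simpa [Transducer.out, projTransducer] using ih

theorem Computes.snd (h : Computes x (fun a => pairWord (y a) (z a))) : Computes x z :=
  h.transduce (projTransducer false) fun a => by
    induction y a with
    | nil =>
      suffices H : ∀ l, (projTransducer false).out (some false) l = l by
        simpa [Transducer.out, projTransducer] using H (z a)
      intro l
      induction l with
      | nil => rfl
      | cons b l ih => simpa [Transducer.out, projTransducer] using ih
    | cons b l ih => simpa [Transducer.out, projTransducer] using ih

/-- Branching is iteration with counter `0` or `1`: starting from the pair `(y, z)`, the map `(u, v)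
↦ (v, v)` is applied not at all or once, and the first component is the answer. -/
theorem Computes.ite {c : α → Bool} (hc : Computes x (fun a => [c a])) (hy : Computes x y)
    (hz : Computes x z) : Computes x (fun a => if c a then y a else z a) := by
  have h1 : Computes x (fun a => encodeUnary (if c a then 0 else 1)) :=
    (hc.flatMap (fun b => if b then [] else [true]) []).of_eq (fun _ => rfl) fun a => by
      cases c a <;> simp [encodeUnary]
  have h2 := h1.pair (hy.pair hz)
  have hid := Computes.refl fun p : List Bool × List Bool => pairWord p.1 p.2
  have h3 := computes_iterate (x := fun p : List Bool × List Bool => pairWord p.1 p.2)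
    (F := fun p => (p.2, p.2)) (N := fun a => if c a then 0 else 1) (I := fun a => (y a, z a))
    (hid.snd.pair hid.snd)
    ⟨fun a => (pairWord (y a) (z a)).length + (pairWord (z a) (z a)).length,
      ?_, fun a i hi => ?_⟩
  · refine (h2.trans h3).fst.of_eq (fun _ => rfl) fun a => ?_
    cases c a <;> rfl
  · have hl := Computes.refl fun a => pairWord (encodeUnary (if c a then 0 else 1))
      (pairWord (y a) (z a))
    exact hl.snd.polyBounded.add (hl.snd.snd.pair hl.snd.snd).polyBounded
  · have : i = 0 ∨ i = 1 := by split_ifs at hi <;> omega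
    rcases this with rfl | rfl <;> simp

theorem Computes.bit₂ (f : Bool → Bool → Bool) {c d : α → Bool}
    (hc : Computes x (fun a => [c a])) (hd : Computes x (fun a => [d a])) :
    Computes x (fun a => [f (c a) (d a)]) :=
  (hc.ite (hd.ite (.const [f true true]) (.const [f true false]))
    (hd.ite (.const [f false true]) (.const [f false false]))).of_eq (fun _ => rfl) fun a => by
      cases c a <;> cases d a <;> rfl

theorem Computes.bit₃ (f : Bool → Bool → Bool → Bool) {b c d : α → Bool}
    (hb : Computes x (fun a => [b a])) (hc : Computes x (fun a => [c a]))
    (hd : Computes x (fun a => [d a])) : Computes x (fun a => [f (b a) (c a) (d a)]) :=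
  (hb.ite (hc.bit₂ (f true) hd) (hc.bit₂ (f false) hd)).of_eq (fun _ => rfl) fun a => by
    cases b a <;> rfl

theorem Computes.consBit {c : α → Bool} (hc : Computes x (fun a => [c a])) (hy : Computes x y) :
    Computes x (fun a => c a :: y a) :=
  (hc.ite (hy.cons true) (hy.cons false)).of_eq (fun _ => rfl) fun a => by cases c a <;> rfl

/-- Primitive recursion, provided that all intermediate values have polynomial length. -/
theorem Computes.natRec {e : β → List Bool} {N : α → ℕ} {r : α → β} {s : α → ℕ → β → β}
    (hN : Computes x (fun a => encodeUnary (N a))) (hr : Computes x (fun a => e (r a)))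
    (hs : Computes
      (fun p : α × ℕ × β => pairWord (x p.1) (pairWord (encodeUnary p.2.1) (e p.2.2)))
      (fun p => e (s p.1 p.2.1 p.2.2)))
    {g : α → ℕ} (hg : PolyBounded x g)
    (hle : ∀ a, ∀ i ≤ N a, (e (Nat.rec (r a) (s a) i)).length ≤ g a) :
    Computes x (fun a => e (Nat.rec (r a) (s a) (N a))) := by
  set E : α × ℕ × β → List Bool :=
    fun p => pairWord (x p.1) (pairWord (encodeUnary p.2.1) (e p.2.2)) with hE
  have hid := Computes.refl E
  -- The input and the step number are carried along in the state, so that a step depending on both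
  -- becomes the iteration of a single map.
  have hF : Computes E (fun p => E (p.1, p.2.1 + 1, s p.1 p.2.1 p.2.2)) :=
    hid.fst.pair ((hid.snd.fst.cons true).pair hs)
  have hit : ∀ a i, (fun p : α × ℕ × β => (p.1, p.2.1 + 1, s p.1 p.2.1 p.2.2))^[i] (a, 0, r a) =
      (a, i, Nat.rec (r a) (s a) i) := by
    intro a i
    induction i with
    | zero => rfl
    | succ i ih => rw [Function.iterate_succ_apply', ih]
  have hI := hN.pair ((Computes.refl x).pair ((Computes.const (encodeUnary 0)).pair hr))
  have h := computes_iterate (x := E) (N := N) (I := fun a => (a, 0, r a)) hF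
    ⟨fun a => 2 * (x a).length + (2 * N a + g a + 1) + 1, ?_, fun a i hi => ?_⟩
  · refine (hI.trans h).snd.snd.of_eq (fun _ => rfl) fun a => ?_
    exact (congrArg (fun p : α × ℕ × β => e p.2.2) (hit a (N a))).symm
  · have hl := Computes.refl fun a => pairWord (encodeUnary (N a)) (E (a, 0, r a))
    have h1 := hl.fst.polyBounded
    simp only [encodeUnary, List.length_replicate] at h1
    exact (((PolyBounded.const 2).mul hl.snd.fst.polyBounded).add
      ((((PolyBounded.const 2).mul h1).add (hg.trans hl.snd.fst.polyBounded)).add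
        (.const 1))).add (.const 1)
  · rw [hit]
    have := hle a i hi
    simp only [hE, length_pairWord, encodeUnary, List.length_replicate]
    omega

end Words

end PeriodicHeat
end

noncomputable section

namespace PeriodicHeat

open Computability (encodeNat encodeNum encodePosNum)

/-! ### Arithmetic of natural numbers in binary -/

/-- This gives access to the lemmas on `Nat.bits`: least significant digit first, no leading zeros,
and the empty word for zero. -/
theorem encodeNat_eq_bits (n : ℕ) : encodeNat n = n.bits := by
  induction n using Nat.binaryRec' with
  | zero => simp [encodeNat, encodeNum]
  | bit b n h ih =>
    rw [Nat.bits_append_bit _ _ h, ← ih, encodeNat, encodeNat, ← Num.ofNat'_eq, ← Num.ofNat'_eq,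
      Num.ofNat'_bit]
    cases hn : Num.ofNat' n with
    | zero =>
      have : n = 0 := by
        have := congrArg (fun m : Num => (m : ℕ)) hn
        simpa [Num.ofNat'_eq] using this
      rw [h this]
      rfl
    | pos p => cases b <;> rfl

theorem encodeNat_zero : encodeNat 0 = [] := rfl

theorem length_encodeNat (n : ℕ) : (encodeNat n).length = n.size := by
  rw [encodeNat_eq_bits, Nat.size_eq_bits_len]

theorem tail_encodeNat (n : ℕ) : (encodeNat n).tail = encodeNat (n / 2) := by
  rw [encodeNat_eq_bits, encodeNat_eq_bits, ← Nat.div2_val]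
  exact (Nat.div2_bits_eq_tail n).symm

theorem headD_encodeNat (n : ℕ) : (encodeNat n).headD false = decide (n % 2 = 1) := by
  rw [encodeNat_eq_bits]
  have h1 := Nat.bodd_eq_bits_head n
  have h2 := Nat.mod_two_of_bodd n
  rw [h2]
  cases hb : n.bits with
  | nil => simp [hb, List.headI] at h1; simp [h1]
  | cons b l => simp [hb, List.headI] at h1; cases b <;> simp [h1]

theorem isEmpty_encodeNat (n : ℕ) : (encodeNat n).isEmpty = decide (n = 0) := by
  rw [Bool.eq_iff_iff, List.isEmpty_iff_length_eq_zero, length_encodeNat, Nat.size_eq_zero]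
  simp

theorem encodeNat_double_add_one (n : ℕ) : encodeNat (2 * n + 1) = true :: encodeNat n := by
  rw [encodeNat_eq_bits, encodeNat_eq_bits, Nat.bit1_bits]

theorem encodeNat_double (n : ℕ) :
    encodeNat (2 * n) = if (encodeNat n).isEmpty then [] else false :: encodeNat n := by
  rw [isEmpty_encodeNat]
  by_cases h : n = 0
  · simp [h, encodeNat_zero]
  · simp only [h, decide_false]
    rw [encodeNat_eq_bits, encodeNat_eq_bits, Nat.bit0_bits _ h]
    rfl

/-- The number with a given list of binary digits, most significant digit first, that continues
the digits of `n`. -/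
def appendDigits (n : ℕ) (l : List Bool) : ℕ :=
  l.foldl (fun m b => 2 * m + b.toNat) n

theorem appendDigits_eq (n : ℕ) (l : List Bool) :
    appendDigits n l = n * 2 ^ l.length + appendDigits 0 l := by
  induction l generalizing n with
  | nil => simp [appendDigits]
  | cons b l ih =>
    have h1 : ∀ m, appendDigits m (b :: l) = appendDigits (2 * m + b.toNat) l := fun _ => rfl
    rw [h1, h1, ih, ih (2 * 0 + b.toNat), List.length_cons, pow_succ]
    ring

theorem appendDigits_cons (b : Bool) (l : List Bool) :
    appendDigits 0 (b :: l) = b.toNat * 2 ^ l.length + appendDigits 0 l := by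
  rw [show appendDigits 0 (b :: l) = appendDigits (2 * 0 + b.toNat) l from rfl, appendDigits_eq]
  simp

theorem appendDigits_lt (l : List Bool) : appendDigits 0 l < 2 ^ l.length := by
  induction l with
  | nil => simp [appendDigits]
  | cons b l ih =>
    rw [appendDigits_cons, List.length_cons, pow_succ]
    cases b <;> simp <;> omega

section Arith

variable {α β : Type} {x : α → List Bool} {m n : α → ℕ} {N : α → ℕ} {c : α → Bool}

theorem Computes.size (h : Computes x (fun a => encodeNat (n a))) :
    Computes x (fun a => encodeUnary (n a).size) :=
  h.length.of_eq (fun _ => rfl) fun a => by rw [length_encodeNat]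

theorem Computes.polyBounded_size (h : Computes x (fun a => encodeNat (n a))) :
    PolyBounded x (fun a => (n a).size) :=
  h.polyBounded.mono fun a => by rw [length_encodeNat]

theorem Computes.polyBounded_unary (h : Computes x (fun a => encodeUnary (N a))) :
    PolyBounded x N :=
  h.polyBounded.mono fun a => by simp [encodeUnary]

theorem Computes.half (h : Computes x (fun a => encodeNat (n a))) :
    Computes x (fun a => encodeNat (n a / 2)) :=
  h.tail.of_eq (fun _ => rfl) fun a => by rw [tail_encodeNat]

theorem Computes.odd (h : Computes x (fun a => encodeNat (n a))) :
    Computes x (fun a => [decide (n a % 2 = 1)]) :=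
  h.headD.of_eq (fun _ => rfl) fun a => by rw [headD_encodeNat]

theorem Computes.eqZero (h : Computes x (fun a => encodeNat (n a))) :
    Computes x (fun a => [decide (n a = 0)]) :=
  h.isEmpty.of_eq (fun _ => rfl) fun a => by rw [isEmpty_encodeNat]

theorem Computes.double (h : Computes x (fun a => encodeNat (n a))) :
    Computes x (fun a => encodeNat (2 * n a)) :=
  h.consFalse.of_eq (fun _ => rfl) fun a => by rw [encodeNat_double]

theorem Computes.doubleAddOne (h : Computes x (fun a => encodeNat (n a))) :
    Computes x (fun a => encodeNat (2 * n a + 1)) :=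
  (h.cons true).of_eq (fun _ => rfl) fun a => by rw [encodeNat_double_add_one]

theorem Computes.iteNat (hc : Computes x (fun a => [c a]))
    (hm : Computes x (fun a => encodeNat (m a))) (hn : Computes x (fun a => encodeNat (n a))) :
    Computes x (fun a => encodeNat (if c a then m a else n a)) :=
  (hc.ite hm hn).of_eq (fun _ => rfl) fun a => by cases c a <;> rfl

theorem Computes.addUnary (hm : Computes x (fun a => encodeUnary (m a)))
    (hn : Computes x (fun a => encodeUnary (n a))) :
    Computes x (fun a => encodeUnary (m a + n a)) := by
  have h := Computes.natRec (x := x) (e := encodeUnary) (N := m) (r := n)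
    (s := fun _ _ k => k + 1) hm hn ((Computes.refl _).snd.snd.cons true)
    (g := fun a => m a + n a) (hm.polyBounded_unary.add hn.polyBounded_unary)
  have e : ∀ a i, (Nat.rec (n a) (fun _ k => k + 1) i : ℕ) = i + n a := fun a i => by
    induction i with
    | zero => simp
    | succ i ih => simp only [ih]; omega
  simp only [e] at h
  exact h fun a i hi => by simp [encodeUnary, hi]

theorem Computes.constUnary (k : ℕ) : Computes x (fun _ => encodeUnary k) := .const _

theorem Computes.constNat (k : ℕ) : Computes x (fun _ => encodeNat k) := .const _

theorem Computes.constMulUnary (k : ℕ) (hn : Computes x (fun a => encodeUnary (n a))) :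
    Computes x (fun a => encodeUnary (k * n a)) :=
  (hn.flatMap (fun _ => List.replicate k true) []).of_eq (fun _ => rfl) fun a => by
    simp only [encodeUnary, List.append_nil]
    induction n a with
    | zero => simp
    | succ i ih =>
      rw [List.replicate_succ, List.flatMap_cons, ← ih, Nat.mul_succ, Nat.add_comm,
        List.replicate_add]

/-- Turns an arbitrary digit list, most significant digit first, into the canonical code of a number
by Horner's scheme. Leading zeros disappear because doubling zero yields the empty word. -/
theorem Computes.appendDigits {l : α → List Bool} (hn : Computes x (fun a => encodeNat (n a)))
    (hl : Computes x l) : Computes x (fun a => encodeNat (PeriodicHeat.appendDigits (n a) (l a))) := by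
  let e : ℕ × List Bool → List Bool := fun p => pairWord (encodeNat p.1) p.2
  have hid := Computes.refl fun p : α × ℕ × (ℕ × List Bool) =>
    pairWord (x p.1) (pairWord (encodeUnary p.2.1) (e p.2.2))
  have hs := (hid.snd.snd.snd.headD.iteNat hid.snd.snd.fst.doubleAddOne
    hid.snd.snd.fst.double).pair hid.snd.snd.snd.tail
  have h := Computes.natRec (x := x) (e := e) (N := fun a => (l a).length)
    (r := fun a => (n a, l a)) (s := fun _ _ p =>
      (if p.2.headD false then 2 * p.1 + 1 else 2 * p.1, p.2.tail)) hl.length (hn.pair hl) hs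
    (g := fun a => 2 * ((n a).size + (l a).length) + (l a).length + 1)
    ((((PolyBounded.const 2).mul (hn.polyBounded_size.add hl.polyBounded)).add
      hl.polyBounded).add (.const 1))
  have ef : ∀ p : ℕ × List Bool, p.2 ≠ [] →
      PeriodicHeat.appendDigits (if p.2.headD false then 2 * p.1 + 1 else 2 * p.1) p.2.tail =
      PeriodicHeat.appendDigits p.1 p.2 := by
    rintro ⟨k, l⟩ hl
    cases l with
    | nil => exact absurd rfl hl
    | cons b l => cases b <;> simp [PeriodicHeat.appendDigits]
  -- After `i` digits the value of what is read and what remains is unchanged, and the size has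
  -- grown by at most one per digit.
  have inv : ∀ a, ∀ i ≤ (l a).length, ∃ k, (Nat.rec (n a, l a) (fun _ p =>
      (if p.2.headD false then 2 * p.1 + 1 else 2 * p.1, p.2.tail)) i : ℕ × List Bool) =
      (k, (l a).drop i) ∧ PeriodicHeat.appendDigits k ((l a).drop i) =
        PeriodicHeat.appendDigits (n a) (l a) ∧ k.size ≤ (n a).size + i := by
    intro a i
    induction i with
    | zero => exact fun _ => ⟨n a, by simp⟩
    | succ i ih =>
      intro hi
      obtain ⟨k, h1, h2, h3⟩ := ih (by omega)
      refine ⟨if ((l a).drop i).headD false then 2 * k + 1 else 2 * k,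
        by simp only [h1, List.tail_drop], ?_, ?_⟩
      · rw [← h2, ← ef (k, (l a).drop i) (by simp; omega)]
        simp
      · rw [Nat.size_le] at h3 ⊢
        rw [← add_assoc, pow_succ]
        split_ifs <;> omega
  refine (h fun a i hi => ?_).fst.of_eq (fun _ => rfl) fun a => ?_
  · obtain ⟨k, h1, h2, h3⟩ := inv a i hi
    rw [h1]
    simp only [e, length_pairWord, length_encodeNat, List.length_drop]
    omega
  · obtain ⟨k, h1, h2, h3⟩ := inv a _ le_rfl
    rw [h1, ← h2]
    simp [PeriodicHeat.appendDigits]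

/-- Digit-wise operation with a carry on two numbers, least significant digits first: `f` gives the
carry and `g` the digits of the result. -/
def ripple (f g : Bool → Bool → Bool → Bool) (m n : ℕ) : ℕ → ℕ × ℕ × Bool × List Bool :=
  Nat.rec (m, n, false, []) fun _ p => (p.1 / 2, p.2.1 / 2,
    f (decide (p.1 % 2 = 1)) (decide (p.2.1 % 2 = 1)) p.2.2.1,
    g (decide (p.1 % 2 = 1)) (decide (p.2.1 % 2 = 1)) p.2.2.1 :: p.2.2.2)

theorem ripple_fst (f g : Bool → Bool → Bool → Bool) (m n i : ℕ) :
    (ripple f g m n i).1 = m / 2 ^ i ∧ (ripple f g m n i).2.1 = n / 2 ^ i ∧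
      (ripple f g m n i).2.2.2.length = i := by
  induction i with
  | zero => simp [ripple]
  | succ i ih =>
    simp only [ripple] at ih ⊢
    simp [ih, pow_succ, Nat.div_div_eq_div_mul]

theorem size_div_le (m k : ℕ) : (m / k).size ≤ m.size :=
  Nat.size_le_size (Nat.div_le_self _ _)

theorem Computes.ripple (f g : Bool → Bool → Bool → Bool)
    (hm : Computes x (fun a => encodeNat (m a))) (hn : Computes x (fun a => encodeNat (n a)))
    (hN : Computes x (fun a => encodeUnary (N a))) :
    Computes x (fun a => [(PeriodicHeat.ripple f g (m a) (n a) (N a)).2.2.1]) ∧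
    Computes x (fun a => (PeriodicHeat.ripple f g (m a) (n a) (N a)).2.2.2) := by
  let e : ℕ × ℕ × Bool × List Bool → List Bool := fun p =>
    pairWord (encodeNat p.1) (pairWord (encodeNat p.2.1) (pairWord [p.2.2.1] p.2.2.2))
  have hid := Computes.refl fun p : α × ℕ × (ℕ × ℕ × Bool × List Bool) =>
    pairWord (x p.1) (pairWord (encodeUnary p.2.1) (e p.2.2))
  have h1 := hid.snd.snd.fst
  have h2 := hid.snd.snd.snd.fst
  have h3 := hid.snd.snd.snd.snd.fst
  have h4 := hid.snd.snd.snd.snd.snd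
  have hs := h1.half.pair (h2.half.pair ((h1.odd.bit₃ f h2.odd h3).pair
    ((h1.odd.bit₃ g h2.odd h3).consBit h4)))
  have h := Computes.natRec (x := x) (e := e) (N := N) (r := fun a => (m a, n a, false, []))
    (s := fun _ _ p => (p.1 / 2, p.2.1 / 2,
      f (decide (p.1 % 2 = 1)) (decide (p.2.1 % 2 = 1)) p.2.2.1,
      g (decide (p.1 % 2 = 1)) (decide (p.2.1 % 2 = 1)) p.2.2.1 :: p.2.2.2)) hN
    (hm.pair (hn.pair ((Computes.const [false]).pair (Computes.const [])))) hs
    (g := fun a => 2 * (m a).size + (2 * (n a).size + (2 + N a + 1) + 1) + 1)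
    ((((PolyBounded.const 2).mul hm.polyBounded_size).add
      ((((PolyBounded.const 2).mul hn.polyBounded_size).add
        (((PolyBounded.const 2).add hN.polyBounded_unary).add (.const 1))).add (.const 1))).add
      (.const 1))
  have h' := h fun a i hi => by
    obtain ⟨e1, e2, e3⟩ := ripple_fst f g (m a) (n a) i
    change (e (PeriodicHeat.ripple f g (m a) (n a) i)).length ≤ _
    have := size_div_le (m a) (2 ^ i)
    have := size_div_le (n a) (2 ^ i)
    simp only [e, length_pairWord, length_encodeNat, e1, e2, e3, List.length_singleton]
    omega
  exact ⟨h'.snd.snd.fst, h'.snd.snd.snd⟩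

/-- School addition: the carry is the majority of the three bits and the digit is their sum modulo
2. After `i` digits the carry has weight `2 ^ i`. The digits are collected most significant first,
as `appendDigits` wants them. -/
theorem ripple_add (m n i : ℕ) :
    m % 2 ^ i + n % 2 ^ i =
      (ripple (fun a b c => a && b || (c && (a || b))) (fun a b c => a ^^ b ^^ c) m n i).2.2.1.toNat
        * 2 ^ i +
      appendDigits 0
        (ripple (fun a b c => a && b || (c && (a || b))) (fun a b c => a ^^ b ^^ c) m n i).2.2.2 := by
  induction i with
  | zero => simp [ripple, appendDigits, Nat.mod_one]
  | succ i ih =>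
    obtain ⟨e1, e2, e3⟩ := ripple_fst (fun a b c => a && b || (c && (a || b)))
      (fun a b c => a ^^ b ^^ c) m n i
    have hm : m % 2 ^ (i + 1) = m % 2 ^ i + 2 ^ i * (m / 2 ^ i % 2) := Nat.mod_pow_succ
    have hn : n % 2 ^ (i + 1) = n % 2 ^ i + 2 ^ i * (n / 2 ^ i % 2) := Nat.mod_pow_succ
    rw [hm, hn]
    simp only [ripple] at ih e1 e2 e3 ⊢
    rw [appendDigits_cons, e3, e1, e2, pow_succ]
    generalize 2 ^ i = P at *
    generalize (Nat.rec _ _ i : ℕ × ℕ × Bool × List Bool).2.2.1 = c at *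
    -- With the two digits and the carry fixed, the claim is linear in `P = 2 ^ i`.
    rcases Nat.mod_two_eq_zero_or_one (m / P) with h1 | h1 <;>
    rcases Nat.mod_two_eq_zero_or_one (n / P) with h2 | h2 <;>
    cases c <;> simp [h1, h2] at ih ⊢ <;> omega

/-- School subtraction: the borrow is the majority of `!a`, `b`, `c`. It stands on the side of the
minuend, which avoids truncated subtraction. -/
theorem ripple_sub (m n i : ℕ) :
    m % 2 ^ i + (ripple (fun a b c => (b && c) || (!a && (b || c))) (fun a b c => a ^^ b ^^ c)
        m n i).2.2.1.toNat * 2 ^ i =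
      n % 2 ^ i + appendDigits 0 (ripple (fun a b c => (b && c) || (!a && (b || c)))
        (fun a b c => a ^^ b ^^ c) m n i).2.2.2 := by
  induction i with
  | zero => simp [ripple, appendDigits, Nat.mod_one]
  | succ i ih =>
    obtain ⟨e1, e2, e3⟩ := ripple_fst (fun a b c => (b && c) || (!a && (b || c)))
      (fun a b c => a ^^ b ^^ c) m n i
    have hm : m % 2 ^ (i + 1) = m % 2 ^ i + 2 ^ i * (m / 2 ^ i % 2) := Nat.mod_pow_succ
    have hn : n % 2 ^ (i + 1) = n % 2 ^ i + 2 ^ i * (n / 2 ^ i % 2) := Nat.mod_pow_succ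
    rw [hm, hn]
    simp only [ripple] at ih e1 e2 e3 ⊢
    rw [appendDigits_cons, e3, e1, e2, pow_succ]
    generalize 2 ^ i = P at *
    generalize (Nat.rec _ _ i : ℕ × ℕ × Bool × List Bool).2.2.1 = c at *
    rcases Nat.mod_two_eq_zero_or_one (m / P) with h1 | h1 <;>
    rcases Nat.mod_two_eq_zero_or_one (n / P) with h2 | h2 <;>
    cases c <;> simp [h1, h2] at ih ⊢ <;> omega

/-- The sum of the two sizes serves as a common number of digits, so that the remainders modulo `2 ^
i` in the `ripple` lemmas are the numbers themselves. -/
theorem lt_two_pow_size_add (m n : ℕ) : m < 2 ^ (m.size + n.size) ∧ n < 2 ^ (m.size + n.size) :=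
  ⟨(Nat.lt_size_self m).trans_le (Nat.pow_le_pow_right (by norm_num) (by omega)),
    (Nat.lt_size_self n).trans_le (Nat.pow_le_pow_right (by norm_num) (by omega))⟩

theorem Computes.add (hm : Computes x (fun a => encodeNat (m a)))
    (hn : Computes x (fun a => encodeNat (n a))) :
    Computes x (fun a => encodeNat (m a + n a)) := by
  obtain ⟨h1, h2⟩ := Computes.ripple (fun a b c => a && b || (c && (a || b)))
    (fun a b c => a ^^ b ^^ c) hm hn (hm.size.addUnary hn.size)
  -- The last carry becomes the leading digit.
  refine ((h1.iteNat (.constNat 1) (.constNat 0)).appendDigits h2).of_eq (fun _ => rfl) fun a => ?_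
  obtain ⟨l1, l2⟩ := lt_two_pow_size_add (m a) (n a)
  have e := ripple_add (m a) (n a) ((m a).size + (n a).size)
  rw [Nat.mod_eq_of_lt l1, Nat.mod_eq_of_lt l2] at e
  have hlen := (ripple_fst (fun a b c => a && b || (c && (a || b))) (fun a b c => a ^^ b ^^ c)
    (m a) (n a) ((m a).size + (n a).size)).2.2
  revert e hlen
  generalize PeriodicHeat.ripple _ _ _ _ _ = R
  intro e hlen
  rw [e]
  conv_rhs => rw [PeriodicHeat.appendDigits_eq, hlen]
  cases R.2.2.1 <;> rfl

theorem Computes.sub (hm : Computes x (fun a => encodeNat (m a)))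
    (hn : Computes x (fun a => encodeNat (n a))) :
    Computes x (fun a => encodeNat (m a - n a)) := by
  obtain ⟨h1, h2⟩ := Computes.ripple (fun a b c => (b && c) || (!a && (b || c)))
    (fun a b c => a ^^ b ^^ c) hm hn (hm.size.addUnary hn.size)
  -- A last borrow means `m < n`, where truncated subtraction gives `0`.
  refine (h1.iteNat (.constNat 0) ((Computes.constNat 0).appendDigits h2)).of_eq (fun _ => rfl)
    fun a => ?_
  obtain ⟨l1, l2⟩ := lt_two_pow_size_add (m a) (n a)
  have e := ripple_sub (m a) (n a) ((m a).size + (n a).size)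
  rw [Nat.mod_eq_of_lt l1, Nat.mod_eq_of_lt l2] at e
  have hlen := (ripple_fst (fun a b c => (b && c) || (!a && (b || c))) (fun a b c => a ^^ b ^^ c)
    (m a) (n a) ((m a).size + (n a).size)).2.2
  revert e hlen
  generalize PeriodicHeat.ripple _ _ _ _ _ = R
  intro e hlen
  have hl := PeriodicHeat.appendDigits_lt R.2.2.2
  rw [hlen] at hl
  congr 1
  revert e
  cases R.2.2.1 <;> simp <;> omega

theorem Computes.le (hm : Computes x (fun a => encodeNat (m a)))
    (hn : Computes x (fun a => encodeNat (n a))) :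
    Computes x (fun a => [decide (m a ≤ n a)]) :=
  (hm.sub hn).eqZero.of_eq (fun _ => rfl) fun a => by rw [decide_eq_decide.2 Nat.sub_eq_zero_iff_le]

theorem mul_lt_two_pow {m n i j : ℕ} (hm : m < 2 ^ i) (hn : n < 2 ^ j) : m * n < 2 ^ (i + j) := by
  rw [pow_add]
  exact Nat.mul_lt_mul'' hm hn

/-- Shift and add: the state `(k, m * 2 ^ i, n / 2 ^ i)` keeps `k + (m * 2 ^ i) * (n / 2 ^ i) = m *
n`, so the accumulator never exceeds the product. After `n.size` rounds the last component is zero.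
-/
theorem Computes.mul (hm : Computes x (fun a => encodeNat (m a)))
    (hn : Computes x (fun a => encodeNat (n a))) :
    Computes x (fun a => encodeNat (m a * n a)) := by
  let e : ℕ × ℕ × ℕ → List Bool := fun p =>
    pairWord (encodeNat p.1) (pairWord (encodeNat p.2.1) (encodeNat p.2.2))
  let s : ℕ × ℕ × ℕ → ℕ × ℕ × ℕ := fun p =>
    (if decide (p.2.2 % 2 = 1) then p.1 + p.2.1 else p.1, 2 * p.2.1, p.2.2 / 2)
  have hid := Computes.refl fun p : α × ℕ × (ℕ × ℕ × ℕ) =>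
    pairWord (x p.1) (pairWord (encodeUnary p.2.1) (e p.2.2))
  have h1 := hid.snd.snd.fst
  have h2 := hid.snd.snd.snd.fst
  have h3 := hid.snd.snd.snd.snd
  have hs := (h3.odd.iteNat (h1.add h2) h1).pair (h2.double.pair h3.half)
  have h := Computes.natRec (x := x) (e := e) (N := fun a => (n a).size)
    (r := fun a => (0, m a, n a)) (s := fun _ _ => s) hn.size
    ((Computes.constNat 0).pair (hm.pair hn)) hs
    (g := fun a => 2 * ((m a).size + (n a).size) + (2 * ((m a).size + (n a).size) +
      (n a).size + 1) + 1)
    ((((PolyBounded.const 2).mul (hm.polyBounded_size.add hn.polyBounded_size)).add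
      ((((PolyBounded.const 2).mul (hm.polyBounded_size.add hn.polyBounded_size)).add
        hn.polyBounded_size).add (.const 1))).add (.const 1))
  have inv : ∀ a i, ∃ k, (Nat.rec (0, m a, n a) (fun _ => s) i : ℕ × ℕ × ℕ) =
      (k, m a * 2 ^ i, n a / 2 ^ i) ∧ k + (m a * 2 ^ i) * (n a / 2 ^ i) = m a * n a := by
    intro a i
    induction i with
    | zero => exact ⟨0, by simp⟩
    | succ i ih =>
      obtain ⟨k, e1, e2⟩ := ih
      refine ⟨if decide (n a / 2 ^ i % 2 = 1) then k + m a * 2 ^ i else k, by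
        simp only [e1, s]
        rw [Nat.div_div_eq_div_mul, ← pow_succ, ← mul_left_comm, ← pow_succ'], ?_⟩
      rw [← e2, pow_succ, ← Nat.div_div_eq_div_mul]
      generalize n a / 2 ^ i = q
      rw [← mul_assoc]
      generalize m a * 2 ^ i = r
      have hq := Nat.div_add_mod q 2
      rcases Nat.mod_two_eq_zero_or_one q with h | h
      · rw [h] at hq
        simp only [h]
        conv_rhs => rw [← hq]
        simp
        ring
      · rw [h] at hq
        simp only [h]
        conv_rhs => rw [← hq]
        simp
        ring
  refine (h fun a i hi => ?_).fst.of_eq (fun _ => rfl) fun a => ?_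
  · obtain ⟨k, e1, e2⟩ := inv a i
    rw [e1]
    have b1 : k.size ≤ (m a).size + (n a).size := by
      rw [Nat.size_le]
      exact lt_of_le_of_lt (by omega : k ≤ m a * n a)
        (mul_lt_two_pow (Nat.lt_size_self _) (Nat.lt_size_self _))
    have b2 : (m a * 2 ^ i).size ≤ (m a).size + (n a).size := by
      rw [Nat.size_le, pow_add]
      exact Nat.mul_lt_mul_of_lt_of_le (Nat.lt_size_self _)
        (Nat.pow_le_pow_right (by norm_num) hi) (by positivity)
    have b3 := size_div_le (n a) (2 ^ i)
    simp only [e, length_pairWord, length_encodeNat]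
    omega
  · obtain ⟨k, e1, e2⟩ := inv a (n a).size
    rw [e1]
    rw [Nat.div_eq_of_lt (Nat.lt_size_self _)] at e2
    simp only [← e2]
    simp

end Arith

end PeriodicHeat
end

noncomputable section

namespace PeriodicHeat

open Computability (encodeNat)

/-! ### Powers, shifts, division and sums -/

section Arith

variable {α : Type} {x : α → List Bool} {m n N : α → ℕ} {z : α → ℤ} {c : α → Bool}

theorem Computes.twoPow (h : Computes x (fun a => encodeUnary (N a))) :
    Computes x (fun a => encodeNat (2 ^ N a)) :=
  (h.flatMap (fun _ => [false]) [true]).of_eq (fun _ => rfl) fun a => by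
    induction N a with
    | zero => rfl
    | succ i ih =>
      rw [pow_succ', encodeNat_double, isEmpty_encodeNat, ih]
      simp [encodeUnary, List.replicate_succ]

theorem Computes.shiftRight (hn : Computes x (fun a => encodeNat (n a)))
    (hN : Computes x (fun a => encodeUnary (N a))) :
    Computes x (fun a => encodeNat (n a / 2 ^ N a)) := by
  have h := Computes.natRec (x := x) (e := encodeNat) (N := N) (r := n)
    (s := fun _ _ k => k / 2) hN hn (Computes.refl _).snd.snd.half
    (g := fun a => (n a).size) hn.polyBounded_size
  have e : ∀ a i, (Nat.rec (n a) (fun _ k => k / 2) i : ℕ) = n a / 2 ^ i := fun a i => by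
    induction i with
    | zero => simp
    | succ i ih => simp only [ih, Nat.div_div_eq_div_mul, pow_succ]
  simp only [e] at h
  exact h fun a i hi => by rw [length_encodeNat]; exact size_div_le _ _

theorem Computes.constPow (q : ℕ) (hN : Computes x (fun a => encodeUnary (N a))) :
    Computes x (fun a => encodeNat (q ^ N a)) := by
  have h := Computes.natRec (x := x) (e := encodeNat) (N := N) (r := fun _ => 1)
    (s := fun _ _ k => k * q) hN (.constNat 1) ((Computes.refl _).snd.snd.mul (.constNat q))
    (g := fun a => q.size * N a + 1)
    (((PolyBounded.const _).mul hN.polyBounded_unary).add (.const 1))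
  have e : ∀ i, (Nat.rec 1 (fun _ k => k * q) i : ℕ) = q ^ i := fun i => by
    induction i with
    | zero => simp
    | succ i ih => simp only [ih, pow_succ]
  simp only [e] at h
  refine h fun a i hi => ?_
  rw [length_encodeNat, Nat.size_le]
  calc q ^ i ≤ (2 ^ q.size) ^ i := Nat.pow_le_pow_left (Nat.lt_size_self q).le i
    _ = 2 ^ (q.size * i) := (pow_mul _ _ _).symm
    _ < 2 ^ (q.size * N a + 1) := Nat.pow_lt_pow_right (by norm_num)
      (Nat.lt_succ_of_le (Nat.mul_le_mul_left _ hi))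

/-- Long division of a power of two. -/
theorem Computes.twoPowDiv (hn : Computes x (fun a => encodeNat (n a)))
    (hN : Computes x (fun a => encodeUnary (N a))) (hlt : ∀ a, 1 < n a) :
    Computes x (fun a => encodeNat (2 ^ N a / n a)) := by
  let e : ℕ × ℕ → List Bool := fun p => pairWord (encodeNat p.1) (encodeNat p.2)
  let s : α → ℕ → ℕ × ℕ → ℕ × ℕ := fun a _ p =>
    (if decide (n a ≤ 2 * p.1) then 2 * p.1 - n a else 2 * p.1,
      if decide (n a ≤ 2 * p.1) then 2 * p.2 + 1 else 2 * p.2)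
  have hid := Computes.refl fun p : α × ℕ × (ℕ × ℕ) =>
    pairWord (x p.1) (pairWord (encodeUnary p.2.1) (e p.2.2))
  have h1 := hid.snd.snd.fst
  have h2 := hid.snd.snd.snd
  have h3 := hid.fst.trans (hn.comp fun p : α × ℕ × (ℕ × ℕ) => p.1)
  have hs := ((h3.le h1.double).iteNat (h1.double.sub h3) h1.double).pair
    ((h3.le h1.double).iteNat h2.doubleAddOne h2.double)
  have h := Computes.natRec (x := x) (e := e) (N := N) (r := fun _ => (1, 0)) (s := s) hN
    ((Computes.constNat 1).pair (.constNat 0)) hs (g := fun a => 2 * (n a).size + (N a + 1) + 1)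
    ((((PolyBounded.const 2).mul hn.polyBounded_size).add
      (hN.polyBounded_unary.add (.const 1))).add (.const 1))
  -- The state consists of remainder and quotient of `2 ^ i`; each further digit of the dividend is
  -- zero. The start `(1, 0)` is correct because the divisor exceeds `1`.
  have inv : ∀ a i, (Nat.rec (1, 0) (s a) i : ℕ × ℕ) = (2 ^ i % n a, 2 ^ i / n a) := by
    intro a i
    induction i with
    | zero => simp [Nat.mod_eq_of_lt (hlt a), Nat.div_eq_of_lt (hlt a)]
    | succ i ih =>
      simp only [ih, s]
      have hd := Nat.div_add_mod (2 ^ i) (n a)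
      have hr := Nat.mod_lt (2 ^ i) (zero_lt_one.trans (hlt a))
      have hp : 2 ^ (i + 1) = 2 * 2 ^ i := pow_succ' 2 i
      generalize 2 ^ i / n a = q at *
      generalize 2 ^ i % n a = r at *
      by_cases hc : n a ≤ 2 * r
      · have := (Nat.div_mod_unique (a := 2 ^ (i + 1)) (b := n a) (c := 2 * r - n a)
          (d := 2 * q + 1) (by omega)).2 ⟨by
            rw [hp, ← hd, show n a * (2 * q + 1) = 2 * (n a * q) + n a by ring]; omega, by omega⟩
        simp [hc, this.1, this.2]
      · have := (Nat.div_mod_unique (a := 2 ^ (i + 1)) (b := n a) (c := 2 * r)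
          (d := 2 * q) (by omega)).2 ⟨by
            rw [hp, ← hd, show n a * (2 * q) = 2 * (n a * q) by ring]; omega, by omega⟩
        simp [hc, this.1, this.2]
  refine (h fun a i hi => ?_).snd.of_eq (fun _ => rfl) fun a => by rw [inv]
  rw [inv]
  have b1 : (2 ^ i % n a).size ≤ (n a).size :=
    Nat.size_le_size (Nat.mod_lt _ (zero_lt_one.trans (hlt a))).le
  have b2 : (2 ^ i / n a).size ≤ N a + 1 := (size_div_le _ _).trans (by
    rw [Nat.size_pow]; omega)
  simp only [e, length_pairWord, length_encodeNat]
  omega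

theorem Computes.unaryToBinary (hN : Computes x (fun a => encodeUnary (N a))) :
    Computes x (fun a => encodeNat (N a)) := by
  have h := Computes.natRec (x := x) (e := encodeNat) (N := N) (r := fun _ => 0)
    (s := fun _ _ k => k + 1) hN (.constNat 0) ((Computes.refl _).snd.snd.add (.constNat 1))
    (g := N) hN.polyBounded_unary
  have e : ∀ i, (Nat.rec 0 (fun _ k => k + 1) i : ℕ) = i := fun i => by
    induction i with
    | zero => simp
    | succ i ih => simp only [ih]
  simp only [e] at h
  refine h fun a i hi => ?_
  rw [length_encodeNat, Nat.size_le]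
  exact hi.trans_lt Nat.lt_two_pow_self

/-- Summation with a unary number of terms. -/
theorem Computes.sum {T : α → ℕ → ℕ} (hN : Computes x (fun a => encodeUnary (N a)))
    (hT : Computes (fun p : α × ℕ => pairWord (x p.1) (encodeUnary p.2))
      (fun p => encodeNat (T p.1 p.2)))
    {g : α → ℕ} (hg : PolyBounded x g) (hle : ∀ a, ∑ i ∈ Finset.range (N a), T a i < 2 ^ g a) :
    Computes x (fun a => encodeNat (∑ i ∈ Finset.range (N a), T a i)) := by
  have hid := Computes.refl fun p : α × ℕ × ℕ =>
    pairWord (x p.1) (pairWord (encodeUnary p.2.1) (encodeNat p.2.2))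
  have h := Computes.natRec (x := x) (e := encodeNat) (N := N) (r := fun _ => 0)
    (s := fun a i k => k + T a i) hN (.constNat 0)
    (hid.snd.snd.add ((hid.fst.pair hid.snd.fst).trans
      (hT.comp fun p : α × ℕ × ℕ => (p.1, p.2.1)))) (g := g) hg
  have e : ∀ a i, (Nat.rec 0 (fun i k => k + T a i) i : ℕ) = ∑ j ∈ Finset.range i, T a j :=
    fun a i => by
      induction i with
      | zero => simp
      | succ i ih => simp only [ih, Finset.sum_range_succ]
  simp only [e] at h
  refine h fun a i hi => ?_
  rw [length_encodeNat, Nat.size_le]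
  exact (Finset.sum_le_sum_of_subset (Finset.range_mono hi)).trans_lt (hle a)

/-! ### Integers and indices -/

theorem Computes.natAbs (h : Computes x (fun a => encodeInt (z a))) :
    Computes x (fun a => encodeNat (z a).natAbs) :=
  h.tail

theorem Computes.neg (h : Computes x (fun a => encodeInt (z a))) :
    Computes x (fun a => [decide (z a < 0)]) :=
  h.headD

theorem Computes.signed (hc : Computes x (fun a => [c a]))
    (hn : Computes x (fun a => encodeNat (n a))) :
    Computes x (fun a => encodeInt (if c a then -(n a : ℤ) else n a)) :=
  -- Zero has to get the sign bit `false` whatever `c` is.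
  (hn.eqZero.ite (.const [false]) (hc.consBit hn)).of_eq (fun _ => rfl) fun a => by
    by_cases h : n a = 0
    · simp [h, encodeInt, encodeNat_zero]
    · have h0 : 0 < n a := by omega
      cases c a <;> simp [h, h0, encodeInt]

theorem encodeIndex_eq (p : ℕ × ℤ) :
    encodeIndex p = List.replicate p.1 true ++ false :: encodeInt p.2 := rfl

/-- A transducer that turns an index into a pair. -/
def indexTransducer : Transducer where
  Q := Bool
  start := true
  next q b := q && b
  emit q b := if q && b then [true, true] else [b]
  final _ := []
  width := 2
  emit_le := by rintro (_ | _) (_ | _) <;> simp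
  final_le := by simp

theorem indexTransducer_out_false (l : List Bool) : indexTransducer.out false l = l := by
  induction l with
  | nil => rfl
  | cons b l ih => simpa [Transducer.out, indexTransducer] using ih

/-- Only the leading ones need to be doubled, into a flag and a letter; the separating `0` of the
index already is the flag that announces the second component. -/
theorem computes_index_pair :
    Computes encodeIndex (fun p => pairWord (encodeUnary p.1) (encodeInt p.2)) :=
  (Computes.refl _).transduce indexTransducer fun p => by
    rw [encodeIndex_eq, encodeUnary]
    induction p.1 with
    | zero => simpa [Transducer.out, indexTransducer] using indexTransducer_out_false _
    | succ n ih => simpa [Transducer.out, indexTransducer, List.replicate_succ] using ih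

/-- A transducer that turns a pair into an index. In state `none` it expects a flag, in state
`some true` a letter of the first component, in state `some false` one of the second component. -/
def pairTransducer : Transducer where
  Q := Option Bool
  start := none
  next
    | none, b => some b
    | some true, _ => none
    | some false, _ => some false
  emit
    | none, b => if b then [] else [false]
    | some _, b => [b]
  final _ := []
  width := 1
  emit_le := by rintro (_ | _ | _) (_ | _) <;> simp
  final_le := by simp

theorem pairTransducer_out_false (l : List Bool) : pairTransducer.out (some false) l = l := by
  induction l with
  | nil => rfl
  | cons b l ih => simpa [Transducer.out, pairTransducer] using ih

theorem Computes.index (hN : Computes x (fun a => encodeUnary (N a)))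
    (hz : Computes x (fun a => encodeInt (z a))) : Computes x (fun a => encodeIndex (N a, z a)) :=
  (hN.pair hz).transduce pairTransducer fun a => by
    rw [encodeIndex_eq, encodeUnary]
    induction N a with
    | zero => simpa [Transducer.out, pairTransducer] using pairTransducer_out_false _
    | succ n ih => simpa [Transducer.out, pairTransducer, List.replicate_succ] using ih

end Arith

end PeriodicHeat
end

noncomputable section

namespace PeriodicHeat

open Computability (encodeNat)

/-! ### Computable real numbers -/

/-- Division by `2 ^ (S + 1)`, rounded to a nearest integer. -/
def roundShift (n S : ℕ) : ℕ := (n + 2 ^ S) / 2 ^ (S + 1)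

/-- Rounding to a nearest integer uses up only half of the admissible error `1 / 2 ^ n` and leaves
the other half to the data. -/
theorem abs_div_sub_roundShift_le (n S : ℕ) :
    |(n : ℝ) / 2 ^ (S + 1) - roundShift n S| ≤ 1 / 2 := by
  have h := Nat.div_add_mod (n + 2 ^ S) (2 ^ (S + 1))
  have hlt := Nat.mod_lt (n + 2 ^ S) (show 0 < 2 ^ (S + 1) by positivity)
  change 2 ^ (S + 1) * roundShift n S + _ = _ at h
  generalize (n + 2 ^ S) % 2 ^ (S + 1) = r at *
  have h' : (2 : ℝ) ^ (S + 1) * roundShift n S + r = n + 2 ^ S := by exact_mod_cast h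
  have hlt' : (r : ℝ) < 2 ^ (S + 1) := by exact_mod_cast hlt
  have hp : (0 : ℝ) < 2 ^ (S + 1) := by positivity
  have hr : (0 : ℝ) ≤ r := by positivity
  have e : (n : ℝ) / 2 ^ (S + 1) - roundShift n S = (r - 2 ^ S) / 2 ^ (S + 1) := by
    field_simp
    linarith
  rw [e, abs_div, abs_of_pos hp, div_le_iff₀ hp, abs_le]
  rw [pow_succ] at *
  constructor <;> linarith

theorem Computes.roundShift {α : Type} {x : α → List Bool} {n S : α → ℕ}
    (hn : Computes x (fun a => encodeNat (n a))) (hS : Computes x (fun a => encodeUnary (S a))) :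
    Computes x (fun a => encodeNat (PeriodicHeat.roundShift (n a) (S a))) :=
  (hn.add hS.twoPow).shiftRight (hS.addUnary (.constUnary 1))

/-- The nonnegative real number `r` has natural numbers as approximations that are computable in
polynomial time. -/
def NatApproximable (r : ℝ) : Prop :=
  ∃ A : ℕ → ℕ, (∀ n, |r - (A n : ℝ) / 2 ^ n| ≤ 1 / 2 ^ n) ∧
    Computes encodeUnary (fun n => encodeNat (A n))

/-- For `r ≥ 0`, replacing an approximation by its absolute value does not increase the error. -/
theorem PolyTimeReal.natApproximable {r : ℝ} (h : PolyTimeReal r) (hr : 0 ≤ r) :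
    NatApproximable r := by
  obtain ⟨a, ha, hc⟩ := h
  refine ⟨fun n => (a n).natAbs, fun n => ?_, (polyTime_iff.1 hc).natAbs⟩
  refine le_trans ?_ (ha n)
  have h1 := abs_abs_sub_abs_le r ((a n : ℝ) / 2 ^ n)
  rwa [abs_of_nonneg hr, abs_div, abs_of_pos (show (0 : ℝ) < 2 ^ n by positivity),
    ← Int.cast_abs, Int.abs_eq_natAbs] at h1

theorem NatApproximable.mul {r s : ℝ} (hr : NatApproximable r) (hs : NatApproximable s)
    (hr0 : 0 ≤ r) : NatApproximable (r * s) := by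
  obtain ⟨A, hA, hAc⟩ := hr
  obtain ⟨B, hB, hBc⟩ := hs
  -- With `M = n + b + 3` bits for both factors, each at most `2 ^ b`, the product errs by at most
  -- `2 * 2 ^ b / 2 ^ M = (1 / 4) / 2 ^ n`. The shift by `2 * M - n = n + 2 * b + 6` then rounds to
  -- `n` bits and adds `(1 / 2) / 2 ^ n`.
  obtain ⟨b, hb⟩ := pow_unbounded_of_one_lt (max r (|s| + 1)) (one_lt_two : (1 : ℝ) < 2)
  have hM : Computes encodeUnary (fun n => encodeUnary (n + (b + 3))) :=
    (Computes.refl _).addUnary (.constUnary _)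
  refine ⟨fun n => roundShift (A (n + (b + 3)) * B (n + (b + 3))) (n + (2 * b + 5)), fun n => ?_,
    ((hM.trans (hAc.comp fun n => n + (b + 3))).mul
      (hM.trans (hBc.comp fun n => n + (b + 3)))).roundShift
      ((Computes.refl _).addUnary (.constUnary _))⟩
  beta_reduce
  set M := n + (b + 3) with hMdef
  have h1 := hA M
  have h2 := hB M
  have h3 := abs_div_sub_roundShift_le (A M * B M) (n + (2 * b + 5))
  generalize roundShift (A M * B M) (n + (2 * b + 5)) = R at *
  have hp : (2 : ℝ) ^ M = 2 ^ n * (2 ^ b * 8) := by rw [hMdef, pow_add, pow_add]; norm_num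
  have hp2 : (2 : ℝ) ^ (n + (2 * b + 5) + 1) = 2 ^ M * 2 ^ M / 2 ^ n := by
    rw [hMdef, eq_div_iff (by positivity), ← pow_add, ← pow_add]
    congr 1
    ring
  have hn : (0 : ℝ) < 2 ^ n := by positivity
  have hbp : (1 : ℝ) ≤ 2 ^ b := one_le_pow₀ (by norm_num)
  have e1 : (1 : ℝ) / 2 ^ M = 1 / 2 ^ n * (1 / (2 ^ b * 8)) := by rw [hp]; field_simp
  have hsb : |(B M : ℝ) / 2 ^ M| ≤ 2 ^ b := by
    have : |(B M : ℝ) / 2 ^ M| ≤ |s| + 1 / 2 ^ M := by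
      have := abs_sub_abs_le_abs_sub ((B M : ℝ) / 2 ^ M) s
      rw [abs_sub_comm] at this
      linarith
    have h' : (1 : ℝ) / 2 ^ M ≤ 1 := by
      rw [div_le_one (by positivity)]; exact one_le_pow₀ (by norm_num)
    linarith [le_max_right r (|s| + 1)]
  have hrb : r ≤ 2 ^ b := (le_max_left _ _).trans hb.le
  have key : |r * s - (A M : ℝ) / 2 ^ M * (B M / 2 ^ M)| ≤ 1 / 2 ^ n * (1 / 4) := by
    have e : r * s - (A M : ℝ) / 2 ^ M * (B M / 2 ^ M) =
        r * (s - B M / 2 ^ M) + (r - A M / 2 ^ M) * (B M / 2 ^ M) := by ring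
    rw [e]
    refine (abs_add_le _ _).trans ?_
    rw [abs_mul, abs_mul, abs_of_nonneg hr0]
    calc r * |s - B M / 2 ^ M| + |r - A M / 2 ^ M| * |(B M : ℝ) / 2 ^ M|
        ≤ 2 ^ b * (1 / 2 ^ M) + 1 / 2 ^ M * 2 ^ b := by gcongr
      _ = 1 / 2 ^ n * (1 / 4) := by rw [e1]; field_simp; norm_num
  have key2 : |(A M : ℝ) / 2 ^ M * (B M / 2 ^ M) - R / 2 ^ n| ≤ 1 / 2 ^ n * (1 / 2) := by
    have e : (A M : ℝ) / 2 ^ M * (B M / 2 ^ M) - R / 2 ^ n =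
        1 / 2 ^ n * (((A M * B M : ℕ) : ℝ) / 2 ^ (n + (2 * b + 5) + 1) - R) := by
      rw [hp2]; push_cast; field_simp
    rw [e, abs_mul, abs_of_pos (by positivity)]
    gcongr
  have := abs_sub_le (r * s) ((A M : ℝ) / 2 ^ M * (B M / 2 ^ M)) (R / 2 ^ n)
  have hpos : 0 < 1 / (2 : ℝ) ^ n := by positivity
  linarith

/-! ### The number `π` -/

/-- An integer approximation of `2 ^ M * arctan (1 / q)`. -/
def arctanApprox (q M : ℕ) : ℕ :=
  ∑ i ∈ Finset.range M, (2 ^ M / ((4 * i + 1) * q ^ (4 * i + 1)) -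
    2 ^ M / ((4 * i + 3) * q ^ (4 * i + 3)))

/-- The alternating series is summed in pairs of terms, whose natural-number differences are not
truncated. Each pair of floors errs by at most `1`, which gives `M`; cutting the series off after `2
* M` terms costs at most `2 ^ (-M)`, after scaling the summand `1`. -/
theorem abs_two_pow_mul_arctan_sub_le (q M : ℕ) (hq : 1 < q) :
    |2 ^ M * Real.arctan (1 / q) - arctanApprox q M| ≤ M + 1 := by
  have hq' : (1 : ℝ) < q := by exact_mod_cast hq
  set t : ℕ → ℝ := fun j => 1 / ((2 * j + 1) * (q : ℝ) ^ (2 * j + 1)) with ht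
  have hx : ‖(1 / q : ℝ)‖ < 1 := by
    rw [Real.norm_of_nonneg (by positivity), div_lt_one (by positivity)]; exact hq'
  have hs : HasSum (fun j : ℕ => (-1) ^ j * t j) (Real.arctan (1 / q)) := by
    convert! Real.hasSum_arctan hx using 2 with j
    simp only [ht]
    rw [one_div_pow, ← mul_one_div ((-1 : ℝ) ^ j * _)]
    push_cast
    field_simp
  have hanti : Antitone t := by
    refine antitone_nat_of_succ_le fun j => ?_
    simp only [ht]
    push_cast
    gcongr 1 / (?_ * ?_)
    · linarith
    · exact pow_le_pow_right₀ hq'.le (by omega)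
  have hlim := hs.tendsto_sum_nat
  -- The limit lies between the partial sum of `2 * M` terms and the next one, so the tail is at
  -- most `t (2 * M)`.
  have hlo := hanti.alternating_series_le_tendsto hlim M
  have hhi := hanti.tendsto_le_alternating_series hlim M
  rw [Finset.sum_range_succ] at hhi
  have htl : t (2 * M) ≤ 1 / 2 ^ M := by
    simp only [ht]
    refine one_div_le_one_div_of_le (by positivity) ?_
    have h2 : (2 : ℝ) ^ M ≤ (q : ℝ) ^ (2 * (2 * M) + 1) := by
      calc (2 : ℝ) ^ M ≤ q ^ M := by gcongr; exact_mod_cast hq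
        _ ≤ _ := pow_le_pow_right₀ hq'.le (by omega)
    have : (1 : ℝ) ≤ 2 * ((2 * M : ℕ) : ℝ) + 1 := by
      have : (0 : ℝ) ≤ ((2 * M : ℕ) : ℝ) := by positivity
      linarith
    exact_mod_cast h2.trans (le_mul_of_one_le_left (by positivity) this)
  have hpair : ∑ j ∈ Finset.range (2 * M), (-1) ^ j * t j =
      ∑ i ∈ Finset.range M, (t (2 * i) - t (2 * i + 1)) := by
    clear hlo hhi htl
    induction M with
    | zero => simp
    | succ M ih =>
      rw [show 2 * (M + 1) = 2 * M + 1 + 1 by ring, Finset.sum_range_succ, Finset.sum_range_succ,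
        ih, Finset.sum_range_succ]
      simp [pow_succ, pow_mul]
      ring
  have hterm : ∀ i, |2 ^ M * (t (2 * i) - t (2 * i + 1)) -
      ((2 ^ M / ((4 * i + 1) * q ^ (4 * i + 1)) - 2 ^ M / ((4 * i + 3) * q ^ (4 * i + 3)) : ℕ) : ℝ)| ≤
      1 := by
    intro i
    have hmono : 2 ^ M / ((4 * i + 3) * q ^ (4 * i + 3)) ≤ 2 ^ M / ((4 * i + 1) * q ^ (4 * i + 1)) := by
      refine Nat.div_le_div_left ?_ (by positivity)
      gcongr <;> omega
    have hfl : ∀ d : ℕ, 0 < d → ((2 ^ M / d : ℕ) : ℝ) ≤ 2 ^ M * (1 / d) ∧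
        2 ^ M * (1 / d) < ((2 ^ M / d : ℕ) : ℝ) + 1 := by
      intro d hd
      have hd' : (0 : ℝ) < d := by exact_mod_cast hd
      have h1 := Nat.div_mul_le_self (2 ^ M) d
      have h2 := Nat.lt_div_mul_add (a := 2 ^ M) hd
      have h1' : ((2 ^ M / d : ℕ) : ℝ) * d ≤ 2 ^ M := by exact_mod_cast h1
      have h2' : (2 : ℝ) ^ M < ((2 ^ M / d : ℕ) : ℝ) * d + d := by exact_mod_cast h2
      rw [mul_one_div]
      refine ⟨(le_div_iff₀ hd').2 h1', (div_lt_iff₀ hd').2 (by linarith)⟩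
    have f1 := hfl ((4 * i + 1) * q ^ (4 * i + 1)) (by positivity)
    have f2 := hfl ((4 * i + 3) * q ^ (4 * i + 3)) (by positivity)
    have e1 : t (2 * i) = 1 / (((4 * i + 1) * q ^ (4 * i + 1) : ℕ) : ℝ) := by
      simp only [ht]; push_cast
      rw [show 2 * (2 * i) + 1 = 4 * i + 1 by ring]; ring
    have e2 : t (2 * i + 1) = 1 / (((4 * i + 3) * q ^ (4 * i + 3) : ℕ) : ℝ) := by
      simp only [ht]; push_cast
      rw [show 2 * (2 * i + 1) + 1 = 4 * i + 3 by ring]; ring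
    rw [Nat.cast_sub hmono, e1, e2, mul_sub, abs_le]
    constructor <;> linarith
  have hsum : |2 ^ M * ∑ i ∈ Finset.range M, (t (2 * i) - t (2 * i + 1)) - arctanApprox q M| ≤ M := by
    rw [arctanApprox, Nat.cast_sum, Finset.mul_sum, ← Finset.sum_sub_distrib]
    refine (Finset.abs_sum_le_sum_abs _ _).trans ((Finset.sum_le_sum fun i _ => hterm i).trans ?_)
    simp
  rw [hpair] at hlo hhi
  have hP : (0 : ℝ) < 2 ^ M := by positivity
  have e3 : (-1 : ℝ) ^ (2 * M) = 1 := by simp [pow_mul]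
  rw [e3, one_mul] at hhi
  have h1 := mul_le_mul_of_nonneg_left hlo hP.le
  have h2 := mul_le_mul_of_nonneg_left (hhi.trans (add_le_add_right htl _)) hP.le
  rw [mul_add, mul_one_div_cancel hP.ne'] at h2
  rw [abs_le] at hsum ⊢
  constructor <;> linarith [hsum.1, hsum.2]

theorem computes_arctanApprox (q : ℕ) (hq : 1 < q) :
    Computes encodeUnary (fun M => encodeNat (arctanApprox q M)) := by
  have hid := Computes.refl fun p : ℕ × ℕ => pairWord (encodeUnary p.1) (encodeUnary p.2)
  have h4 := hid.snd.constMulUnary 4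
  have hd : ∀ c, 0 < c → Computes (fun p : ℕ × ℕ => pairWord (encodeUnary p.1) (encodeUnary p.2))
      (fun p => encodeNat (2 ^ p.1 / ((4 * p.2 + c) * q ^ (4 * p.2 + c)))) := fun c hc =>
    ((h4.addUnary (.constUnary c)).unaryToBinary.mul
      ((h4.addUnary (.constUnary c)).constPow q)).twoPowDiv hid.fst fun p =>
        one_lt_mul_of_le_of_lt (by omega) (one_lt_pow₀ hq (by omega))
  refine Computes.sum (x := encodeUnary) (N := fun M => M) (T := fun M i =>
    2 ^ M / ((4 * i + 1) * q ^ (4 * i + 1)) - 2 ^ M / ((4 * i + 3) * q ^ (4 * i + 3)))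
    (Computes.refl _) ((hd 1 one_pos).sub (hd 3 (by norm_num))) (g := fun M => M + M)
    ((Computes.refl _).polyBounded_unary.add (Computes.refl _).polyBounded_unary) fun M => ?_
  rw [pow_add]
  refine lt_of_le_of_lt (Finset.sum_le_card_nsmul _ _ (2 ^ M) fun i _ =>
    (Nat.sub_le _ _).trans (Nat.div_le_self _ _)) ?_
  rw [Finset.card_range, smul_eq_mul]
  exact Nat.mul_lt_mul_of_pos_right Nat.lt_two_pow_self (by positivity)

theorem natApproximable_pi : NatApproximable Real.pi := by
  -- For `M = 2 * n + 10`, the error `8 * (M + 1)` of the scaled value is at most `2 ^ (n + 9)`,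
  -- half a unit for the shift by `n + 10 = M - n`.
  have hM : Computes encodeUnary (fun n => encodeUnary (2 * n + 10)) :=
    ((Computes.refl _).constMulUnary 2).addUnary (.constUnary _)
  refine ⟨fun n => roundShift (4 * (arctanApprox 2 (2 * n + 10) + arctanApprox 3 (2 * n + 10)))
    (n + 9), fun n => ?_, ((Computes.constNat 4).mul
      ((hM.trans ((computes_arctanApprox 2 (by norm_num)).comp fun n => 2 * n + 10)).add
      (hM.trans ((computes_arctanApprox 3 (by norm_num)).comp fun n => 2 * n + 10)))).roundShift
      ((Computes.refl _).addUnary (.constUnary _))⟩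
  beta_reduce
  set M := 2 * n + 10 with hM
  have h2 := abs_two_pow_mul_arctan_sub_le 2 M (by norm_num)
  have h3 := abs_two_pow_mul_arctan_sub_le 3 M (by norm_num)
  have hpi := Real.arctan_inv_2_add_arctan_inv_3
  have hr := abs_div_sub_roundShift_le (4 * (arctanApprox 2 M + arctanApprox 3 M)) (n + 9)
  generalize roundShift _ _ = R at *
  generalize arctanApprox 2 M = a at *
  generalize arctanApprox 3 M = b at *
  have hn : (0 : ℝ) < 2 ^ n := by positivity
  have hlin : (8 : ℝ) * (M + 1) ≤ 2 ^ n * 2 ^ 9 := by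
    have : (n : ℝ) + 1 ≤ 2 ^ n := by exact_mod_cast Nat.lt_two_pow_self
    rw [hM]; push_cast; linarith
  have hMn : (2 : ℝ) ^ M = 2 ^ n * (2 ^ n * 2 ^ 10) := by rw [hM, pow_add, two_mul, pow_add]; ring
  have e10 : (2 : ℝ) ^ (n + 9 + 1) = 2 ^ n * 2 ^ 10 := by rw [add_assoc, pow_add]
  have h5 : |2 ^ M * Real.pi - 4 * (a + b)| ≤ 8 * (M + 1) := by
    have : Real.pi = 4 * (Real.arctan 2⁻¹ + Real.arctan 3⁻¹) := by rw [hpi]; ring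
    simp only [one_div, Nat.cast_ofNat] at h2 h3
    rw [this]
    rw [abs_le] at h2 h3 ⊢
    constructor <;> linarith [h2.1, h2.2, h3.1, h3.2]
  rw [e10] at hr
  push_cast at hr
  rw [hMn] at h5
  set Q : ℝ := 2 ^ n * 2 ^ 10 with hQ
  have hQ0 : 0 < Q := by positivity
  have e : Real.pi - R / 2 ^ n = 1 / 2 ^ n * ((2 ^ n * Q * Real.pi - 4 * (a + b)) / Q +
      (4 * (a + b) / Q - R)) := by field_simp; ring
  rw [e, abs_mul, abs_of_pos (by positivity)]
  refine mul_le_of_le_one_right (by positivity) ((abs_add_le _ _).trans ?_)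
  have h6 : |(2 ^ n * Q * Real.pi - 4 * (a + b)) / Q| ≤ 1 / 2 := by
    rw [abs_div, abs_of_pos hQ0, div_le_iff₀ hQ0]
    refine h5.trans (hlin.trans ?_)
    rw [hQ]; norm_num; linarith
  linarith

end PeriodicHeat
end

noncomputable section

namespace PeriodicHeat

open Computability (encodeNat)

/-! ### The exponential function -/

theorem abs_pow_sub_pow_le {a b : ℝ} (ha : 0 ≤ a) (ha' : a ≤ 1) (hb : 0 ≤ b) (hb' : b ≤ 1)
    (n : ℕ) : |a ^ n - b ^ n| ≤ n * |a - b| := by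
  induction n with
  | zero => simp
  | succ n ih =>
    have e : a ^ (n + 1) - b ^ (n + 1) = a * (a ^ n - b ^ n) + (a - b) * b ^ n := by ring
    rw [e]
    refine (abs_add_le _ _).trans ?_
    rw [abs_mul, abs_mul, abs_of_nonneg ha, abs_of_nonneg (pow_nonneg hb n)]
    have h1 : a * |a ^ n - b ^ n| ≤ |a ^ n - b ^ n| :=
      mul_le_of_le_one_left (abs_nonneg _) ha'
    have h2 : |a - b| * b ^ n ≤ |a - b| :=
      mul_le_of_le_one_right (abs_nonneg _) (pow_le_one₀ hb hb')
    push_cast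
    linarith

/-- On `[0, 1]` the `N`-th power is `N`-Lipschitz. With `N = 2 ^ m`, the first-order Taylor error
`(x / 2 ^ m) ^ 2` of `exp(-x / 2 ^ m)` is magnified at most by `2 ^ m`. -/
theorem abs_exp_neg_sub_pow_le {x : ℝ} (hx : 0 ≤ x) (m : ℕ) (hm : x ≤ 2 ^ m) :
    |Real.exp (-x) - (1 - x / 2 ^ m) ^ 2 ^ m| ≤ x ^ 2 / 2 ^ m := by
  have hp : (0 : ℝ) < 2 ^ m := by positivity
  have hy0 : 0 ≤ x / 2 ^ m := by positivity
  have hy1 : x / 2 ^ m ≤ 1 := by rwa [div_le_one hp]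
  have e : Real.exp (-x) = Real.exp (-(x / 2 ^ m)) ^ 2 ^ m := by
    rw [← Real.exp_nat_mul]
    congr 1
    push_cast
    field_simp
  rw [e]
  refine (abs_pow_sub_pow_le (Real.exp_pos _).le (Real.exp_le_one_iff.2 (by linarith))
    (by linarith) (by linarith) _).trans ?_
  have h := Real.abs_exp_sub_one_sub_id_le (x := -(x / 2 ^ m)) (by rwa [abs_neg, abs_of_nonneg hy0])
  have e2 : Real.exp (-(x / 2 ^ m)) - 1 - -(x / 2 ^ m) =
      Real.exp (-(x / 2 ^ m)) - (1 - x / 2 ^ m) := by ring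
  rw [e2] at h
  refine (mul_le_mul_of_nonneg_left h (by positivity)).trans (le_of_eq ?_)
  push_cast
  field_simp

/-- Repeated squaring of a number in the unit interval, with precision `2 ^ (-P)`. -/
def squarings (P z : ℕ) : ℕ → ℕ := Nat.rec z fun _ y => y * y / 2 ^ P

theorem squarings_succ (P z i : ℕ) :
    squarings P z (i + 1) = squarings P z i * squarings P z i / 2 ^ P := rfl

theorem squarings_le {P z : ℕ} (hz : z ≤ 2 ^ P) (i : ℕ) : squarings P z i ≤ 2 ^ P := by
  induction i with
  | zero => exact hz
  | succ i ih =>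
    rw [squarings_succ]
    exact Nat.div_le_of_le_mul (Nat.mul_le_mul ih ih)

/-- In units of `2 ^ (-P)`, one squaring doubles the error and the floor adds `1`; from the initial
error `2` this recursion produces `3 * 2 ^ i - 1`. Hence `m` squarings cost about `m` bits of
precision. -/
theorem abs_squarings_sub_le {P z : ℕ} (hz : z ≤ 2 ^ P) {w : ℝ} (hw : 0 ≤ w) (hw' : w ≤ 1)
    (h : |(z : ℝ) / 2 ^ P - w| ≤ 2 / 2 ^ P) (i : ℕ) :
    |(squarings P z i : ℝ) / 2 ^ P - w ^ 2 ^ i| ≤ (3 * 2 ^ i - 1) / 2 ^ P := by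
  have hp : (0 : ℝ) < 2 ^ P := by positivity
  induction i with
  | zero => simpa [squarings, show (3 : ℝ) - 1 = 2 by norm_num] using h
  | succ i ih =>
    have hle := squarings_le hz i
    rw [squarings_succ]
    generalize squarings P z i = y at *
    have hle' : (y : ℝ) / 2 ^ P ≤ 1 := by rw [div_le_one hp]; exact_mod_cast hle
    have hy0 : (0 : ℝ) ≤ (y : ℝ) / 2 ^ P := by positivity
    have h1 : |((y * y / 2 ^ P : ℕ) : ℝ) / 2 ^ P - ((y : ℝ) / 2 ^ P) ^ 2| ≤ 1 / 2 ^ P := by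
      have h1 := Nat.div_mul_le_self (y * y) (2 ^ P)
      have h2 := Nat.lt_div_mul_add (a := y * y) (show 0 < 2 ^ P by positivity)
      have h1' : ((y * y / 2 ^ P : ℕ) : ℝ) * 2 ^ P ≤ y * y := by exact_mod_cast h1
      have h2' : (y * y : ℝ) < ((y * y / 2 ^ P : ℕ) : ℝ) * 2 ^ P + 2 ^ P := by exact_mod_cast h2
      have e : ((y * y / 2 ^ P : ℕ) : ℝ) / 2 ^ P - ((y : ℝ) / 2 ^ P) ^ 2 =
        (((y * y / 2 ^ P : ℕ) : ℝ) * 2 ^ P - y * y) / 2 ^ P / 2 ^ P := by field_simp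
      rw [e, abs_div, abs_of_pos hp]
      gcongr
      rw [abs_div, abs_of_pos hp, div_le_one hp, abs_le]
      constructor <;> linarith
    have h2 := abs_pow_sub_pow_le hy0 hle' (pow_nonneg hw (2 ^ i)) (pow_le_one₀ hw hw') 2
    have e : w ^ 2 ^ (i + 1) = (w ^ 2 ^ i) ^ 2 := by rw [← pow_mul, pow_succ]
    rw [e]
    refine (abs_sub_le _ (((y : ℝ) / 2 ^ P) ^ 2) _).trans ?_
    have e3 : (3 * 2 ^ (i + 1) - 1) / 2 ^ P = 1 / 2 ^ P + 2 * ((3 * 2 ^ i - 1) / (2 : ℝ) ^ P) := by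
      rw [pow_succ]; field_simp; ring
    rw [e3]
    push_cast at h2
    linarith

theorem Computes.squarings {α : Type} {x : α → List Bool} {P z N : α → ℕ}
    (hP : Computes x (fun a => encodeUnary (P a))) (hz : Computes x (fun a => encodeNat (z a)))
    (hN : Computes x (fun a => encodeUnary (N a))) (hle : ∀ a, z a ≤ 2 ^ P a) :
    Computes x (fun a => encodeNat (PeriodicHeat.squarings (P a) (z a) (N a))) := by
  have hid := Computes.refl fun p : α × ℕ × ℕ =>
    pairWord (x p.1) (pairWord (encodeUnary p.2.1) (encodeNat p.2.2))
  refine Computes.natRec (x := x) (e := encodeNat) (N := N) (r := z)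
    (s := fun a _ y => y * y / 2 ^ P a) hN hz ((hid.snd.snd.mul hid.snd.snd).shiftRight
      (hid.fst.trans (hP.comp fun p : α × ℕ × ℕ => p.1))) (g := fun a => P a + 1)
      (hP.polyBounded_unary.add (.const 1)) fun a i _ => ?_
  rw [length_encodeNat, Nat.size_le]
  exact (PeriodicHeat.squarings_le (hle a) i).trans_lt (Nat.pow_lt_pow_right (by norm_num)
    (by omega))

/-- Gaussian decay factors are computable in polynomial time. -/
theorem exists_exp_approx {s : ℝ} (hs : NatApproximable s) (hs0 : 0 ≤ s) :
    ∃ P E : ℕ × ℕ → ℕ,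
      (∀ p, |Real.exp (-(s * (p.2 : ℝ) ^ 2)) - (E p : ℝ) / 2 ^ P p| ≤ 1 / 2 ^ p.1) ∧
      (∀ p, E p ≤ 2 ^ P p) ∧
      Computes (fun p => pairWord (encodeUnary p.1) (encodeNat p.2)) (fun p => encodeUnary (P p)) ∧
      Computes (fun p => pairWord (encodeUnary p.1) (encodeNat p.2)) (fun p => encodeNat (E p)) := by
  obtain ⟨A, hA, hAc⟩ := hs
  obtain ⟨b, hb⟩ := pow_unbounded_of_one_lt s (one_lt_two : (1 : ℝ) < 2)
  -- Chosen so that `2 ^ m = 4 * 2 ^ n * X ^ 2` for the bound `X = 2 ^ b * 2 ^ (2 * k.size)` of `s *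
  -- k ^ 2`; the error `x ^ 2 / 2 ^ m` is then at most `(1 / 4) / 2 ^ n`.
  let m : ℕ × ℕ → ℕ := fun p => p.1 + 4 * p.2.size + (2 * b + 2)
  -- These bits make the error `3 * 2 ^ m / 2 ^ P` of the squarings equal to `(3 / 8) / 2 ^ n`.
  let P : ℕ × ℕ → ℕ := fun p => m p + p.1 + 3
  let z : ℕ × ℕ → ℕ := fun p => 2 ^ P p - A (P p) * (p.2 * p.2) / 2 ^ m p
  have hid := Computes.refl fun p : ℕ × ℕ => pairWord (encodeUnary p.1) (encodeNat p.2)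
  have hm : Computes _ (fun p => encodeUnary (m p)) :=
    (hid.fst.addUnary (hid.snd.size.constMulUnary 4)).addUnary (.constUnary _)
  have hP : Computes _ (fun p => encodeUnary (P p)) :=
    (hm.addUnary hid.fst).addUnary (.constUnary 3)
  have hz : Computes _ (fun p => encodeNat (z p)) :=
    hP.twoPow.sub (((hP.trans (hAc.comp P)).mul (hid.snd.mul hid.snd)).shiftRight hm)
  refine ⟨P, fun p => squarings (P p) (z p) (m p), fun p => ?_,
    fun p => squarings_le (Nat.sub_le _ _) _, hP, hP.squarings hz hm fun p => Nat.sub_le _ _⟩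
  obtain ⟨n, k⟩ := p
  beta_reduce
  have hk : (k : ℝ) ^ 2 ≤ 2 ^ (2 * k.size) := by
    have h : (k : ℝ) ≤ 2 ^ k.size := by exact_mod_cast (Nat.lt_size_self k).le
    rw [mul_comm 2, pow_mul]
    gcongr
  have hm' : (2 : ℝ) ^ m (n, k) = 2 ^ n * 4 * (2 ^ b * 2 ^ (2 * k.size)) ^ 2 := by
    have : m (n, k) = n + 2 + (b + 2 * k.size) * 2 := by simp only [m]; ring
    rw [this, pow_add, pow_add, pow_mul, pow_add]; norm_num
  have hP' : (2 : ℝ) ^ P (n, k) = 2 ^ m (n, k) * 2 ^ n * 8 := by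
    simp only [P]; rw [pow_add, pow_add]; norm_num
  set M := m (n, k)
  have hx0 : 0 ≤ s * (k : ℝ) ^ 2 := by positivity
  have hX : s * (k : ℝ) ^ 2 ≤ 2 ^ b * 2 ^ (2 * k.size) := by gcongr
  have hX1 : (1 : ℝ) ≤ 2 ^ b * 2 ^ (2 * k.size) := by
    rw [← pow_add]; exact one_le_pow₀ (by norm_num)
  have hn1 : (1 : ℝ) ≤ 2 ^ n := one_le_pow₀ (by norm_num)
  set X : ℝ := 2 ^ b * 2 ^ (2 * k.size)
  have hXM : X ≤ 2 ^ M := by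
    rw [hm']; nlinarith
  have hkM : (k : ℝ) ^ 2 ≤ 2 ^ M := by
    refine hk.trans (le_trans ?_ hXM)
    exact le_mul_of_one_le_left (by positivity) (one_le_pow₀ (by norm_num))
  have h1 := abs_exp_neg_sub_pow_le hx0 M (hX.trans hXM)
  have h1' : (s * (k : ℝ) ^ 2) ^ 2 / 2 ^ M ≤ 1 / 2 ^ n * (1 / 4) := by
    calc (s * (k : ℝ) ^ 2) ^ 2 / 2 ^ M ≤ X ^ 2 / 2 ^ M := by gcongr
      _ = 1 / 2 ^ n * (1 / 4) := by rw [hm']; field_simp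
  have hMp : (0 : ℝ) < 2 ^ M := by positivity
  have hw0 : 0 ≤ 1 - s * (k : ℝ) ^ 2 / 2 ^ M := by
    rw [sub_nonneg, div_le_one hMp]; exact hX.trans hXM
  have hw1 : 1 - s * (k : ℝ) ^ 2 / 2 ^ M ≤ 1 := by
    rw [sub_le_self_iff]; positivity
  have hz' : |(z (n, k) : ℝ) / 2 ^ P (n, k) - (1 - s * (k : ℝ) ^ 2 / 2 ^ M)| ≤ 2 / 2 ^ P (n, k) := by
    have hPp : (0 : ℝ) < 2 ^ P (n, k) := by positivity
    have ha := hA (P (n, k))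
    have f1 := Nat.div_mul_le_self (A (P (n, k)) * (k * k)) (2 ^ M)
    have f2 := Nat.lt_div_mul_add (a := A (P (n, k)) * (k * k)) (show 0 < 2 ^ M by positivity)
    have hzdef : z (n, k) = 2 ^ P (n, k) - A (P (n, k)) * (k * k) / 2 ^ M := rfl
    rw [hzdef]
    generalize A (P (n, k)) * (k * k) / 2 ^ M = q at *
    generalize A (P (n, k)) = a at *
    generalize P (n, k) = p at *
    have f1' : (q : ℝ) * 2 ^ M ≤ a * (k * k) := by exact_mod_cast f1
    have f2' : (a : ℝ) * (k * k) < q * 2 ^ M + 2 ^ M := by exact_mod_cast f2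
    have g : |(q : ℝ) / 2 ^ p - s * (k : ℝ) ^ 2 / 2 ^ M| ≤ 2 / 2 ^ p := by
      have g1 : |(q : ℝ) / 2 ^ p - a / 2 ^ p * k ^ 2 / 2 ^ M| ≤ 1 / 2 ^ p := by
        have e : (q : ℝ) / 2 ^ p - a / 2 ^ p * k ^ 2 / 2 ^ M =
          (q * 2 ^ M - a * (k * k)) / 2 ^ M / 2 ^ p := by field_simp
        rw [e, abs_div, abs_of_pos hPp]
        gcongr
        rw [abs_div, abs_of_pos hMp, div_le_one hMp, abs_le]
        constructor <;> linarith
      have g2 : |(a : ℝ) / 2 ^ p * k ^ 2 / 2 ^ M - s * (k : ℝ) ^ 2 / 2 ^ M| ≤ 1 / 2 ^ p := by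
        have e : (a : ℝ) / 2 ^ p * k ^ 2 / 2 ^ M - s * (k : ℝ) ^ 2 / 2 ^ M =
          -(s - a / 2 ^ p) * (k ^ 2 / 2 ^ M) := by ring
        rw [e, abs_mul, abs_neg, abs_of_nonneg (show 0 ≤ (k : ℝ) ^ 2 / 2 ^ M by positivity)]
        refine (mul_le_of_le_one_right (abs_nonneg _) ?_).trans ha
        rwa [div_le_one hMp]
      refine (abs_sub_le _ _ _).trans ((add_le_add g1 g2).trans (le_of_eq ?_))
      ring
    -- Rounding may make the subtrahend exceed `2 ^ p`. The truncated difference is then `0`, which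
    -- is close enough because the true value is nonnegative.
    by_cases hq : q ≤ 2 ^ p
    · rw [Nat.cast_sub hq]
      push_cast
      rw [abs_sub_comm] at g
      refine le_trans (le_of_eq ?_) g
      congr 1
      rw [sub_div, div_self hPp.ne']
      ring
    · rw [Nat.sub_eq_zero_of_le (by omega)]
      have hq' : (1 : ℝ) ≤ q / 2 ^ p := by
        rw [le_div_iff₀ hPp, one_mul]; exact_mod_cast (not_le.1 hq).le
      simp only [CharP.cast_eq_zero, zero_div, zero_sub, abs_neg, abs_of_nonneg hw0]
      have := (abs_le.1 g).2
      linarith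
  have h2 := abs_squarings_sub_le (Nat.sub_le _ _) hw0 hw1 hz' M
  change |(squarings (P (n, k)) (z (n, k)) M : ℝ) / 2 ^ P (n, k) - _| ≤ _ at h2
  have h2' : (3 * 2 ^ M - 1) / (2 : ℝ) ^ P (n, k) ≤ 1 / 2 ^ n * (3 / 8) := by
    rw [hP', div_le_iff₀ (by positivity)]
    field_simp
    linarith
  have := abs_sub_le (Real.exp (-(s * (k : ℝ) ^ 2))) ((1 - s * (k : ℝ) ^ 2 / 2 ^ M) ^ 2 ^ M)
    ((squarings (P (n, k)) (z (n, k)) M : ℝ) / 2 ^ P (n, k))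
  rw [abs_sub_comm] at h2
  have hpos : 0 < 1 / (2 : ℝ) ^ n := by positivity
  linarith

/-! ### Damped coefficients -/

/-- Rounded multiplication of the integer `c` with `E / 2 ^ (S + 1)`. -/
def dampInt (E S : ℕ) (c : ℤ) : ℤ :=
  if decide (c < 0) then -(roundShift (E * c.natAbs) S : ℤ) else roundShift (E * c.natAbs) S

theorem abs_dampInt_sub_le (E S : ℕ) (c : ℤ) :
    |(E : ℝ) * c / 2 ^ (S + 1) - dampInt E S c| ≤ 1 / 2 := by
  have h := abs_div_sub_roundShift_le (E * c.natAbs) S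
  have hc : (c.natAbs : ℝ) = |(c : ℝ)| := by rw [← Int.cast_abs, Int.abs_eq_natAbs]; simp
  unfold dampInt
  push_cast at h
  rw [hc] at h
  by_cases h0 : c < 0
  · have h0' : (c : ℝ) < 0 := by exact_mod_cast h0
    rw [abs_of_neg h0'] at h
    simp only [h0, decide_true, if_true]
    rw [← abs_neg] at h
    refine le_trans (le_of_eq ?_) h
    congr 1
    push_cast
    ring
  · have h0' : (0 : ℝ) ≤ c := by exact_mod_cast not_lt.1 h0
    rw [abs_of_nonneg h0'] at h
    simpa [h0] using h

/-- The damping factor is taken to `n + b + 3` bits, as the coefficients are bounded by `2 ^ b`, and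
the coefficient to `n + 3` bits, as the approximate factor is at most `1`. Together these errors are
at most `(1 / 4) / 2 ^ n`, and rounding real and imaginary parts adds at most `(3 / 4) / 2 ^ n`. -/
theorem exists_damped_approx {s : ℝ} (hs : NatApproximable s) (hs0 : 0 ≤ s) {F : ℤ → ℂ} {B : ℝ}
    (hB : ∀ k, ‖F k‖ ≤ B) {c : ℤ → ℕ → GaussianInt}
    (hc : ∀ k n, ‖F k - GaussianInt.toComplex (c k n) / 2 ^ n‖ ≤ 1 / 2 ^ n)
    (hre : PolyTime encodeIndex encodeInt (fun p => (c p.2 p.1).re))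
    (him : PolyTime encodeIndex encodeInt (fun p => (c p.2 p.1).im)) :
    ∃ c' : ℤ → ℕ → GaussianInt,
      (∀ (k : ℤ) n, ‖Real.exp (-(s * (k : ℝ) ^ 2)) * F k - GaussianInt.toComplex (c' k n) / 2 ^ n‖ ≤
        1 / 2 ^ n) ∧
      PolyTime encodeIndex encodeInt (fun p => (c' p.2 p.1).re) ∧
      PolyTime encodeIndex encodeInt (fun p => (c' p.2 p.1).im) := by
  obtain ⟨P, E, hE, hE1, hPc, hEc⟩ := exists_exp_approx hs hs0
  obtain ⟨b, hb⟩ := pow_unbounded_of_one_lt B (one_lt_two : (1 : ℝ) < 2)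
  have hn : Computes encodeIndex (fun p => encodeUnary p.1) := computes_index_pair.fst
  have hk : Computes encodeIndex (fun p => encodeInt p.2) := computes_index_pair.snd
  have hpair := (hn.addUnary (.constUnary (b + 3))).pair hk.natAbs
  have hP := hpair.trans (hPc.comp fun p : ℕ × ℤ => (p.1 + (b + 3), p.2.natAbs))
  have hE' := hpair.trans (hEc.comp fun p : ℕ × ℤ => (p.1 + (b + 3), p.2.natAbs))
  have hidx := (hn.addUnary (.constUnary 3)).index hk
  have hdamp : ∀ d : ℕ × ℤ → ℤ, PolyTime encodeIndex encodeInt d →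
      PolyTime encodeIndex encodeInt fun p : ℕ × ℤ => dampInt (E (p.1 + (b + 3), p.2.natAbs))
        (P (p.1 + (b + 3), p.2.natAbs) + 2) (d (p.1 + 3, p.2)) := by
    intro d hd
    have hd' := hidx.trans ((polyTime_iff.1 hd).comp fun p : ℕ × ℤ => (p.1 + 3, p.2))
    -- The product has scale `2 ^ (P + n + 3)`; division by `2 ^ (P + 2 + 1)` leaves the scale `2 ^
    -- n`.
    exact polyTime_iff.2 (hd'.neg.signed ((hE'.mul hd'.natAbs).roundShift
      (hP.addUnary (.constUnary 2))))
  refine ⟨fun k n => ⟨dampInt (E (n + (b + 3), k.natAbs)) (P (n + (b + 3), k.natAbs) + 2)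
    (c k (n + 3)).re, dampInt (E (n + (b + 3), k.natAbs)) (P (n + (b + 3), k.natAbs) + 2)
    (c k (n + 3)).im⟩, fun k n => ?_, hdamp _ hre, hdamp _ him⟩
  beta_reduce
  have h1 := hE (n + (b + 3), k.natAbs)
  have h2 := hE1 (n + (b + 3), k.natAbs)
  have h3 := hc k (n + 3)
  have h4 := abs_dampInt_sub_le (E (n + (b + 3), k.natAbs)) (P (n + (b + 3), k.natAbs) + 2)
    (c k (n + 3)).re
  have h5 := abs_dampInt_sub_le (E (n + (b + 3), k.natAbs)) (P (n + (b + 3), k.natAbs) + 2)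
    (c k (n + 3)).im
  simp only at h1
  have hkk : ((k.natAbs : ℕ) : ℝ) ^ 2 = (k : ℝ) ^ 2 := by
    rw [← sq_abs (k : ℝ), ← Int.cast_abs, Int.abs_eq_natAbs]; simp
  rw [hkk] at h1
  generalize E (n + (b + 3), k.natAbs) = ε at *
  generalize P (n + (b + 3), k.natAbs) = p at *
  generalize dampInt ε (p + 2) (c k (n + 3)).re = u at *
  generalize dampInt ε (p + 2) (c k (n + 3)).im = v at *
  generalize Real.exp (-(s * (k : ℝ) ^ 2)) = e at *
  have hn0 : (0 : ℝ) < 2 ^ n := by positivity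
  have hp0 : (0 : ℝ) < 2 ^ p := by positivity
  set D : ℂ := GaussianInt.toComplex (c k (n + 3)) with hD
  have hDre : D.re = (c k (n + 3)).re := by rw [hD, GaussianInt.toComplex_def₂]
  have hDim : D.im = (c k (n + 3)).im := by rw [hD, GaussianInt.toComplex_def₂]
  have ha : ‖(e : ℂ) * F k - (ε / 2 ^ p : ℝ) * (D / 2 ^ (n + 3))‖ ≤ 1 / 2 ^ n * (1 / 4) := by
    have eq : (e : ℂ) * F k - (ε / 2 ^ p : ℝ) * (D / 2 ^ (n + 3)) =
        ((e - ε / 2 ^ p : ℝ) : ℂ) * F k + (ε / 2 ^ p : ℝ) * (F k - D / 2 ^ (n + 3)) := by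
      push_cast; ring
    rw [eq]
    refine (norm_add_le _ _).trans ?_
    rw [norm_mul, norm_mul, Complex.norm_real, Complex.norm_real, Real.norm_eq_abs,
      Real.norm_of_nonneg (by positivity : (0 : ℝ) ≤ ε / 2 ^ p)]
    have hε : (ε : ℝ) / 2 ^ p ≤ 1 := by rw [div_le_one hp0]; exact_mod_cast h2
    calc |e - ε / 2 ^ p| * ‖F k‖ + ε / 2 ^ p * ‖F k - D / 2 ^ (n + 3)‖
        ≤ 1 / 2 ^ (n + (b + 3)) * 2 ^ b + 1 * (1 / 2 ^ (n + 3)) := by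
          gcongr
          exact (hB k).trans hb.le
      _ = 1 / 2 ^ n * (1 / 4) := by
          rw [pow_add, pow_add, pow_add]; field_simp; norm_num
  have hq : (2 : ℝ) ^ (p + 2 + 1) = 2 ^ p * 8 := by rw [add_assoc, pow_add]; norm_num
  rw [hq] at h4 h5
  have hb' : ‖(ε / 2 ^ p : ℝ) * (D / 2 ^ (n + 3)) -
      GaussianInt.toComplex (⟨u, v⟩ : GaussianInt) / 2 ^ n‖ ≤ 1 / 2 ^ n * (3 / 4) := by
    have eq : (ε / 2 ^ p : ℝ) * (D / 2 ^ (n + 3)) -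
        GaussianInt.toComplex (⟨u, v⟩ : GaussianInt) / 2 ^ n = ((1 / 2 ^ n : ℝ) : ℂ) *
        ⟨ε * (c k (n + 3)).re / (2 ^ p * 8) - u, ε * (c k (n + 3)).im / (2 ^ p * 8) - v⟩ := by
      have e1 : (⟨ε * (c k (n + 3)).re / (2 ^ p * 8) - u,
          ε * (c k (n + 3)).im / (2 ^ p * 8) - v⟩ : ℂ) =
          ((ε / (2 ^ p * 8) : ℝ) : ℂ) * D - GaussianInt.toComplex (⟨u, v⟩ : GaussianInt) := by
        apply Complex.ext
        · rw [Complex.sub_re, Complex.re_ofReal_mul, hDre]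
          rw [GaussianInt.toComplex_def₂]; ring
        · rw [Complex.sub_im, Complex.im_ofReal_mul, hDim]
          rw [GaussianInt.toComplex_def₂]; ring
      rw [e1, pow_add]
      push_cast
      field_simp
      ring
    rw [eq, norm_mul, Complex.norm_real, Real.norm_of_nonneg (by positivity)]
    gcongr
    -- Both components are at most `1 / 2`, and `1 / 4 + 1 / 4 ≤ (3 / 4) ^ 2`.
    rw [Complex.norm_def, Real.sqrt_le_left (by norm_num), Complex.normSq_mk]
    have := sq_le_sq' (abs_le.1 h4).1 (abs_le.1 h4).2
    have := sq_le_sq' (abs_le.1 h5).1 (abs_le.1 h5).2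
    nlinarith
  refine (norm_sub_le_norm_sub_add_norm_sub _ _ _).trans ((add_le_add ha hb').trans (le_of_eq ?_))
  ring

end PeriodicHeat
end

noncomputable section

namespace PeriodicHeat

open MeasureTheory

/-! ### Fourier series on the unit interval -/

/-- The exponential `exp(2πikx)`. -/
def mode (k : ℤ) (x : ℝ) : ℂ :=
  Complex.exp (2 * Real.pi * Complex.I * k * x)

theorem norm_mode (k : ℤ) (x : ℝ) : ‖mode k x‖ = 1 := by
  have h : (2 * Real.pi * Complex.I * k * x : ℂ) = ((2 * Real.pi * k * x : ℝ) : ℂ) * Complex.I := by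
    push_cast; ring
  rw [mode, h, Complex.norm_exp_ofReal_mul_I]

theorem mode_zero (x : ℝ) : mode 0 x = 1 := by simp [mode]

theorem mode_mul (j k : ℤ) (x : ℝ) : mode j x * mode k x = mode (j + k) x := by
  rw [mode, mode, mode, ← Complex.exp_add]
  congr 1
  push_cast
  ring

theorem mode_add_one (k : ℤ) (x : ℝ) : mode k (x + 1) = mode k x := by
  have h : (2 * Real.pi * Complex.I * k * ((x + 1 : ℝ) : ℂ) : ℂ) =
      2 * Real.pi * Complex.I * k * x + k * (2 * Real.pi * Complex.I) := by
    push_cast; ring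
  rw [mode, h, Complex.exp_add, Complex.exp_int_mul_two_pi_mul_I, mul_one, mode]

theorem hasDerivAt_mode (k : ℤ) (x : ℝ) :
    HasDerivAt (mode k) (2 * Real.pi * Complex.I * k * mode k x) x := by
  have h : HasDerivAt (fun y : ℂ => Complex.exp (2 * Real.pi * Complex.I * k * y))
      (Complex.exp (2 * Real.pi * Complex.I * k * x) * (2 * Real.pi * Complex.I * k * 1)) x :=
    ((hasDerivAt_id (x : ℂ)).const_mul _).cexp
  have h' := h.comp_ofReal
  rw [mul_one, mul_comm (Complex.exp _)] at h'
  exact h'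

theorem continuous_mode (k : ℤ) : Continuous (mode k) := by
  unfold mode
  fun_prop

theorem unitMeasure_eq_restrict_Ioc : unitMeasure = volume.restrict (Set.Ioc 0 1) :=
  Measure.restrict_congr_set Ioc_ae_eq_Icc.symm

instance : IsProbabilityMeasure unitMeasure :=
  ⟨by simp [unitMeasure]⟩

theorem integral_unitMeasure (g : ℝ → ℂ) : ∫ x, g x ∂unitMeasure = ∫ x in (0 : ℝ)..1, g x := by
  rw [unitMeasure_eq_restrict_Ioc, intervalIntegral.integral_of_le zero_le_one]

theorem _root_.Continuous.memLp_unitMeasure {g : ℝ → ℂ} (hg : Continuous g) (p : ENNReal) :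
    MemLp g p unitMeasure := by
  obtain ⟨C, hC⟩ := (isCompact_Icc (a := (0 : ℝ)) (b := 1)).exists_bound_of_continuousOn
    hg.continuousOn
  refine MemLp.of_bound hg.aestronglyMeasurable C ?_
  exact (ae_restrict_iff' measurableSet_Icc).2 (Filter.Eventually.of_forall hC)

theorem _root_.Continuous.integrable_unitMeasure {g : ℝ → ℂ} (hg : Continuous g) :
    Integrable g unitMeasure :=
  memLp_one_iff_integrable.1 (hg.memLp_unitMeasure 1)

theorem fourierCoefficient_eq (g : ℝ → ℂ) (k : ℤ) :
    fourierCoefficient g k = ∫ x, mode (-k) x * g x ∂unitMeasure := by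
  refine integral_congr_ae (Filter.Eventually.of_forall fun x => ?_)
  simp only [mode]
  congr 2
  push_cast
  ring

theorem integrable_mode_mul {g : ℝ → ℂ} (hg : Integrable g unitMeasure) (k : ℤ) :
    Integrable (fun x => mode k x * g x) unitMeasure :=
  hg.bdd_mul (c := 1) (continuous_mode k).aestronglyMeasurable
    (Filter.Eventually.of_forall fun x => (norm_mode k x).le)

theorem norm_fourierCoefficient_le (g : ℝ → ℂ) (k : ℤ) :
    ‖fourierCoefficient g k‖ ≤ ∫ x, ‖g x‖ ∂unitMeasure := by
  rw [fourierCoefficient_eq]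
  refine (norm_integral_le_integral_norm _).trans_eq ?_
  simp [norm_mode]

theorem fourierCoefficient_sub {g h : ℝ → ℂ} (hg : Integrable g unitMeasure)
    (hh : Integrable h unitMeasure) (k : ℤ) :
    fourierCoefficient (fun x => g x - h x) k =
      fourierCoefficient g k - fourierCoefficient h k := by
  simp only [fourierCoefficient_eq, mul_sub]
  exact integral_sub (integrable_mode_mul hg _) (integrable_mode_mul hh _)

theorem integral_mode (k : ℤ) : ∫ x, mode k x ∂unitMeasure = if k = 0 then 1 else 0 := by
  split_ifs with hk
  · subst hk
    simp [mode_zero]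
  · have hc : (2 * Real.pi * Complex.I * k : ℂ) ≠ 0 := by
      simp [hk, Real.pi_ne_zero]
    rw [integral_unitMeasure, intervalIntegral.integral_eq_sub_of_hasDerivAt
      (f := fun x => (2 * Real.pi * Complex.I * k : ℂ)⁻¹ * mode k x)]
    · have h := mode_add_one k 0
      rw [zero_add] at h
      rw [h, sub_self]
    · intro x _
      have h := (hasDerivAt_mode k x).const_mul (2 * Real.pi * Complex.I * k : ℂ)⁻¹
      rwa [← mul_assoc, inv_mul_cancel₀ hc, one_mul] at h
    · exact (continuous_mode k).intervalIntegrable _ _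

theorem fourierCoefficient_mode (j k : ℤ) :
    fourierCoefficient (mode j) k = if j = k then 1 else 0 := by
  simp only [fourierCoefficient_eq, mode_mul, integral_mode, neg_add_eq_zero, eq_comm]

/-- The bridge to Mathlib's Fourier theory, from which Parseval's identity is taken. -/
theorem fourierCoefficient_eq_fourierCoeffOn (g : ℝ → ℂ) (k : ℤ) :
    fourierCoefficient g k = fourierCoeffOn (zero_lt_one : (0 : ℝ) < 1) g k := by
  rw [fourierCoeffOn_eq_integral, fourierCoefficient_eq, integral_unitMeasure, sub_zero, div_one,
    one_smul]
  refine intervalIntegral.integral_congr fun x _ => ?_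
  simp only [mode, smul_eq_mul]
  rw [fourier_coe_apply]
  simp

theorem hasSum_sq_norm_fourierCoefficient {g : ℝ → ℂ} (hg : MemLp g 2 unitMeasure) :
    HasSum (fun k => ‖fourierCoefficient g k‖ ^ 2) (∫ x, ‖g x‖ ^ 2 ∂unitMeasure) := by
  rw [unitMeasure_eq_restrict_Ioc] at hg
  have h := hasSum_sq_fourierCoeffOn (zero_lt_one : (0 : ℝ) < 1) hg
  rw [sub_zero, inv_one, one_smul, intervalIntegral.integral_of_le zero_le_one,
    ← unitMeasure_eq_restrict_Ioc] at h
  simpa only [fourierCoefficient_eq_fourierCoeffOn] using h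

/-- Parseval's identity. -/
theorem eLpNorm_eq_sqrt_tsum {g : ℝ → ℂ} (hg : MemLp g 2 unitMeasure) :
    eLpNorm g 2 unitMeasure =
      ENNReal.ofReal (Real.sqrt (∑' k, ‖fourierCoefficient g k‖ ^ 2)) := by
  rw [hg.eLpNorm_eq_integral_rpow_norm (by simp) (by simp),
    (hasSum_sq_norm_fourierCoefficient hg).tsum_eq, Real.sqrt_eq_rpow]
  simp

theorem continuous_fourierPartialSum (g : ℝ → ℂ) (K : ℕ) : Continuous (fourierPartialSum g K) := by
  unfold fourierPartialSum
  fun_prop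

theorem fourierCoefficient_fourierPartialSum (g : ℝ → ℂ) (K : ℕ) (k : ℤ) :
    fourierCoefficient (fourierPartialSum g K) k =
      if k ∈ Finset.Icc (-(K : ℤ)) K then fourierCoefficient g k else 0 := by
  have h : fourierCoefficient (fourierPartialSum g K) k =
      ∑ j ∈ Finset.Icc (-(K : ℤ)) K, fourierCoefficient g j * fourierCoefficient (mode j) k := by
    simp only [fourierCoefficient_eq (mode _), ← integral_const_mul]
    rw [← integral_finsetSum, fourierCoefficient_eq]
    · refine integral_congr_ae (Filter.Eventually.of_forall fun x => ?_)
      simp only [fourierPartialSum, Finset.mul_sum, mode]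
      exact Finset.sum_congr rfl fun _ _ => by ring
    · intro j _
      exact (integrable_mode_mul (continuous_mode j).integrable_unitMeasure _).const_mul _
  rw [h]
  simp only [fourierCoefficient_mode, mul_ite, mul_one, mul_zero, Finset.sum_ite_eq']

/-- By Parseval, the error of the partial sum is the `ℓ²` norm of the coefficients with `|k| > K`,
hence monotone in their absolute values. This carries the tail bound from the initial datum to the
solution. -/
theorem eLpNorm_sub_fourierPartialSum_le {g h : ℝ → ℂ} (hg : MemLp g 2 unitMeasure)
    (hh : MemLp h 2 unitMeasure)
    (hgh : ∀ k, ‖fourierCoefficient g k‖ ≤ ‖fourierCoefficient h k‖) (K : ℕ) :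
    eLpNorm (fun x => g x - fourierPartialSum g K x) 2 unitMeasure ≤
      eLpNorm (fun x => h x - fourierPartialSum h K x) 2 unitMeasure := by
  have hsum {g : ℝ → ℂ} (hg : MemLp g 2 unitMeasure) :=
    hg.sub ((continuous_fourierPartialSum g K).memLp_unitMeasure 2)
  have hcoeff {g : ℝ → ℂ} (hg : MemLp g 2 unitMeasure) (k : ℤ) :
      fourierCoefficient (g - fourierPartialSum g K) k =
        if k ∈ Finset.Icc (-(K : ℤ)) K then 0 else fourierCoefficient g k := by
    refine (fourierCoefficient_sub (hg.integrable one_le_two)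
      (continuous_fourierPartialSum g K).integrable_unitMeasure k).trans ?_
    rw [fourierCoefficient_fourierPartialSum]
    split_ifs <;> simp
  change eLpNorm (g - fourierPartialSum g K) 2 unitMeasure ≤
    eLpNorm (h - fourierPartialSum h K) 2 unitMeasure
  rw [eLpNorm_eq_sqrt_tsum (hsum hg), eLpNorm_eq_sqrt_tsum (hsum hh)]
  refine ENNReal.ofReal_le_ofReal (Real.sqrt_le_sqrt (Summable.tsum_le_tsum (fun k => ?_)
    (hasSum_sq_norm_fourierCoefficient (hsum hg)).summable
    (hasSum_sq_norm_fourierCoefficient (hsum hh)).summable))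
  rw [hcoeff hg, hcoeff hh]
  have := hgh k
  split_ifs <;> gcongr

/-- A continuous `1`-periodic function is determined by its Fourier coefficients. -/
theorem eq_of_fourierCoefficient_eq {g h : ℝ → ℂ} (hg : Continuous g) (hh : Continuous h)
    (hgp : ∀ x, g (x + 1) = g x) (hhp : ∀ x, h (x + 1) = h x)
    (hgh : ∀ k, fourierCoefficient g k = fourierCoefficient h k) : g = h := by
  have hzero : eLpNorm (g - h) 2 unitMeasure = 0 := by
    have hcoeff (k : ℤ) : fourierCoefficient (g - h) k = 0 :=
      (fourierCoefficient_sub hg.integrable_unitMeasure hh.integrable_unitMeasure k).trans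
        (sub_eq_zero.2 (hgh k))
    rw [eLpNorm_eq_sqrt_tsum ((hg.memLp_unitMeasure 2).sub (hh.memLp_unitMeasure 2))]
    simp [hcoeff]
  have hae : g =ᵐ[volume.restrict (Set.Icc 0 1)] h := by
    rw [eLpNorm_eq_zero_iff (hg.sub hh).aestronglyMeasurable (by simp)] at hzero
    filter_upwards [hzero] with x hx
    simpa [sub_eq_zero] using hx
  have hIcc : Set.EqOn g h (Set.Icc 0 1) :=
    Measure.eqOn_Icc_of_ae_eq volume zero_ne_one hae hg.continuousOn hh.continuousOn
  have hper : Function.Periodic g 1 := hgp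
  have hper' : Function.Periodic h 1 := hhp
  funext x
  obtain ⟨y, hy, hxy⟩ := (hper.sub hper').exists_mem_Ico₀ zero_lt_one x
  have := hIcc (Set.Ico_subset_Icc_self hy)
  have h0 : (g - h) x = 0 := by rw [hxy]; simp [this]
  exact sub_eq_zero.1 h0

end PeriodicHeat

end

noncomputable section

namespace PeriodicHeat

open MeasureTheory Filter Topology

/-! ### The solution of the heat equation -/

/-- The damping factor `exp(-4π²k²s)`. -/
def decay (k : ℤ) (s : ℝ) : ℝ :=
  Real.exp (-(4 * Real.pi ^ 2 * s * (k : ℝ) ^ 2))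

theorem decay_pos (k : ℤ) (s : ℝ) : 0 < decay k s := Real.exp_pos _

theorem decay_zero (k : ℤ) : decay k 0 = 1 := by simp [decay]

theorem decay_antitone (k : ℤ) : Antitone (decay k) := by
  intro s t hst
  unfold decay
  gcongr

theorem decay_le_one (k : ℤ) {s : ℝ} (hs : 0 ≤ s) : decay k s ≤ 1 :=
  (decay_antitone k hs).trans_eq (decay_zero k)

theorem continuous_decay (k : ℤ) : Continuous (decay k) := by
  unfold decay
  fun_prop

theorem hasDerivAt_decay (k : ℤ) (s : ℝ) :
    HasDerivAt (fun s => (decay k s : ℂ)) ((2 * Real.pi * Complex.I * k) ^ 2 * decay k s) s := by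
  have h : HasDerivAt (fun s => -(4 * Real.pi ^ 2 * s * (k : ℝ) ^ 2))
      (-(4 * Real.pi ^ 2 * 1 * (k : ℝ) ^ 2)) s :=
    (((hasDerivAt_id s).const_mul _).mul_const _).neg
  refine h.exp.ofReal_comp.congr_deriv ?_
  rw [mul_pow, mul_pow, Complex.I_sq]
  unfold decay
  push_cast
  ring

theorem summable_pow_mul_decay (j : ℕ) {s : ℝ} (hs : 0 < s) :
    Summable fun k : ℤ => (2 * Real.pi * |(k : ℝ)|) ^ j * decay k s := by
  -- For `T = 4πs` the theta bound `exp(-πTk²)` is exactly the damping factor.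
  have h := (summable_pow_mul_jacobiTheta₂_term_bound 0
    (T := 4 * Real.pi * s) (by positivity) j).mul_left ((2 * Real.pi) ^ j)
  refine h.congr fun k => ?_
  rw [decay, mul_pow (2 * Real.pi), mul_assoc ((2 * Real.pi) ^ j), Int.cast_abs]
  congr 3
  ring

/-- The general term of the `j`-th space derivative of the solution of the heat equation whose
initial datum has Fourier coefficients `a`. -/
def heatTerm (a : ℤ → ℂ) (j : ℕ) (k : ℤ) (x s : ℝ) : ℂ :=
  (2 * Real.pi * Complex.I * k) ^ j * decay k s * a k * mode k x

/-- The `j`-th space derivative of the solution of the heat equation whose initial datum has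
Fourier coefficients `a`. -/
def heatSeries (a : ℤ → ℂ) (j : ℕ) (x s : ℝ) : ℂ :=
  ∑' k, heatTerm a j k x s

/-- The bound is uniform in `x` and in all times `s ≥ r`. With `summable_pow_mul_decay` it is the
summable majorant behind every exchange of limits below. -/
theorem norm_heatTerm_le {a : ℤ → ℂ} {B : ℝ} (ha : ∀ k, ‖a k‖ ≤ B)
    (j : ℕ) (k : ℤ) (x : ℝ) {r s : ℝ} (hrs : r ≤ s) :
    ‖heatTerm a j k x s‖ ≤ (2 * Real.pi * |(k : ℝ)|) ^ j * decay k r * B := by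
  have hB := ha k
  have hd := decay_antitone k hrs
  have hd' := (decay_pos k r).le
  have hk : ‖(2 * Real.pi * Complex.I * k : ℂ)‖ = 2 * Real.pi * |(k : ℝ)| := by
    simp [abs_of_pos Real.pi_pos]
  rw [heatTerm, norm_mul, norm_mode, mul_one, norm_mul, norm_mul, norm_pow, hk, Complex.norm_real,
    Real.norm_of_nonneg (decay_pos k s).le]
  gcongr

theorem summable_heatTerm {a : ℤ → ℂ} {B : ℝ} (ha : ∀ k, ‖a k‖ ≤ B)
    (j : ℕ) (x : ℝ) {s : ℝ} (hs : 0 < s) :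
    Summable fun k => heatTerm a j k x s :=
  .of_norm_bounded ((summable_pow_mul_decay j hs).mul_right B) fun k =>
    norm_heatTerm_le ha j k x le_rfl

theorem continuousOn_heatSeries {a : ℤ → ℂ} {B : ℝ} (ha : ∀ k, ‖a k‖ ≤ B)
    (j : ℕ) :
    ContinuousOn (Function.uncurry (heatSeries a j)) (Set.univ ×ˢ Set.Ioi 0) := by
  rintro ⟨x, s⟩ ⟨-, hs⟩
  have hs : 0 < s := hs
  -- Convergence is uniform only away from time `0`; the times from `s / 2` on form a neighbourhood
  -- of `s`.
  have hcont : ContinuousOn (fun p : ℝ × ℝ => ∑' k, heatTerm a j k p.1 p.2)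
      (Set.univ ×ˢ Set.Ici (s / 2)) := by
    refine continuousOn_tsum (fun k => Continuous.continuousOn ?_)
      ((summable_pow_mul_decay j (half_pos hs)).mul_right B)
      fun k p hp => norm_heatTerm_le ha j k p.1 hp.2
    have := continuous_decay k
    have := continuous_mode k
    unfold heatTerm
    fun_prop
  refine ContinuousAt.continuousWithinAt (hcont.continuousAt ?_)
  exact prod_mem_nhds univ_mem (Ici_mem_nhds (half_lt_self hs))

theorem continuous_heatSeries {a : ℤ → ℂ} {B : ℝ} (ha : ∀ k, ‖a k‖ ≤ B)
    (j : ℕ) {s : ℝ} (hs : 0 < s) :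
    Continuous fun x => heatSeries a j x s := by
  refine continuous_tsum (fun k => ?_) ((summable_pow_mul_decay j hs).mul_right B)
    fun k x => norm_heatTerm_le ha j k x le_rfl
  exact continuous_const.mul (continuous_mode k)

theorem hasDerivAt_heatSeries_space {a : ℤ → ℂ} {B : ℝ} (ha : ∀ k, ‖a k‖ ≤ B)
    (j : ℕ) (x : ℝ) {s : ℝ} (hs : 0 < s) :
    HasDerivAt (fun y => heatSeries a j y s) (heatSeries a (j + 1) x s) x := by
  refine hasDerivAt_tsum (g := fun k y => heatTerm a j k y s)
    (g' := fun k y => heatTerm a (j + 1) k y s) (y₀ := x)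
    ((summable_pow_mul_decay (j + 1) hs).mul_right B)
    (fun k y => ?_) (fun k y => norm_heatTerm_le ha (j + 1) k y le_rfl)
    (summable_heatTerm ha j x hs) x
  refine ((hasDerivAt_mode k y).const_mul _).congr_deriv ?_
  rw [heatTerm]
  ring

/-- The time derivative brings down `(2πik)²`, just as two space derivatives do; for `j = 0` this is
the heat equation. -/
theorem hasDerivAt_heatSeries_time {a : ℤ → ℂ} {B : ℝ} (ha : ∀ k, ‖a k‖ ≤ B)
    (j : ℕ) (x : ℝ) {s : ℝ} (hs : 0 < s) :
    HasDerivAt (fun r => heatSeries a j x r) (heatSeries a (j + 2) x s) s := by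
  have hmem : s ∈ Set.Ioi (s / 2) := half_lt_self hs
  refine hasDerivAt_tsum_of_isPreconnected (t := Set.Ioi (s / 2)) (y₀ := s)
    ((summable_pow_mul_decay (j + 2) (half_pos hs)).mul_right B) isOpen_Ioi isPreconnected_Ioi
    (fun k r _ => ?_) (fun k r hr => norm_heatTerm_le ha (j + 2) k x (le_of_lt hr)) hmem
    (summable_heatTerm ha j x hs) hmem
  refine ((((hasDerivAt_decay k r).const_mul _).mul_const _).mul_const _).congr_deriv ?_
  rw [heatTerm]
  ring

/-- The norms of the terms are summable uniformly in `x`, so the series may be integrated termwise,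
and orthogonality leaves a single term. -/
theorem fourierCoefficient_heatSeries {a : ℤ → ℂ} {B : ℝ} (ha : ∀ k, ‖a k‖ ≤ B)
    {s : ℝ} (hs : 0 < s) (k : ℤ) :
    fourierCoefficient (fun x => heatSeries a 0 x s) k = decay k s * a k := by
  have hterm_int (i : ℤ) : Integrable (fun x => mode (-k) x * heatTerm a 0 i x s) unitMeasure :=
    integrable_mode_mul
      (Continuous.integrable_unitMeasure (continuous_const.mul (continuous_mode i))) _
  have hsum := hasSum_integral_of_summable_integral_norm hterm_int
    (.of_nonneg_of_le (fun i => by positivity) (fun i => ?_)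
      ((summable_pow_mul_decay 0 hs).mul_right B))
  · have hterm (i : ℤ) : ∫ x, mode (-k) x * heatTerm a 0 i x s ∂unitMeasure =
        if i = k then decay k s * a k else 0 := by
      have h : ∫ x, mode (-k) x * heatTerm a 0 i x s ∂unitMeasure =
          decay i s * a i * fourierCoefficient (mode i) k := by
        rw [fourierCoefficient_eq, ← integral_const_mul]
        refine integral_congr_ae (Eventually.of_forall fun x => ?_)
        simp only [heatTerm]
        ring
      rw [h, fourierCoefficient_mode]
      split_ifs with hik
      · rw [hik, mul_one]
      · rw [mul_zero]
    simp only [hterm, tsum_mul_left] at hsum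
    rw [fourierCoefficient_eq]
    exact hsum.unique (hasSum_ite_eq k _)
  · have hle (x : ℝ) : ‖mode (-k) x * heatTerm a 0 i x s‖ ≤
        (2 * Real.pi * |(i : ℝ)|) ^ 0 * decay i s * B := by
      rw [norm_mul, norm_mode, one_mul]
      exact norm_heatTerm_le ha 0 i x le_rfl
    refine (integral_mono (hterm_int i).norm (integrable_const _) hle).trans_eq ?_
    simp

theorem norm_fourierCoefficient_heatSeries_le {a : ℤ → ℂ} {B : ℝ} (ha : ∀ k, ‖a k‖ ≤ B) {s : ℝ}
    (hs : 0 < s) (k : ℤ) : ‖fourierCoefficient (fun x => heatSeries a 0 x s) k‖ ≤ ‖a k‖ := by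
  rw [fourierCoefficient_heatSeries ha hs, norm_mul, Complex.norm_real,
    Real.norm_of_nonneg (decay_pos k s).le]
  exact mul_le_of_le_one_left (norm_nonneg _) (decay_le_one k hs.le)

theorem heatSeries_add_one (a : ℤ → ℂ) (j : ℕ) (x s : ℝ) :
    heatSeries a j (x + 1) s = heatSeries a j x s := by
  simp only [heatSeries, heatTerm, mode_add_one]

/-- By Parseval, the squared distance is the sum of `((1 - decay k s) * ‖fourierCoefficient f k‖) ^
2`. Each term tends to `0` and is dominated by the summable `‖fourierCoefficient f k‖ ^ 2`. -/
theorem tendsto_eLpNorm_heatSeries_sub {f : ℝ → ℂ} (hf : MemLp f 2 unitMeasure) :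
    Tendsto (fun s => eLpNorm (fun x => heatSeries (fourierCoefficient f) 0 x s - f x) 2 unitMeasure)
      (𝓝[>] 0) (𝓝 0) := by
  have ha := norm_fourierCoefficient_le f
  have htsum : Tendsto (fun s => ∑' k, ((1 - decay k s) * ‖fourierCoefficient f k‖) ^ 2)
      (𝓝[>] 0) (𝓝 (∑' _ : ℤ, 0)) := by
    refine tendsto_tsum_of_dominated_convergence
      (hasSum_sq_norm_fourierCoefficient hf).summable (fun k => ?_) ?_
    · have h : Continuous fun s => ((1 - decay k s) * ‖fourierCoefficient f k‖) ^ 2 := by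
        have := continuous_decay k
        fun_prop
      refine (h.tendsto' 0 0 ?_).mono_left nhdsWithin_le_nhds
      simp [decay_zero]
    · filter_upwards [self_mem_nhdsWithin] with s hs k
      have h₁ := decay_pos k s
      have h₂ := decay_le_one k (le_of_lt hs)
      rw [Real.norm_of_nonneg (by positivity), mul_pow]
      exact mul_le_of_le_one_left (by positivity) (pow_le_one₀ (by linarith) (by linarith))
  rw [tsum_zero] at htsum
  have hlim := ENNReal.tendsto_ofReal (Real.continuous_sqrt.tendsto 0 |>.comp htsum)
  rw [Real.sqrt_zero, ENNReal.ofReal_zero] at hlim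
  refine hlim.congr' ?_
  filter_upwards [self_mem_nhdsWithin] with s hs
  have hcont := continuous_heatSeries ha 0 hs
  have hpars := eLpNorm_eq_sqrt_tsum ((hcont.memLp_unitMeasure 2).sub hf)
  refine Eq.trans ?_ hpars.symm
  simp only [Function.comp_apply]
  congr 3
  funext k
  have hcoeff := fourierCoefficient_sub hcont.integrable_unitMeasure (hf.integrable one_le_two) k
  rw [fourierCoefficient_heatSeries ha hs] at hcoeff
  have hcoeff' : fourierCoefficient ((fun x => heatSeries (fourierCoefficient f) 0 x s) - f) k =
      -(((1 - decay k s : ℝ) : ℂ) * fourierCoefficient f k) := by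
    refine hcoeff.trans ?_
    push_cast
    ring
  rw [hcoeff', norm_neg, norm_mul, Complex.norm_real,
    Real.norm_of_nonneg (sub_nonneg.2 (decay_le_one k (le_of_lt hs)))]

theorem isHeatSolution_heatSeries {f : ℝ → ℂ} (hf : MemLp f 2 unitMeasure) :
    IsHeatSolution f (heatSeries (fourierCoefficient f) 0) where
  periodic x s _ := heatSeries_add_one _ _ _ _
  continuousOn := continuousOn_heatSeries (norm_fourierCoefficient_le f) 0
  equation := by
    have ha := norm_fourierCoefficient_le f
    exact ⟨_, _, continuousOn_heatSeries ha 1, continuousOn_heatSeries ha 2, fun x s hs =>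
      ⟨hasDerivAt_heatSeries_space ha 0 x hs, hasDerivAt_heatSeries_space ha 1 x hs,
        hasDerivAt_heatSeries_time ha 0 x hs⟩⟩
  initial := tendsto_eLpNorm_heatSeries_sub hf

end PeriodicHeat

end

noncomputable section

namespace PeriodicHeat

open MeasureTheory Filter Topology

/-! ### Uniqueness and computability of the solution -/

/-- Integration by parts; the boundary terms cancel by periodicity. -/
theorem fourierCoefficient_deriv {g g' : ℝ → ℂ} (hg : ∀ x, HasDerivAt g (g' x) x)
    (hg' : Continuous g') (hper : ∀ x, g (x + 1) = g x) (k : ℤ) :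
    fourierCoefficient g' k = 2 * Real.pi * Complex.I * k * fourierCoefficient g k := by
  rw [fourierCoefficient_eq, fourierCoefficient_eq, integral_unitMeasure, integral_unitMeasure,
    intervalIntegral.integral_mul_deriv_eq_deriv_mul (fun x _ => hasDerivAt_mode (-k) x)
      (fun x _ => hg x)
      ((continuous_const.mul (continuous_mode _)).intervalIntegrable _ _)
      (hg'.intervalIntegrable _ _),
    ← intervalIntegral.integral_const_mul]
  have h := hper 0
  have h' := mode_add_one (-k) 0
  rw [zero_add] at h h'
  rw [h, h', sub_self, zero_sub, ← intervalIntegral.integral_neg]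
  refine intervalIntegral.integral_congr fun x _ => ?_
  push_cast
  ring

theorem periodic_deriv {g g' : ℝ → ℂ} (hg : ∀ x, HasDerivAt g (g' x) x)
    (hper : ∀ x, g (x + 1) = g x) (x : ℝ) : g' (x + 1) = g' x := by
  have h := (hg (x + 1)).comp_add_const x 1
  simp only [hper] at h
  exact h.unique (hg x)

theorem enorm_fourierCoefficient_le {g : ℝ → ℂ} (hg : AEStronglyMeasurable g unitMeasure)
    (k : ℤ) : ‖fourierCoefficient g k‖ₑ ≤ eLpNorm g 2 unitMeasure := by
  rw [fourierCoefficient_eq]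
  refine (enorm_integral_le_lintegral_enorm _).trans ?_
  refine le_trans (le_of_eq ?_) (eLpNorm_le_eLpNorm_of_exponent_le one_le_two hg)
  rw [eLpNorm_one_eq_lintegral_enorm]
  refine lintegral_congr fun x => ?_
  rw [enorm_mul, ← ofReal_norm (mode _ _), norm_mode, ENNReal.ofReal_one, one_mul]

theorem continuous_slice {w : ℝ → ℝ → ℂ}
    (hw : ContinuousOn (Function.uncurry w) (Set.univ ×ˢ Set.Ioi 0)) {s : ℝ} (hs : 0 < s) :
    Continuous fun x => w x s :=
  hw.comp_continuous (f := fun x : ℝ => (x, s)) (by fun_prop) fun _ => ⟨trivial, hs⟩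

theorem hasDerivAt_fourierCoefficient {w w' : ℝ → ℝ → ℂ}
    (hw : ContinuousOn (Function.uncurry w) (Set.univ ×ˢ Set.Ioi 0))
    (hw' : ContinuousOn (Function.uncurry w') (Set.univ ×ˢ Set.Ioi 0))
    (hderiv : ∀ x s, 0 < s → HasDerivAt (fun r => w x r) (w' x s) s) (k : ℤ) {s : ℝ} (hs : 0 < s) :
    HasDerivAt (fun r => fourierCoefficient (fun x => w x r) k)
      (fourierCoefficient (fun x => w' x s) k) s := by
  have hpos {r : ℝ} (hr : r ∈ Set.Icc (s / 2) (2 * s)) : 0 < r := (half_pos hs).trans_le hr.1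
  -- On a compact rectangle around time `s` the time derivative is bounded, and a constant is
  -- integrable on `[0, 1]`.
  obtain ⟨C, hC⟩ := (isCompact_Icc.prod isCompact_Icc).exists_bound_of_continuousOn
    (hw'.mono (t := Set.Icc 0 1 ×ˢ Set.Icc (s / 2) (2 * s)) fun p hp => ⟨trivial, hpos hp.2⟩)
  simp only [fourierCoefficient_eq]
  refine (hasDerivAt_integral_of_dominated_loc_of_deriv_le (bound := fun _ => C)
    (F := fun r x => mode (-k) x * w x r) (F' := fun r x => mode (-k) x * w' x r)
    (Icc_mem_nhds (half_lt_self hs) (by linarith : s < 2 * s)) ?_ ?_ ?_ ?_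
    (integrable_const _) ?_).2
  · filter_upwards [lt_mem_nhds hs] with r hr
    exact ((continuous_mode _).mul (continuous_slice hw hr)).aestronglyMeasurable
  · exact ((continuous_mode _).mul (continuous_slice hw hs)).integrable_unitMeasure
  · exact ((continuous_mode _).mul (continuous_slice hw' hs)).aestronglyMeasurable
  · refine (ae_restrict_iff' measurableSet_Icc).2 (Eventually.of_forall fun x hx r hr => ?_)
    rw [norm_mul, norm_mode, one_mul]
    exact hC (x, r) ⟨hx, hr⟩
  · exact Eventually.of_forall fun x r hr => (hderiv x r (hpos hr)).const_mul _

/-- The `k`-th coefficient and `decay k` solve the same linear ODE, so their quotient is constant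
for positive times. Its limit at `0` is the coefficient of `f`, since a Fourier coefficient is at
most the `L²` norm. -/
theorem IsHeatSolution.fourierCoefficient_eq {f : ℝ → ℂ} (hf : MemLp f 2 unitMeasure)
    {v : ℝ → ℝ → ℂ} (hv : IsHeatSolution f v) (k : ℤ) {s : ℝ} (hs : 0 < s) :
    fourierCoefficient (fun x => v x s) k = decay k s * fourierCoefficient f k := by
  obtain ⟨vx, vxx, hvx, hvxx, heq⟩ := hv.equation
  set z : ℂ := 2 * Real.pi * Complex.I * k with hz
  have hode {r : ℝ} (hr : 0 < r) :
      HasDerivAt (fun r => fourierCoefficient (fun x => v x r) k)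
        (z ^ 2 * fourierCoefficient (fun x => v x r) k) r := by
    have h := hasDerivAt_fourierCoefficient hv.continuousOn hvxx
      (fun x s hs => (heq x s hs).2.2) k hr
    rw [fourierCoefficient_deriv (fun x => (heq x r hr).2.1) (continuous_slice hvxx hr)
      (periodic_deriv (fun x => (heq x r hr).1) fun x => hv.periodic x r hr),
      fourierCoefficient_deriv (fun x => (heq x r hr).1) (continuous_slice hvx hr)
      (fun x => hv.periodic x r hr), ← mul_assoc, ← sq] at h
    exact h
  have hne (r : ℝ) : (decay k r : ℂ) ≠ 0 := Complex.ofReal_ne_zero.2 (decay_pos k r).ne'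
  have hquot {r : ℝ} (hr : 0 < r) :
      HasDerivAt (fun r => fourierCoefficient (fun x => v x r) k / decay k r) 0 r := by
    refine ((hode hr).div (hasDerivAt_decay k r) (hne r)).congr_deriv ?_
    rw [← hz]
    ring
  have hconst {r : ℝ} (hr : 0 < r) : fourierCoefficient (fun x => v x r) k / decay k r =
      fourierCoefficient (fun x => v x s) k / decay k s :=
    isOpen_Ioi.is_const_of_deriv_eq_zero (s := Set.Ioi (0 : ℝ)) isPreconnected_Ioi
      (fun r hr => (hquot hr).differentiableAt.differentiableWithinAt)
      (fun r hr => (hquot hr).deriv) hr hs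
  have hcoeff : Tendsto (fun r => fourierCoefficient (fun x => v x r) k) (𝓝[>] 0)
      (𝓝 (fourierCoefficient f k)) := by
    rw [tendsto_iff_edist_tendsto_0]
    refine tendsto_of_tendsto_of_tendsto_of_le_of_le' tendsto_const_nhds hv.initial
      (Eventually.of_forall fun _ => zero_le) ?_
    filter_upwards [self_mem_nhdsWithin] with r hr
    have hvr := continuous_slice hv.continuousOn hr
    rw [edist_eq_enorm_sub, ← fourierCoefficient_sub hvr.integrable_unitMeasure
      (hf.integrable one_le_two)]
    exact enorm_fourierCoefficient_le
      (hvr.aestronglyMeasurable.sub hf.aestronglyMeasurable) k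
  have hdecay : Tendsto (fun r => (decay k r : ℂ)) (𝓝[>] 0) (𝓝 1) :=
    ((Complex.continuous_ofReal.comp (continuous_decay k)).tendsto' 0 1
      (by simp [decay_zero])).mono_left nhdsWithin_le_nhds
  have hlim := (hcoeff.div hdecay one_ne_zero).congr' (f₂ := fun _ =>
    fourierCoefficient (fun x => v x s) k / decay k s) (by
      filter_upwards [self_mem_nhdsWithin] with r hr using hconst hr)
  have h := tendsto_nhds_unique hlim tendsto_const_nhds
  rw [div_one] at h
  rw [h, mul_div_cancel₀ _ (hne s)]

theorem IsHeatSolution.eq_heatSeries {f : ℝ → ℂ} (hf : MemLp f 2 unitMeasure) {v : ℝ → ℝ → ℂ}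
    (hv : IsHeatSolution f v) (x : ℝ) {s : ℝ} (hs : 0 < s) :
    v x s = heatSeries (fourierCoefficient f) 0 x s := by
  have ha := norm_fourierCoefficient_le f
  refine congrFun (eq_of_fourierCoefficient_eq (continuous_slice hv.continuousOn hs)
    (continuous_heatSeries ha 0 hs) (fun x => hv.periodic x s hs)
    (fun x => heatSeries_add_one _ _ _ _) fun k => ?_) x
  rw [hv.fourierCoefficient_eq hf k hs, fourierCoefficient_heatSeries ha hs]

theorem natApproximable_natCast (m : ℕ) : NatApproximable m :=
  ⟨fun n => m * 2 ^ n, fun n => by simp, (Computes.constNat m).mul (Computes.refl _).twoPow⟩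

theorem FourierPolyTime.heatSeries {t : ℝ} (ht : 0 < t) (htc : PolyTimeReal t) {f : ℝ → ℂ}
    (hf : FourierPolyTime f) :
    FourierPolyTime fun x => PeriodicHeat.heatSeries (fourierCoefficient f) 0 x t := by
  have ha := norm_fourierCoefficient_le f
  have hmem := (continuous_heatSeries ha 0 ht).memLp_unitMeasure 2
  refine ⟨hmem, ?_, ?_⟩
  · have hpi := natApproximable_pi
    -- The rate `4π²t` is bracketed so that `NatApproximable.mul` always has a visibly nonnegative
    -- first factor.
    have hs : NatApproximable (((4 : ℕ) : ℝ) * (Real.pi * (Real.pi * t))) :=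
      (natApproximable_natCast 4).mul (hpi.mul (hpi.mul (htc.natApproximable ht.le)
        Real.pi_pos.le) Real.pi_pos.le) (Nat.cast_nonneg _)
    obtain ⟨c, hc, hre, him⟩ := hf.approx
    obtain ⟨c', hc', hre', him'⟩ := exists_damped_approx hs (by positivity) ha hc hre him
    refine ⟨c', fun k n => ?_, hre', him'⟩
    rw [fourierCoefficient_heatSeries ha ht]
    refine le_of_eq_of_le ?_ (hc' k n)
    rw [decay]
    congr 6
    push_cast
    ring
  -- Damping only decreases the coefficients, so the polynomial of `f` serves again.
  · obtain ⟨q, hq⟩ := hf.tail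
    exact ⟨q, fun m => (eLpNorm_sub_fourierPartialSum_le hmem hf.memLp
      (norm_fourierCoefficient_heatSeries_le ha ht) _).trans (hq m)⟩

end PeriodicHeat

theorem theoremt (t : ℝ) (ht : 0 < t) (htc : PeriodicHeat.PolyTimeReal t)
    (f : ℝ → ℂ) (hf : PeriodicHeat.FourierPolyTime f) :
    ∃ u : ℝ → ℝ → ℂ,
      PeriodicHeat.IsHeatSolution f u ∧
      (∀ v : ℝ → ℝ → ℂ, PeriodicHeat.IsHeatSolution f v → ∀ x s, 0 < s → v x s = u x s) ∧
      PeriodicHeat.FourierPolyTime (fun x => u x t) :=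
  ⟨PeriodicHeat.heatSeries (PeriodicHeat.fourierCoefficient f) 0,
    PeriodicHeat.isHeatSolution_heatSeries hf.memLp,
    fun _ hv x _ hs => hv.eq_heatSeries hf.memLp x hs, hf.heatSeries ht htc⟩

end
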